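/- Let $R$ be a commutative Artin ring and let $\Lambda$ and $\Gamma$ be Artin $R$-algebras (i.e. $R$-algebras that are finitely generated as $R$-modules). Modules are left modules unless stated otherwise, and $R$ acts centrally on all bimodules. Suppose that $\Lambda$ and $\Gamma$ are stably equivalent of adjoint type, that is, there are bimodules ${}_\Lambda M_\Gamma$ and ${}_\Gamma N_\Lambda$, finitely generated and projective as left modules and as right modules, and bimodules ${}_\Lambda P_\Lambda$ and ${}_\Gamma Q_\Gamma$ which are projective as bimodules (over $\Lambda\otimes_R\Lambda^{\mathrm{op}}$ and $\Gamma\otimes_R\Gamma^{\mathrm{op}}$ respectively), such that $$M\otimes_\Gamma N\cong \Lambda\oplus P,\qquad N\otimes_\Lambda M\cong \Gamma\oplus Q$$ as bimodules, and such that both $(M\otimes_\Gamma-,\,N\otimes_\Lambda-)$ and $(N\otimes_\Lambda-,\,M\otimes_\Gamma-)$ are adjoint pairs of functors between the categories of left $\Gamma$-modules and left $\Lambda$-modules. Then $\Lambda$ is a tilted algebra if and only if $\Gamma$ is a tilted algebra. Here an Artin $R$-algebra is called tilted if it is isomorphic, as an $R$-algebra, to $\operatorname{End}_H(T)$ for some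 hereditary Artin $R$-algebra $H$ (every left ideal of $H$ is projective) and some $1$-tilting $H$-module $T$. A finitely generated $H$-module $T$ is $1$-tilting if $\operatorname{pd}_H T\le 1$, $\operatorname{Ext}_H^{j}(T,T)=0$ for all $j\ge 1$, and there is an exact sequence $0\to H\to T_0\to T_1\to 0$ with $T_0$ and $T_1$ isomorphic to direct summands of finite direct sums of copies of $T$. -/

import Mathlib

open CategoryTheory TensorProduct

universe v u

/-! ### Tensor products over a noncommutative ring -/

section BalancedTensor

variable (A B M X : Type u) [Ring A] [Ring B] [AddCommGroup M] [Module A M] [Module Bᵐᵒᵖ M]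
  [AddCommGroup X] [Module B X]

/-- The relations `(m b) ⊗ x - m ⊗ (b x)` inside `M ⊗_ℤ X`, for an `A`-`B`-bimodule `M` and a left
`B`-module `X`. This set is stable under `A`, so its `A`-span is the subgroup it generates. -/
def balancedRel : Submodule A (M ⊗[ℤ] X) :=
  Submodule.span A {t | ∃ (m : M) (b : B) (x : X),
    t = (MulOpposite.op b • m) ⊗ₜ[ℤ] x - m ⊗ₜ[ℤ] (b • x)}

/-- The tensor product `M ⊗_B X` of an `A`-`B`-bimodule `M` with a left `B`-module `X`,
as a left `A`-module. -/
abbrev BalancedTensor : Type u := (M ⊗[ℤ] X) ⧸ balancedRel A B M X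

variable {X} {Y Z : Type u} [AddCommGroup Y] [Module B Y] [AddCommGroup Z] [Module B Z]

/-- The `A`-linear map `M ⊗_B f : M ⊗_B X → M ⊗_B Y`, `m ⊗ x ↦ m ⊗ f x`. -/
noncomputable def BalancedTensor.map (f : X →ₗ[B] Y) :
    BalancedTensor A B M X →ₗ[A] BalancedTensor A B M Y :=
  Submodule.mapQ _ _ (TensorProduct.AlgebraTensorModule.lTensor A M (f.restrictScalars ℤ)) <| by
    refine Submodule.span_le.2 ?_
    rintro _ ⟨m, b, x, rfl⟩
    refine Submodule.subset_span ⟨m, b, f x, ?_⟩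
    simp [map_sub]

variable {A B M}

/-- The class of `m ⊗ x` in `M ⊗_B X`. -/
def BalancedTensor.tmul (m : M) (x : X) : BalancedTensor A B M X :=
  (balancedRel A B M X).mkQ (m ⊗ₜ[ℤ] x)

@[simp]
theorem BalancedTensor.map_tmul (f : X →ₗ[B] Y) (m : M) (x : X) :
    BalancedTensor.map A B M f (BalancedTensor.tmul m x) = BalancedTensor.tmul m (f x) := rfl

theorem BalancedTensor.smul_tmul (m : M) (b : B) (x : X) :
    (BalancedTensor.tmul (MulOpposite.op b • m) x : BalancedTensor A B M X)
      = BalancedTensor.tmul m (b • x) :=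
  (Submodule.Quotient.eq _).2 (Submodule.subset_span ⟨m, b, x, rfl⟩)

theorem BalancedTensor.left_smul_tmul (a : A) (m : M) (x : X) :
    a • (BalancedTensor.tmul m x : BalancedTensor A B M X) = BalancedTensor.tmul (a • m) x := rfl

theorem BalancedTensor.tmul_add (m : M) (x y : X) :
    (BalancedTensor.tmul m (x + y) : BalancedTensor A B M X)
      = BalancedTensor.tmul m x + BalancedTensor.tmul m y := by
  simp only [BalancedTensor.tmul, TensorProduct.tmul_add, map_add]

theorem BalancedTensor.tmul_zero (m : M) :
    (BalancedTensor.tmul m (0 : X) : BalancedTensor A B M X) = 0 := by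
  simp only [BalancedTensor.tmul, TensorProduct.tmul_zero, map_zero]

theorem BalancedTensor.hom_ext {W : Type*} [AddCommGroup W] {f g : BalancedTensor A B M X →+ W}
    (h : ∀ m x, f (BalancedTensor.tmul m x) = g (BalancedTensor.tmul m x)) : f = g := by
  ext t
  obtain ⟨t, rfl⟩ := Submodule.mkQ_surjective _ t
  induction t using TensorProduct.induction_on with
  | zero => simp
  | tmul m x => exact h m x
  | add s t hs ht => rw [map_add, map_add, map_add, hs, ht]

theorem BalancedTensor.linearMap_ext {W : Type*} [AddCommGroup W] [Module A W]
    {f g : BalancedTensor A B M X →ₗ[A] W}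
    (h : ∀ m x, f (BalancedTensor.tmul m x) = g (BalancedTensor.tmul m x)) : f = g := by
  have := BalancedTensor.hom_ext (f := f.toAddMonoidHom) (g := g.toAddMonoidHom) h
  exact LinearMap.ext fun t => DFunLike.congr_fun this t

end BalancedTensor

/-! ### Bimodules over `R`-algebras -/

section Bimodules

variable (R : Type v) [CommRing R]

/-- An `A`-`B`-bimodule over two `R`-algebras on which `R` acts centrally, that is,
a module over `A ⊗_R Bᵒᵖ`. -/
structure CentralBimodule (A B : Type u) [Ring A] [Algebra R A] [Ring B] [Algebra R B] where
  carrier : Type u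
  [addCommGroup : AddCommGroup carrier]
  [leftModule : Module A carrier]
  [rightModule : Module Bᵐᵒᵖ carrier]
  [smulComm : SMulCommClass A Bᵐᵒᵖ carrier]
  central : ∀ (r : R) (m : carrier),
    algebraMap R A r • m = MulOpposite.op (algebraMap R B r) • m

namespace CentralBimodule

attribute [instance] addCommGroup leftModule rightModule smulComm

variable {R} {A B C : Type u} [Ring A] [Algebra R A] [Ring B] [Algebra R B] [Ring C] [Algebra R C]

instance : CoeSort (CentralBimodule R A B) (Type u) := ⟨carrier⟩

/-- Finitely generated and projective as a left `A`-module and as a right `B`-module. -/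
structure IsOneSidedFGProjective (M : CentralBimodule R A B) : Prop where
  finite_left : Module.Finite A M
  projective_left : Module.Projective A M
  finite_right : Module.Finite Bᵐᵒᵖ M
  projective_right : Module.Projective Bᵐᵒᵖ M

/-- The action of `R` on a bimodule. -/
abbrev baseModule (M : CentralBimodule R A B) : Module R M :=
  Module.compHom M (algebraMap R A)

/-- A bimodule as a module over the enveloping algebra: `(a ⊗ b) m = a m b`. -/
noncomputable abbrev envelopingModule (M : CentralBimodule R A B) : Module (A ⊗[R] Bᵐᵒᵖ) M :=
  letI := M.baseModule
  haveI : IsScalarTower R A M := ⟨fun r a m => by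
    change (r • a) • m = algebraMap R A r • (a • m)
    rw [Algebra.smul_def, mul_smul]⟩
  haveI : IsScalarTower R Bᵐᵒᵖ M := ⟨fun r b m => by
    change (r • b) • m = algebraMap R A r • (b • m)
    rw [Algebra.smul_def, mul_smul, M.central]
    rfl⟩
  TensorProduct.Algebra.module

/-- Projective as a bimodule, that is, as a module over `A ⊗_R Bᵒᵖ`. -/
def IsProjective (M : CentralBimodule R A B) : Prop :=
  letI := M.envelopingModule
  Module.Projective (A ⊗[R] Bᵐᵒᵖ) M

/-- Isomorphism of bimodules. -/
def Isomorphic (M N : CentralBimodule R A B) : Prop :=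
  ∃ e : M ≃ₗ[A] N, ∀ (b : Bᵐᵒᵖ) (m : M), e (b • m) = b • e m

variable (R A) in
/-- The regular bimodule `A`. -/
abbrev regular : CentralBimodule R A A where
  carrier := A
  central r m := by
    rw [smul_eq_mul, op_smul_eq_mul, Algebra.commutes]

/-- The direct sum of two bimodules. -/
abbrev directSum (M N : CentralBimodule R A B) : CentralBimodule R A B where
  carrier := M × N
  central r m := Prod.ext (M.central r m.1) (N.central r m.2)

/-- Right multiplication by an element of `B`, as a left `A`-linear map. -/
def rightMul (M : CentralBimodule R A B) (b : Bᵐᵒᵖ) : M →ₗ[A] M where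
  toFun m := b • m
  map_add' := smul_add b
  map_smul' a m := (smul_comm a b m).symm

@[simp]
theorem rightMul_apply (M : CentralBimodule R A B) (b : Bᵐᵒᵖ) (m : M) :
    M.rightMul b m = b • m := rfl

/-- Right multiplication by an element of `C` on a `B`-`C`-bimodule, as an action of `Cᵒᵖ` by left
`A`-linear endomorphisms on the tensor product: `(m ⊗ n) c = m ⊗ (n c)`. -/
noncomputable def tensorRight (M : CentralBimodule R A B) (N : CentralBimodule R B C) :
    Cᵐᵒᵖ →+* Module.End A (BalancedTensor A B M N) where
  toFun c := BalancedTensor.map A B M (N.rightMul c)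
  map_one' := BalancedTensor.linearMap_ext fun m n => by simp
  map_mul' c d := BalancedTensor.linearMap_ext fun m n => by simp [mul_smul]
  map_zero' := BalancedTensor.linearMap_ext fun m n => by
    simp [BalancedTensor.tmul_zero]
  map_add' c d := BalancedTensor.linearMap_ext fun m n => by
    simp [add_smul, BalancedTensor.tmul_add]

/-- The tensor product `M ⊗_B N` as an `A`-`C`-bimodule. -/
noncomputable abbrev tensor (M : CentralBimodule R A B) (N : CentralBimodule R B C) :
    CentralBimodule R A C :=
  letI : Module Cᵐᵒᵖ (BalancedTensor A B M N) := Module.compHom _ (M.tensorRight N)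
  { carrier := BalancedTensor A B M N
    smulComm := ⟨fun a c t => ((M.tensorRight N c).map_smul a t).symm⟩
    central := fun r t => by
      have h : DistribSMul.toAddMonoidHom (BalancedTensor A B M N) (algebraMap R A r)
          = (M.tensorRight N (MulOpposite.op (algebraMap R C r))).toAddMonoidHom :=
        BalancedTensor.hom_ext fun m n => by
          change BalancedTensor.tmul (algebraMap R A r • m) n
            = BalancedTensor.tmul m (MulOpposite.op (algebraMap R C r) • n)
          rw [M.central, BalancedTensor.smul_tmul, N.central]
      exact DFunLike.congr_fun h t }

/-- The functor `M ⊗_B - : Mod B ⥤ Mod A`. -/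
noncomputable def tensorFunctor (M : CentralBimodule R A B) : ModuleCat.{u} B ⥤ ModuleCat.{u} A where
  obj X := ModuleCat.of A (BalancedTensor A B M X)
  map f := ModuleCat.ofHom (BalancedTensor.map A B M f.hom)
  map_id X := ModuleCat.hom_ext (BalancedTensor.linearMap_ext fun m x => by simp)
  map_comp f g := ModuleCat.hom_ext (BalancedTensor.linearMap_ext fun m x => by simp)

end CentralBimodule

/-- The `R`-algebras `Λ` and `Γ` are stably equivalent of adjoint type: there are bimodules
`_ΛM_Γ` and `_ΓN_Λ`, finitely generated projective on each side, with bimodule isomorphisms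
`M ⊗_Γ N ≅ Λ ⊕ P` and `N ⊗_Λ M ≅ Γ ⊕ Q` for projective bimodules `P` and `Q`, such that
`(M ⊗_Γ -, N ⊗_Λ -)` and `(N ⊗_Λ -, M ⊗_Γ -)` are adjoint pairs of functors. -/
def StablyEquivalentOfAdjointType (Λ Γ : Type u) [Ring Λ] [Algebra R Λ] [Ring Γ] [Algebra R Γ] :
    Prop :=
  ∃ (M : CentralBimodule R Λ Γ) (N : CentralBimodule R Γ Λ)
    (P : CentralBimodule R Λ Λ) (Q : CentralBimodule R Γ Γ),
    M.IsOneSidedFGProjective ∧ N.IsOneSidedFGProjective ∧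
    P.IsProjective ∧ Q.IsProjective ∧
    (M.tensor N).Isomorphic ((CentralBimodule.regular R Λ).directSum P) ∧
    (N.tensor M).Isomorphic ((CentralBimodule.regular R Γ).directSum Q) ∧
    Nonempty (M.tensorFunctor ⊣ N.tensorFunctor) ∧
    Nonempty (N.tensorFunctor ⊣ M.tensorFunctor)

end Bimodules

/-! ### Tilting modules and tilted algebras -/

/-- `X ∈ add T`: `X` is isomorphic to a direct summand of `Tⁿ` for some `n`. -/
def MemAdd (H : Type u) [Ring H] (T X : Type u) [AddCommGroup T] [Module H T]
    [AddCommGroup X] [Module H X] : Prop :=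
  ∃ (n : ℕ) (i : X →ₗ[H] (Fin n → T)) (p : (Fin n → T) →ₗ[H] X), p ∘ₗ i = LinearMap.id

/-- `T` is a `1`-tilting (left) `H`-module: it is finitely generated, `pd T ≤ 1`,
`Ext^j(T, T) = 0` for all `j ≥ 1`, and there is an exact sequence `0 → H → T₀ → T₁ → 0` with
`T₀, T₁ ∈ add T`. -/
structure IsOneTilting (H : Type u) [Ring H] (T : Type u) [AddCommGroup T] [Module H T] : Prop where
  finite : Module.Finite H T
  projectiveDimension_le : HasProjectiveDimensionLE (ModuleCat.of H T) 1
  ext_eq_zero : ∀ j : ℕ, 1 ≤ j →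
    Subsingleton (Abelian.Ext.{u} (ModuleCat.of H T) (ModuleCat.of H T) j)
  exists_coresolution : ∃ (T₀ T₁ : ModuleCat.{u} H) (f : H →ₗ[H] T₀) (g : T₀ →ₗ[H] T₁),
    MemAdd H T T₀ ∧ MemAdd H T T₁ ∧
    Function.Injective f ∧ Function.Exact f g ∧ Function.Surjective g

/-- Every left ideal is projective. -/
def IsHereditary (H : Type u) [Ring H] : Prop :=
  ∀ I : Submodule H H, Module.Projective H I

/-- The `R`-algebra `Λ` is tilted: it is isomorphic to the endomorphism algebra of a `1`-tilting
module over a hereditary Artin `R`-algebra. -/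
def IsTiltedAlgebra (R : Type v) [CommRing R] (Λ : Type u) [Ring Λ] [Algebra R Λ] : Prop :=
  ∃ (H : Type u) (_ : Ring H) (_ : Algebra R H) (T : Type u) (_ : AddCommGroup T)
    (_ : Module H T) (_ : Module R T) (_ : IsScalarTower R H T),
    Module.Finite R H ∧ IsHereditary H ∧ IsOneTilting H T ∧ Nonempty (Λ ≃ₐ[R] Module.End H T)

/-! The hypothesis is symmetric, so one implication suffices. Let A = End_H(T) be tilted and let B
be the other algebra, with N ⊗_A M ≅ B ⊕ Q. The plan is to confine Q to a semisimple block of B and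
to recognise the remaining block as an endomorphism ring of a tilting module.

A hereditary ring has no nonzero central nilpotents, so nilpotents of R act as zero on A, and then
on B because M is faithful over B. All R-linear sequences of B-modules therefore split. Hence Q ⊗_B
X is projective for every X, and Hom_B(Q ⊗ -, Y) is exact. Cancelling Hom_B(X, Y) from the two
adjunction formulas for Hom_A(M ⊗ X, M ⊗ Y) shows that Hom_B(Q ⊗ X, Y) and Hom_B(X, Q ⊗ Y) have the
same R-length for finitely generated X, Y. This numerical self-adjointness makes Q ⊗ Y injective for
finitely generated Y. It also gives a nonzero map from V = M ⊗ (Q ⊗ B) to each of its nonzero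
submodules. Moreover V is projective and injective over A.

The core is `ActsAsEnd.isSemisimpleModule`: such a V is semisimple. Otherwise each nonsemisimple
indecomposable summand E of V has a proper simple submodule, which is a quotient of another such
summand E', and E' → E is nonzero and not bijective. The duality Hom_A(-, T) moves these maps to
indecomposables of add T, where by the Happel–Ringel lemma each is injective or surjective. A proper
surjection can only be followed by a proper surjection, since followed by an injection it gives a
nonzero composite that is neither; lengths forbid endless surjections. So all the maps are proper
injections, and lengths grow beyond that of Hom_A(V, T).

Semisimplicity descends from V to Q ⊗ B. Being projective and injective, this module splits off a
semisimple block: there is a central idempotent c of B killing Q ⊗ B with B/Bc semisimple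
(`exists_central_idempotent`). On the block Bc the functor M ⊗ - is fully faithful, so c is central
in End_A(M) and End_A(M)c is Bc (`exists_smul_eq`). Since M is projective and generates A, U =
Hom_A(M, T) has the same additive closure as T. Hence c acts on U as a central idempotent ε of H
(`exists_central_idempotent_smul_eq`). Then εU is tilting over the hereditary ring H/H(1-ε) with
endomorphism ring Bc, so B ≅ End(εU) × B/Bc is a product of two tilted algebras. -/

set_option linter.unusedVariables false

/-! ### Vanishing of Ext¹ as extension of maps, and the additive closure of a module -/

section ExtOne

variable {H : Type u} [Ring H] {K L T X Y : Type u} [AddCommGroup K] [Module H K]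
  [AddCommGroup L] [Module H L] [AddCommGroup T] [Module H T] [AddCommGroup X] [Module H X]
  [AddCommGroup Y] [Module H Y]

/-- If `Ext¹(Y, X) = 0`, linear maps into `X` extend along injections with cokernel `Y`. -/
theorem exists_extend_of_ext_one
    (h : Subsingleton (Abelian.Ext.{u} (ModuleCat.of H Y) (ModuleCat.of H X) 1))
    (i : K →ₗ[H] L) (p : L →ₗ[H] Y) (hi : Function.Injective i) (hip : Function.Exact i p)
    (hp : Function.Surjective p) (g : K →ₗ[H] X) : ∃ f : L →ₗ[H] X, f ∘ₗ i = g := by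
  let S : ShortComplex (ModuleCat.{u} H) := ShortComplex.mk (ModuleCat.ofHom i) (ModuleCat.ofHom p)
    (by ext x; exact hip.apply_apply_eq_zero x)
  have hS : S.ShortExact :=
    { exact := (ShortComplex.ShortExact.moduleCat_exact_iff_function_exact S).2 hip
      mono_f := (ModuleCat.mono_iff_injective _).2 hi
      epi_g := (ModuleCat.epi_iff_surjective _).2 hp }
  obtain ⟨x, hx⟩ := Abelian.Ext.contravariant_sequence_exact₁ hS _
    (Abelian.Ext.mk₀ (ModuleCat.ofHom g)) (add_zero 1) (h.elim _ _)
  obtain ⟨f, rfl⟩ := (Abelian.Ext.mk₀_bijective _ _).2 x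
  rw [Abelian.Ext.mk₀_comp_mk₀] at hx
  have := (Abelian.Ext.mk₀_bijective _ _).1 hx
  exact ⟨f.hom, congrArg ModuleCat.Hom.hom this⟩

/-- This replaces maps to and from Tⁿ by an identity 1 = ∑ bⱼ aⱼ factoring through T, the form in
which add T enters every later computation. -/
theorem MemAdd.exists_sum {H : Type u} [Ring H] {T X : Type u} [AddCommGroup T] [Module H T]
    [AddCommGroup X] [Module H X] (h : MemAdd H T X) :
    ∃ (n : ℕ) (a : Fin n → (X →ₗ[H] T)) (b : Fin n → (T →ₗ[H] X)),
      ∀ x, ∑ j, b j (a j x) = x := by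
  obtain ⟨n, i, p, hpi⟩ := h
  refine ⟨n, fun j => LinearMap.proj j ∘ₗ i, fun j => p ∘ₗ LinearMap.single H (fun _ => T) j,
    fun x => ?_⟩
  simp only [LinearMap.comp_apply, LinearMap.proj_apply]
  rw [← map_sum]
  have : ∑ j, LinearMap.single H (fun _ => T) j (i x j) = i x := by
    ext k
    simp [Finset.sum_apply, Pi.single_apply]
  rw [this]
  exact LinearMap.congr_fun hpi x

theorem MemAdd.of_sum {n : ℕ} (a : Fin n → (X →ₗ[H] T)) (b : Fin n → (T →ₗ[H] X))
    (h : ∀ x, ∑ j, b j (a j x) = x) : MemAdd H T X := by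
  refine ⟨n, LinearMap.pi a, ∑ j, b j ∘ₗ LinearMap.proj j, LinearMap.ext fun x => ?_⟩
  simpa using h x

theorem MemAdd.refl : MemAdd H T T :=
  MemAdd.of_sum (n := 1) (fun _ => LinearMap.id) (fun _ => LinearMap.id) (by simp)

theorem MemAdd.trans (hX : MemAdd H T X) (hY : MemAdd H X Y) : MemAdd H T Y := by
  obtain ⟨n, a, b, hab⟩ := hX.exists_sum
  obtain ⟨m, c, d, hcd⟩ := hY.exists_sum
  refine ⟨m * n, LinearMap.pi fun k => a (finProdFinEquiv.symm k).2 ∘ₗ c (finProdFinEquiv.symm k).1,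
    ∑ k, (d (finProdFinEquiv.symm k).1 ∘ₗ b (finProdFinEquiv.symm k).2) ∘ₗ LinearMap.proj k,
    LinearMap.ext fun x => ?_⟩
  simp only [LinearMap.comp_apply, LinearMap.sum_apply, LinearMap.proj_apply, LinearMap.pi_apply,
    LinearMap.id_apply]
  rw [← Equiv.sum_comp finProdFinEquiv, Fintype.sum_prod_type]
  simp only [Equiv.symm_apply_apply]
  conv_rhs => rw [← hcd x]
  refine Finset.sum_congr rfl fun j _ => ?_
  rw [← map_sum, hab]

theorem MemAdd.finite (hT : Module.Finite H T) (hX : MemAdd H T X) : Module.Finite H X := by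
  obtain ⟨n, i, p, hpi⟩ := hX
  exact Module.Finite.of_surjective p fun x => ⟨i x, LinearMap.congr_fun hpi x⟩

/-- Vanishing of `Ext¹(T, T)` passes to `add T`. -/
theorem subsingleton_ext_one_of_memAdd
    (h : Subsingleton (Abelian.Ext.{u} (ModuleCat.of H T) (ModuleCat.of H T) 1))
    (hY : MemAdd H T Y) (hX : MemAdd H T X) :
    Subsingleton (Abelian.Ext.{u} (ModuleCat.of H Y) (ModuleCat.of H X) 1) := by
  have key : ∀ e : Abelian.Ext.{u} (ModuleCat.of H Y) (ModuleCat.of H X) 1, e = 0 := by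
    intro e
    obtain ⟨n, a, b, hab⟩ := hY.exists_sum
    obtain ⟨m, c, d, hcd⟩ := hX.exists_sum
    have hid : 𝟙 (ModuleCat.of H Y) = ∑ j, ModuleCat.ofHom (a j) ≫ ModuleCat.ofHom (b j) := by
      ext x
      simpa [ModuleCat.hom_sum] using (hab x).symm
    have hid' : 𝟙 (ModuleCat.of H X) = ∑ j, ModuleCat.ofHom (c j) ≫ ModuleCat.ofHom (d j) := by
      ext x
      simpa [ModuleCat.hom_sum] using (hcd x).symm
    have h0 : ∀ f : Abelian.Ext.{u} (ModuleCat.of H T) (ModuleCat.of H T) 1, f = 0 :=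
      fun f => h.elim f 0
    have h1 : ∀ f : Abelian.Ext.{u} (ModuleCat.of H T) (ModuleCat.of H X) 1, f = 0 := by
      intro f
      rw [← f.comp_mk₀_id, hid', Abelian.Ext.mk₀_sum, Abelian.Ext.comp_sum]
      refine Finset.sum_eq_zero fun j _ => ?_
      rw [← Abelian.Ext.mk₀_comp_mk₀, ← Abelian.Ext.comp_assoc_of_third_deg_zero,
        h0 (f.comp (Abelian.Ext.mk₀ (ModuleCat.ofHom (c j))) (add_zero 1)),
        Abelian.Ext.zero_comp]
    rw [← e.mk₀_id_comp, hid, Abelian.Ext.mk₀_sum, Abelian.Ext.sum_comp]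
    refine Finset.sum_eq_zero fun j _ => ?_
    rw [← Abelian.Ext.mk₀_comp_mk₀, Abelian.Ext.comp_assoc_of_second_deg_zero,
      h1 ((Abelian.Ext.mk₀ (ModuleCat.ofHom (b j))).comp e (zero_add 1)), Abelian.Ext.comp_zero]
  exact ⟨fun x y => by rw [key x, key y]⟩

/-- Ext¹ vanishes on the projective middle term, so a class of degree one is g times the extension
class with g : X₁ → X₃. If g extends over X₂, the product contains two consecutive maps of the long
exact sequence and is zero. Degrees above one vanish by projective dimension. -/
theorem CategoryTheory.ShortComplex.ShortExact.ext_self_subsingleton {C : Type*} [Category C]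
    [Abelian C] [HasExt.{u} C] {S : ShortComplex C} (hS : S.ShortExact) [Projective S.X₁]
    [Projective S.X₂] (hext : ∀ g : S.X₁ ⟶ S.X₃, ∃ f : S.X₂ ⟶ S.X₃, S.f ≫ f = g) :
    HasProjectiveDimensionLE S.X₃ 1 ∧
      ∀ j : ℕ, 1 ≤ j → Subsingleton (Abelian.Ext.{u} S.X₃ S.X₃ j) := by
  have hpd : HasProjectiveDimensionLT S.X₃ 2 := by
    rw [hS.hasProjectiveDimensionLT_X₃_iff 0 inferInstance]
    infer_instance
  refine ⟨hpd, fun j hj => ?_⟩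
  obtain rfl | hj := hj.eq_or_lt
  · have key : ∀ e : Abelian.Ext.{u} S.X₃ S.X₃ 1, e = 0 := by
      intro e
      obtain ⟨x, hx⟩ := Abelian.Ext.contravariant_sequence_exact₃ hS _ e
        (Abelian.Ext.eq_zero_of_projective _) (add_zero 1)
      obtain ⟨g, rfl⟩ := (Abelian.Ext.mk₀_bijective _ _).2 x
      obtain ⟨f, rfl⟩ := hext g
      rw [← hx, ← Abelian.Ext.mk₀_comp_mk₀, hS.extClass_comp_assoc]
    exact ⟨fun x y => by rw [key x, key y]⟩
  · exact HasProjectiveDimensionLT.subsingleton _ 2 j hj _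

/-- A presentation `0 → K → L → T → 0` by projectives along which all maps `K → T` extend to `L`
controls the projective dimension and the self-extensions of `T`. -/
theorem isOneTilting_of_presentation [Module.Finite H T] [Module.Projective H K]
    [Module.Projective H L] (i : K →ₗ[H] L) (p : L →ₗ[H] T) (hi : Function.Injective i)
    (hip : Function.Exact i p) (hp : Function.Surjective p)
    (hext : ∀ g : K →ₗ[H] T, ∃ f : L →ₗ[H] T, f ∘ₗ i = g)
    (hcores : ∃ (T₀ T₁ : ModuleCat.{u} H) (f : H →ₗ[H] T₀) (g : T₀ →ₗ[H] T₁),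
      MemAdd H T T₀ ∧ MemAdd H T T₁ ∧
      Function.Injective f ∧ Function.Exact f g ∧ Function.Surjective g) :
    IsOneTilting H T := by
  let S : ShortComplex (ModuleCat.{u} H) := ShortComplex.mk (ModuleCat.ofHom i) (ModuleCat.ofHom p)
    (by ext x; exact hip.apply_apply_eq_zero x)
  have hS : S.ShortExact :=
    { exact := (ShortComplex.ShortExact.moduleCat_exact_iff_function_exact S).2 hip
      mono_f := (ModuleCat.mono_iff_injective _).2 hi
      epi_g := (ModuleCat.epi_iff_surjective _).2 hp }
  have : Projective S.X₁ := (IsProjective.iff_projective K).1 inferInstance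
  have : Projective S.X₂ := (IsProjective.iff_projective L).1 inferInstance
  obtain ⟨h1, h2⟩ := hS.ext_self_subsingleton fun g => by
    obtain ⟨f, hf⟩ := hext g.hom
    exact ⟨ModuleCat.ofHom f, ModuleCat.hom_ext hf⟩
  exact ⟨inferInstance, h1, h2, hcores⟩

end ExtOne

/-! ### Submodules of free modules over a hereditary ring -/

section Hereditary

variable {H : Type u} [Ring H]

/-- All submodules are projective. -/
def SubmodulesProjective (H M : Type*) [Ring H] [AddCommGroup M] [Module H M] : Prop :=
  ∀ N : Submodule H M, Module.Projective H N

theorem SubmodulesProjective.of_injective {M M' : Type*} [AddCommGroup M] [Module H M]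
    [AddCommGroup M'] [Module H M'] (h : SubmodulesProjective H M') (f : M →ₗ[H] M')
    (hf : Function.Injective f) : SubmodulesProjective H M := fun N =>
  haveI := h (N.map f)
  Module.Projective.of_equiv (N.equivMapOfInjective f hf).symm

/-- A submodule N is an extension of its image in M by its intersection with M'. The image is
projective, so the extension splits by s, and N is a summand of a product of two projectives. -/
theorem SubmodulesProjective.prod {M M' : Type*} [AddCommGroup M] [Module H M]
    [AddCommGroup M'] [Module H M'] (h : SubmodulesProjective H M)
    (h' : SubmodulesProjective H M') : SubmodulesProjective H (M × M') := by
  intro N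
  have := h (N.map (LinearMap.fst H M M'))
  have := h' (N.comap (LinearMap.inr H M M'))
  let q : N →ₗ[H] N.map (LinearMap.fst H M M') :=
    ((LinearMap.fst H M M').comp N.subtype).codRestrict _ fun x => ⟨x, x.2, rfl⟩
  have hq : ∀ x, (q x : M) = (x : M × M').1 := fun _ => rfl
  obtain ⟨s, hs⟩ := Module.projective_lifting_property q LinearMap.id
    (by rintro ⟨_, x, hx, rfl⟩; exact ⟨⟨x, hx⟩, rfl⟩)
  have hs' : ∀ y, ((s y : N) : M × M').1 = y := fun y =>
    congrArg Subtype.val (LinearMap.congr_fun hs y)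
  let r : N →ₗ[H] N.comap (LinearMap.inr H M M') :=
    ((LinearMap.snd H M M').comp (N.subtype.comp (LinearMap.id - s.comp q))).codRestrict _
      fun x => by
        have hx : (LinearMap.inr H M M') (((x : M × M') - (s (q x) : M × M')).2)
            = (x : M × M') - (s (q x) : M × M') := by
          refine Prod.ext ?_ rfl
          simp [hs', hq]
        change (LinearMap.inr H M M') (((x : M × M') - (s (q x) : M × M')).2) ∈ N
        rw [hx]
        exact N.sub_mem x.2 (s (q x)).2
  have hr : ∀ x, (r x : M') = (x : M × M').2 - (s (q x) : M × M').2 := fun _ => rfl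
  let j : N.comap (LinearMap.inr H M M') →ₗ[H] N :=
    ((LinearMap.inr H M M').comp (Submodule.subtype _)).codRestrict N fun x => x.2
  have hj : ∀ x, (j x : M × M') = (0, (x : M')) := fun _ => rfl
  refine Module.Projective.of_split (q.prod r) (s.coprod j) (LinearMap.ext fun x => ?_)
  refine Subtype.ext (Prod.ext ?_ ?_)
  · simp [hs', hq, hj]
  · simp [hr, hj]

theorem SubmodulesProjective.pi (hH : IsHereditary H) (n : ℕ) :
    SubmodulesProjective H (Fin n → H) := by
  induction n with
  | zero => exact fun N => inferInstance
  | succ n ih =>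
    exact (SubmodulesProjective.prod hH ih).of_injective
      (Fin.consLinearEquiv H fun _ => H).symm.toLinearMap (LinearEquiv.injective _)

/-- A rigid finitely generated module over a hereditary ring with an `add T`-coresolution of the
regular module is `1`-tilting. -/
theorem IsHereditary.isOneTilting {T : Type u} [AddCommGroup T] [Module H T] [Module.Finite H T]
    (hH : IsHereditary H)
    (hext : ∀ (n : ℕ) (p : (Fin n → H) →ₗ[H] T), Function.Surjective p →
      ∀ g : LinearMap.ker p →ₗ[H] T, ∃ f : (Fin n → H) →ₗ[H] T, ∀ k : LinearMap.ker p, f k = g k)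
    (hcores : ∃ (T₀ T₁ : ModuleCat.{u} H) (f : H →ₗ[H] T₀) (g : T₀ →ₗ[H] T₁),
      MemAdd H T T₀ ∧ MemAdd H T T₁ ∧
      Function.Injective f ∧ Function.Exact f g ∧ Function.Surjective g) :
    IsOneTilting H T := by
  obtain ⟨n, p, hp⟩ := Module.Finite.exists_fin' H T
  have := SubmodulesProjective.pi hH n (LinearMap.ker p)
  refine isOneTilting_of_presentation (LinearMap.ker p).subtype p Subtype.val_injective
    (LinearMap.exact_subtype_ker_map p) hp (fun g => ?_) hcores
  obtain ⟨f, hf⟩ := hext n p hp g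
  exact ⟨f, LinearMap.ext hf⟩

end Hereditary

/-! ### Factorisation through surjections and strict change of length -/

section Factor

variable {H : Type*} [Ring H] {A B C : Type*} [AddCommGroup A] [Module H A] [AddCommGroup B]
  [Module H B] [AddCommGroup C] [Module H C]

theorem LinearMap.exists_factor_of_surjective (p : A →ₗ[H] B) (hp : Function.Surjective p)
    (d : A →ₗ[H] C) (h : ∀ a, p a = 0 → d a = 0) : ∃ s : B →ₗ[H] C, ∀ a, s (p a) = d a :=
  ⟨(LinearMap.ker p).liftQ d (fun a ha => h a ha) ∘ₗ
    (p.quotKerEquivOfSurjective hp).symm.toLinearMap, fun a => by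
    have : (p.quotKerEquivOfSurjective hp).symm (p a) = (LinearMap.ker p).mkQ a :=
      (LinearEquiv.symm_apply_eq _).2 rfl
    simp only [LinearMap.comp_apply, LinearEquiv.coe_coe, this]
    rfl⟩

theorem LinearMap.length_lt_of_surjective [IsArtinian H A] [IsNoetherian H A] (f : A →ₗ[H] B)
    (hf : Function.Surjective f) (h : ¬ Function.Injective f) :
    Module.length H B < Module.length H A := by
  rw [← (f.quotKerEquivOfSurjective hf).length_eq]
  exact Submodule.length_quotient_lt _ fun hk => h (LinearMap.ker_eq_bot.1 hk)

theorem LinearMap.length_lt_of_injective [IsArtinian H B] [IsNoetherian H B] (f : A →ₗ[H] B)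
    (hf : Function.Injective f) (h : ¬ Function.Surjective f) :
    Module.length H A < Module.length H B := by
  rw [(LinearEquiv.ofInjective f hf).length_eq]
  exact Submodule.length_lt fun hk => h (LinearMap.range_eq_top.1 hk)

end Factor

/-! ### Indecomposable modules: Fitting's lemma and the Happel–Ringel lemma -/

/-- The only idempotent endomorphisms are `0` and `1`, that is, the module is indecomposable or
zero. -/
def HasTrivialIdempotents (H X : Type*) [Ring H] [AddCommGroup X] [Module H X] : Prop :=
  ∀ f : Module.End H X, f * f = f → f = 0 ∨ f = 1

/-- Fitting's lemma. -/
theorem HasTrivialIdempotents.isNilpotent_or_bijective {H X : Type*} [Ring H] [AddCommGroup X]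
    [Module H X] [IsArtinian H X] [IsNoetherian H X] (h : HasTrivialIdempotents H X)
    (f : Module.End H X) : IsNilpotent f ∨ Function.Bijective f := by
  -- Fitting: X = ker fⁿ ⊕ im fⁿ for large n. The bound n ≥ 1 is what later lets bijectivity of fⁿ
  -- pass to f.
  obtain ⟨n, hn, hc⟩ := ((Filter.eventually_ge_atTop 1).and
    f.eventually_isCompl_ker_pow_range_pow).exists
  let π := Submodule.projection _ _ hc.symm
  have hπ : π * π = π := Submodule.isIdempotentElem_projection hc.symm
  have hr : LinearMap.range π = LinearMap.range (f ^ n) := Submodule.range_projection hc.symm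
  have hk : LinearMap.ker π = LinearMap.ker (f ^ n) := Submodule.ker_projection hc.symm
  rcases h π hπ with h0 | h1
  · left
    rw [h0, LinearMap.range_zero] at hr
    exact ⟨n, LinearMap.range_eq_bot.1 hr.symm⟩
  · right
    rw [h1] at hr hk
    have hbij : Function.Bijective (f ^ n : Module.End H X) :=
      ⟨LinearMap.ker_eq_bot.1 (hk.symm.trans LinearMap.ker_id),
        LinearMap.range_eq_top.1 (hr.symm.trans LinearMap.range_id)⟩
    obtain ⟨m, rfl⟩ := Nat.exists_eq_add_of_le hn
    constructor
    · refine Function.Injective.of_comp (f := (f ^ m : Module.End H X)) ?_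
      have := hbij.1
      rw [add_comm, pow_succ] at this
      exact this
    · refine Function.Surjective.of_comp (g := (f ^ m : Module.End H X)) ?_
      have := hbij.2
      rw [pow_add, pow_one] at this
      exact this

/-- The Happel–Ringel lemma. -/
theorem IsHereditary.injective_or_surjective {H : Type u} [Ring H] (hH : IsHereditary H)
    {X Y : Type u} [AddCommGroup X] [Module H X] [AddCommGroup Y] [Module H Y]
    [IsArtinian H X] [IsNoetherian H X] [Module.Finite H Y]
    (hX : HasTrivialIdempotents H X) (hY : HasTrivialIdempotents H Y)
    (hext : Subsingleton (Abelian.Ext.{u} (ModuleCat.of H Y) (ModuleCat.of H X) 1))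
    (f : X →ₗ[H] Y) (hf : f ≠ 0) : Function.Injective f ∨ Function.Surjective f := by
  obtain ⟨n, p, hp⟩ := Module.Finite.exists_fin' H Y
  let I := LinearMap.range f
  let α : X →ₗ[H] I := f.rangeRestrict
  have hα : Function.Surjective α := f.surjective_rangeRestrict
  let L₀ := I.comap p
  have := SubmodulesProjective.pi hH n L₀
  let q : L₀ →ₗ[H] I := p.restrict fun x hx => hx
  have hq : Function.Surjective q := by
    rintro ⟨y, hy⟩
    obtain ⟨x, rfl⟩ := hp y
    exact ⟨⟨x, hy⟩, rfl⟩
  -- The preimage L₀ of the image I in a free cover of Y is projective, so L₀ → I lifts through X.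
  -- The obstruction to extending g from ker p to the whole free module lies in Ext¹(Y, X) = 0.
  obtain ⟨g, hg⟩ := Module.projective_lifting_property α q hα
  have hg' : ∀ l, α (g l) = q l := fun l => LinearMap.congr_fun hg l
  have hK : LinearMap.ker p ≤ L₀ := fun x hx => by
    change p x ∈ I
    rw [LinearMap.mem_ker.1 hx]
    exact I.zero_mem
  obtain ⟨h, hh⟩ := exists_extend_of_ext_one hext (LinearMap.ker p).subtype p
    Subtype.val_injective (LinearMap.exact_subtype_ker_map p) hp (g ∘ₗ Submodule.inclusion hK)
  have hh' : ∀ (x : L₀), p x = 0 → h x = g x := fun x hx => LinearMap.congr_fun hh ⟨x, hx⟩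
  -- The maps g and h agree on ker p. Their difference descends to s : I → X and α ∘ h descends to ρ
  -- : Y → I, with ρ = 1 - αs on I.
  obtain ⟨s, hs⟩ := LinearMap.exists_factor_of_surjective q hq (g - h ∘ₗ L₀.subtype) fun x hx => by
    have : p x = 0 := congrArg Subtype.val hx
    simp [hh' x this]
  obtain ⟨ρ, hρ⟩ := LinearMap.exists_factor_of_surjective p hp (α ∘ₗ h) fun x hx => by
    have h1 := hh' ⟨x, hK hx⟩ hx
    have h2 : q ⟨x, hK hx⟩ = 0 := Subtype.ext hx
    simp only [LinearMap.comp_apply]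
    rw [h1, hg', h2]
  have hρI : ∀ y : I, ρ y = y - α (s y) := by
    intro y
    obtain ⟨l, rfl⟩ := hq y
    have : ((q l : I) : Y) = p l := rfl
    rw [this, hρ, hs, LinearMap.sub_apply, map_sub, hg']
    simp
  -- If sα is bijective then α, hence f, is injective. If sα is nilpotent so is αs; then ρ is
  -- invertible on I, so I is a nonzero summand of Y and equals Y.
  rcases hX.isNilpotent_or_bijective (s ∘ₗ α) with ⟨m, hm⟩ | hbij
  · right
    have hnil : IsNilpotent (α ∘ₗ s : Module.End H I) := by
      have key : ∀ k, (α ∘ₗ s : Module.End H I) ^ (k + 1)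
          = α ∘ₗ ((s ∘ₗ α : Module.End H X) ^ k) ∘ₗ s := by
        intro k
        induction k with
        | zero => rfl
        | succ k ih =>
          rw [pow_succ, ih, pow_succ]
          rfl
      exact ⟨m + 1, by rw [key, hm]; ext; simp⟩
    obtain ⟨w, hw⟩ := hnil.isUnit_one_sub
    have hρw : ∀ y : I, ρ y = (w : Module.End H I) y := fun y => by
      rw [hρI, hw]
      rfl
    let e : Module.End H Y := I.subtype ∘ₗ (↑w⁻¹ : Module.End H I) ∘ₗ ρ
    have hww : ∀ y : I, (↑w⁻¹ : Module.End H I) ((w : Module.End H I) y) = y := fun y => by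
      rw [← Module.End.mul_apply, w.inv_mul]
      rfl
    have heI : ∀ y : I, e y = y := fun y => by
      change (((↑w⁻¹ : Module.End H I) (ρ y) : I) : Y) = y
      rw [hρw, hww]
    have he : e * e = e := LinearMap.ext fun y => heI ((↑w⁻¹ : Module.End H I) (ρ y))
    rcases hY e he with h0 | h1
    · refine absurd (LinearMap.ext fun x => ?_) hf
      have := heI (α x)
      rw [h0] at this
      exact this.symm
    · intro y
      have h2 : e y ∈ I := ((↑w⁻¹ : Module.End H I) (ρ y)).2
      rw [h1] at h2
      exact h2
  · left
    have : Function.Injective α := Function.Injective.of_comp (f := s) hbij.1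
    exact fun x y hxy => this (Subtype.ext hxy)

/-! ### The duality Hom(-, T) from projective modules over End T to add T -/

/-- `Λ` acts on the `H`-module `T` as the full endomorphism ring of `T`. -/
structure ActsAsEnd (Λ H T : Type*) [Ring Λ] [Ring H] [AddCommGroup T] [Module Λ T]
    [Module H T] : Prop where
  faithful : ∀ a : Λ, (∀ t : T, a • t = 0) → a = 0
  full : ∀ θ : T →ₗ[H] T, ∃ a : Λ, ∀ t, θ t = a • t

theorem Module.exists_dual_basis (A E : Type*) [Ring A] [AddCommGroup E] [Module A E]
    [Module.Finite A E] [Module.Projective A E] :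
    ∃ (n : ℕ) (c : Fin n → (E →ₗ[A] A)) (x : Fin n → E), ∀ y, ∑ j, c j y • x j = y := by
  obtain ⟨n, p, hp⟩ := Module.Finite.exists_fin' A E
  obtain ⟨s, hs⟩ := Module.projective_lifting_property p LinearMap.id hp
  refine ⟨n, fun j => LinearMap.proj j ∘ₗ s, fun j => p (Pi.single j 1), fun y => ?_⟩
  simp only [LinearMap.comp_apply, LinearMap.proj_apply, ← map_smul]
  rw [← map_sum]
  have : ∑ j, s y j • (Pi.single j 1 : Fin n → A) = s y := by
    ext k
    simp [Finset.sum_apply, Pi.single_apply]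
  rw [this]
  exact LinearMap.congr_fun hs y

/-- Each coordinate of x in a free module, multiplied into t ∈ T, is a value at x of a map E → T.
Faithfulness of T then kills every coordinate. -/
theorem ActsAsEnd.eq_zero_of_forall {Λ H T E : Type*} [Ring Λ] [Ring H] [AddCommGroup T]
    [Module Λ T] [Module H T] [AddCommGroup E] [Module Λ E] (h : ActsAsEnd Λ H T)
    [Module.Projective Λ E] {x : E}
    (hx : ∀ φ : E →ₗ[Λ] T, φ x = 0) : x = 0 := by
  obtain ⟨s, hs⟩ := Module.projective_def'.1 (inferInstance : Module.Projective Λ E)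
  have : s x = 0 := by
    ext e
    refine h.faithful _ fun t => ?_
    exact hx ((LinearMap.toSpanSingleton Λ T t) ∘ₗ (Finsupp.lapply e) ∘ₗ s)
  have h2 := LinearMap.congr_fun hs x
  rw [LinearMap.comp_apply, this, map_zero] at h2
  exact h2.symm

section Duality

variable {Λ H T : Type*} [Ring Λ] [Ring H] [AddCommGroup T] [Module Λ T] [Module H T]
  [SMulCommClass Λ H T] {E E' : Type*} [AddCommGroup E] [Module Λ E] [AddCommGroup E'] [Module Λ E']

variable (H T) in
/-- Precomposition with `f`, as an `H`-linear map. -/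
def precompHom (f : E' →ₗ[Λ] E) : (E →ₗ[Λ] T) →ₗ[H] (E' →ₗ[Λ] T) where
  toFun φ := φ ∘ₗ f
  map_add' _ _ := rfl
  map_smul' _ _ := rfl

/-- Every `H`-linear functional on the dual of a finitely generated projective module is an
evaluation. -/
theorem ActsAsEnd.exists_eval (h : ActsAsEnd Λ H T) [Module.Finite Λ E] [Module.Projective Λ E]
    (θ : (E →ₗ[Λ] T) →ₗ[H] T) : ∃ x : E, ∀ φ, θ φ = φ x := by
  obtain ⟨n, c, x, hcx⟩ := Module.exists_dual_basis Λ E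
  let ι : Fin n → T →ₗ[H] (E →ₗ[Λ] T) := fun j =>
    { toFun := fun t => LinearMap.toSpanSingleton Λ T t ∘ₗ c j
      map_add' := fun s t => LinearMap.ext fun y => smul_add _ _ _
      map_smul' := fun a t => LinearMap.ext fun y => smul_comm _ _ _ }
  choose a ha using fun j => h.full (θ ∘ₗ ι j)
  refine ⟨∑ j, a j • x j, fun φ => ?_⟩
  -- A dual basis writes φ through its values at the xⱼ; each θ ∘ ιⱼ is an endomorphism of T, so it
  -- is multiplication by some aⱼ in Λ.
  have hφ : φ = ∑ j, ι j (φ (x j)) := LinearMap.ext fun y => by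
    conv_lhs => rw [← hcx y]
    simp [ι, LinearMap.sum_apply]
  conv_lhs => rw [hφ]
  simp only [map_sum, map_smul]
  exact Finset.sum_congr rfl fun j _ => ha j _

/-- Fullness of the duality: composing g with evaluation at y is a functional on the dual of E,
hence evaluation at a point of E. Maps into T separate points, so that point is unique and depends
linearly on y. -/
theorem ActsAsEnd.exists_precompHom (h : ActsAsEnd Λ H T) [Module.Finite Λ E]
    [Module.Projective Λ E] (g : (E →ₗ[Λ] T) →ₗ[H] (E' →ₗ[Λ] T)) :
    ∃ f : E' →ₗ[Λ] E, g = precompHom H T f := by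
  have key : ∀ y : E', ∃ x : E, ∀ φ, g φ y = φ x := fun y =>
    h.exists_eval (⟨⟨fun φ => g φ y, fun φ ψ => by simp⟩, fun a φ => by simp⟩ :
      (E →ₗ[Λ] T) →ₗ[H] T)
  choose f hf using key
  have huniq : ∀ x y : E, (∀ φ : E →ₗ[Λ] T, φ x = φ y) → x = y := fun x y hxy =>
    sub_eq_zero.1 (h.eq_zero_of_forall fun φ => by rw [map_sub, hxy, sub_self])
  refine ⟨⟨⟨f, fun x y => huniq _ _ fun φ => ?_⟩, fun a x => huniq _ _ fun φ => ?_⟩,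
    LinearMap.ext fun φ => LinearMap.ext fun y => hf y φ⟩
  · rw [← hf, map_add, map_add, hf, hf]
  · rw [← hf, map_smul, hf, RingHom.id_apply, map_smul]

theorem ActsAsEnd.precompHom_injective (h : ActsAsEnd Λ H T) [Module.Projective Λ E]
    {f g : E' →ₗ[Λ] E} (hfg : precompHom H T f = precompHom H T g) : f = g :=
  LinearMap.ext fun x => sub_eq_zero.1 <| h.eq_zero_of_forall fun φ => by
    rw [map_sub, sub_eq_zero]
    exact LinearMap.congr_fun (LinearMap.congr_fun hfg φ) x

@[simp]
theorem precompHom_zero : precompHom H T (0 : E' →ₗ[Λ] E) = 0 :=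
  LinearMap.ext fun φ => φ.comp_zero

theorem ActsAsEnd.hasTrivialIdempotents (h : ActsAsEnd Λ H T) [Module.Finite Λ E]
    [Module.Projective Λ E] (hE : HasTrivialIdempotents Λ E) :
    HasTrivialIdempotents H (E →ₗ[Λ] T) := by
  intro u hu
  obtain ⟨f, rfl⟩ := h.exists_precompHom u
  rcases hE f (h.precompHom_injective hu) with rfl | rfl
  · exact Or.inl precompHom_zero
  · exact Or.inr rfl

/-- A full and faithful functor reflects isomorphisms; the inverse of the dual map comes from some
g, and faithfulness makes g inverse to f. -/
theorem ActsAsEnd.bijective_of_precompHom (h : ActsAsEnd Λ H T) [Module.Finite Λ E]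
    [Module.Projective Λ E] [Module.Finite Λ E'] [Module.Projective Λ E'] (f : E' →ₗ[Λ] E)
    (hf : Function.Bijective (precompHom H T f)) : Function.Bijective f := by
  let e := LinearEquiv.ofBijective _ hf
  obtain ⟨g, hg⟩ := h.exists_precompHom e.symm.toLinearMap
  have h1 : g ∘ₗ f = LinearMap.id := h.precompHom_injective (H := H) (T := T) <|
    LinearMap.ext fun φ => by
      change precompHom H T f (precompHom H T g φ) = φ
      rw [← hg]
      exact e.apply_symm_apply φ
  have h2 : f ∘ₗ g = LinearMap.id := h.precompHom_injective (H := H) (T := T) <|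
    LinearMap.ext fun φ => by
      change precompHom H T g (precompHom H T f φ) = φ
      rw [← hg]
      exact e.symm_apply_apply φ
  exact ⟨Function.LeftInverse.injective (g := g) (LinearMap.congr_fun h1),
    Function.RightInverse.surjective (g := g) (LinearMap.congr_fun h2)⟩

end Duality

/-- The dual of a finitely generated projective `Λ`-module lies in `add T`. -/
theorem memAdd_hom {Λ H T E : Type u} [Ring Λ] [Ring H] [AddCommGroup T] [Module Λ T]
    [Module H T] [SMulCommClass Λ H T] [AddCommGroup E] [Module Λ E] [Module.Finite Λ E]
    [Module.Projective Λ E] : MemAdd H T (E →ₗ[Λ] T) := by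
  obtain ⟨n, c, x, hcx⟩ := Module.exists_dual_basis Λ E
  refine MemAdd.of_sum (n := n)
    (fun j => ⟨⟨fun φ => φ (x j), fun φ ψ => rfl⟩, fun a φ => rfl⟩)
    (fun j => ⟨⟨fun t => LinearMap.toSpanSingleton Λ T t ∘ₗ c j,
      fun s t => LinearMap.ext fun y => smul_add _ _ _⟩,
      fun a t => LinearMap.ext fun y => smul_comm _ _ _⟩) fun φ => LinearMap.ext fun y => ?_
  conv_rhs => rw [← hcx y]
  simp [LinearMap.sum_apply]

/-! ### Indecomposable direct summands -/

section Retracts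

variable {A : Type*} [Ring A] {V : Type*} [AddCommGroup V] [Module A V]

/-- The submodule `E` is a direct summand. -/
def Submodule.IsRetract (E : Submodule A V) : Prop := ∃ r : V →ₗ[A] E, ∀ x : E, r x = x

theorem Submodule.isRetract_top : (⊤ : Submodule A V).IsRetract :=
  ⟨LinearMap.id.codRestrict ⊤ fun _ => trivial, fun _ => rfl⟩

theorem Submodule.IsRetract.finite [Module.Finite A V] {E : Submodule A V} (h : E.IsRetract) :
    Module.Finite A E :=
  let ⟨r, hr⟩ := h
  Module.Finite.of_surjective r fun x => ⟨x, hr x⟩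

theorem Submodule.IsRetract.projective [Module.Projective A V] {E : Submodule A V}
    (h : E.IsRetract) : Module.Projective A E :=
  let ⟨r, hr⟩ := h
  Module.Projective.of_split E.subtype r (LinearMap.ext hr)

theorem Submodule.IsRetract.map_idempotent {E : Submodule A V} (h : E.IsRetract)
    {f : Module.End A E} (hf : f * f = f) : ((LinearMap.range f).map E.subtype).IsRetract := by
  obtain ⟨r, hr⟩ := h
  refine ⟨(E.subtype ∘ₗ f ∘ₗ r).codRestrict _ fun x => ⟨f (r x), ⟨r x, rfl⟩, rfl⟩, ?_⟩
  rintro ⟨_, _, ⟨y, rfl⟩, rfl⟩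
  refine Subtype.ext ?_
  change ((f (r (f y : V)) : E) : V) = (f y : V)
  rw [hr]
  exact congrArg Subtype.val (LinearMap.congr_fun hf y)

/-- A minimal direct summand with a property that is detected on one of two complementary summands
is indecomposable. -/
theorem exists_isRetract_hasTrivialIdempotents [IsArtinian A V] (bad : Submodule A V → Prop)
    (hsup : ∀ E F : Submodule A V, bad (E ⊔ F) → bad E ∨ bad F) (htop : bad ⊤) :
    ∃ E : Submodule A V, E.IsRetract ∧ HasTrivialIdempotents A E ∧ bad E := by
  -- An idempotent of a minimal bad summand splits it into two summands of V, one of them bad. By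
  -- minimality that one is everything.
  obtain ⟨E, ⟨hE, hbad⟩, hmin⟩ := WellFounded.has_min (wellFounded_lt (α := Submodule A V))
    {E | E.IsRetract ∧ bad E} ⟨⊤, Submodule.isRetract_top, htop⟩
  refine ⟨E, hE, fun f hf => ?_, hbad⟩
  have hf' : (1 - f) * (1 - f) = 1 - f := IsIdempotentElem.one_sub hf
  have hle : ∀ g : Module.End A E, (LinearMap.range g).map E.subtype ≤ E := fun g =>
    Submodule.map_subtype_le _ _
  have hsum : (LinearMap.range f).map E.subtype ⊔ (LinearMap.range (1 - f)).map E.subtype = E := by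
    refine le_antisymm (sup_le (hle _) (hle _)) fun x hx => ?_
    refine Submodule.mem_sup.2 ⟨f ⟨x, hx⟩, ⟨_, ⟨_, rfl⟩, rfl⟩, (1 - f) ⟨x, hx⟩, ⟨_, ⟨_, rfl⟩, rfl⟩, ?_⟩
    simp
  have hfull : ∀ g : Module.End A E, g * g = g → bad ((LinearMap.range g).map E.subtype) →
      g = 1 := by
    intro g hg hb
    have h1 : (LinearMap.range g).map E.subtype = E := by
      by_contra hne
      exact hmin _ ⟨hE.map_idempotent hg, hb⟩ (lt_of_le_of_ne (hle g) hne)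
    refine LinearMap.ext fun x => ?_
    obtain ⟨_, ⟨y, rfl⟩, hy⟩ := (h1.symm ▸ x.2 : (x : V) ∈ (LinearMap.range g).map E.subtype)
    have hx : x = g y := Subtype.ext hy.symm
    rw [hx]
    exact LinearMap.congr_fun hg y
  rcases hsup _ _ (hsum.symm ▸ hbad) with h | h
  · exact Or.inr (hfull f hf h)
  · exact Or.inl (by simpa using hfull (1 - f) hf' h)

/-- Indecomposable direct summands that are not semisimple. -/
def NonsemisimpleSummand (E : Submodule A V) : Prop :=
  E.IsRetract ∧ HasTrivialIdempotents A E ∧ ¬ IsSemisimpleModule A E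

theorem exists_nonsemisimpleSummand [IsArtinian A V] (h : ¬ IsSemisimpleModule A V) :
    ∃ E : Submodule A V, NonsemisimpleSummand E := by
  refine exists_isRetract_hasTrivialIdempotents _ (fun E F hEF => ?_) fun htop => h ?_
  · by_contra! hc
    have := hc.1
    have := hc.2
    exact hEF (IsSemisimpleModule.sup inferInstance inferInstance)
  · exact IsSemisimpleModule.congr (Submodule.topEquiv (R := A) (M := V)).symm

/-- A simple S inside E is proper because E is not semisimple. Some indecomposable summand E' has
nonzero image under a map V → S, and E' → S → E is then nonzero and not surjective. Injectivity of V
is what prevents E' from being semisimple. -/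
theorem NonsemisimpleSummand.exists_map [Small.{u_2} A] [IsArtinian A V] [Module.Injective A V]
    (hV : ∀ S : Submodule A V, IsSimpleModule A S → ∃ g : V →ₗ[A] S, g ≠ 0)
    {E : Submodule A V} (hE : NonsemisimpleSummand E) :
    ∃ E' : Submodule A V, NonsemisimpleSummand E' ∧
      ∃ f : E' →ₗ[A] E, f ≠ 0 ∧ ¬ Function.Bijective f := by
  obtain ⟨hEr, hEi, hEs⟩ := hE
  have hE0 : E ≠ ⊥ := by
    rintro rfl
    exact hEs { exists_isCompl := fun a => ⟨⊥, Subsingleton.elim ⊤ a ▸ isCompl_top_bot⟩ }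
  obtain ⟨S, hS, hSE⟩ := (eq_bot_or_exists_atom_le E).resolve_left hE0
  have hSs : IsSimpleModule A S := isSimpleModule_iff_isAtom.2 hS
  have hne : ¬ E ≤ S := fun h => hEs (le_antisymm h hSE ▸ inferInstance)
  obtain ⟨g, hg⟩ := hV S hSs
  obtain ⟨E', hr', hi', x, hx, hgx⟩ := exists_isRetract_hasTrivialIdempotents
    (fun F : Submodule A V => ∃ x ∈ F, g x ≠ 0) (fun F F' h => by
      by_contra! hc
      obtain ⟨x, hx, hgx⟩ := h
      obtain ⟨y, hy, z, hz, rfl⟩ := Submodule.mem_sup.1 hx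
      exact hgx (by rw [map_add, hc.1 y hy, hc.2 z hz, add_zero]))
    (by
      by_contra! hc
      exact hg (LinearMap.ext fun x => hc x trivial))
  have hg' : g ∘ₗ E'.subtype ≠ 0 := fun h0 => hgx (LinearMap.congr_fun h0 ⟨x, hx⟩)
  refine ⟨E', ⟨hr', hi', fun hss => ?_⟩, Submodule.inclusion hSE ∘ₗ g ∘ₗ E'.subtype, fun h0 => ?_,
    fun hb => hne fun y hy => ?_⟩
  -- If E' were semisimple, E' → S would split. Extending the section to V by injectivity makes S
  -- the image of an idempotent of E, contradicting that E is indecomposable and S is proper.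
  · obtain ⟨σ, hσ⟩ := IsSemisimpleModule.lifting_property (g ∘ₗ E'.subtype)
      (LinearMap.surjective_of_ne_zero hg') LinearMap.id
    obtain ⟨τ, hτ⟩ := Module.Injective.extension_property A V S V S.subtype Subtype.val_injective
      (E'.subtype ∘ₗ σ)
    have hgτ : ∀ s : S, g (τ s) = s := fun s => by
      have h1 : τ s = (σ s : V) := LinearMap.congr_fun hτ s
      rw [h1]
      exact LinearMap.congr_fun hσ s
    let e : Module.End A E := Submodule.inclusion hSE ∘ₗ g ∘ₗ τ ∘ₗ E.subtype
    have he : e * e = e := LinearMap.ext fun y => Subtype.ext <| by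
      change ((g (τ (g (τ y) : V)) : S) : V) = (g (τ y) : V)
      rw [hgτ]
    rcases hEi e he with h0 | h1
    · have hS0 : ∀ s : S, s = 0 := fun s => by
        have h2 := congrArg Subtype.val (LinearMap.congr_fun h0 ⟨s, hSE s.2⟩)
        have h3 : ((g (τ s) : S) : V) = 0 := h2
        rw [hgτ] at h3
        exact Subtype.ext h3
      exact hgx (by rw [hS0 (g x)])
    · refine hne fun y hy => ?_
      have h2 := congrArg Subtype.val (LinearMap.congr_fun h1 ⟨y, hy⟩)
      have h3 : ((g (τ y) : S) : V) = y := h2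
      rw [← h3]
      exact (g (τ y)).2
  · refine hg' (LinearMap.ext fun y => Subtype.ext ?_)
    exact congrArg (fun z : E => (z : V)) (LinearMap.congr_fun h0 y)
  · obtain ⟨z, hz⟩ := hb.2 ⟨y, hy⟩
    have h3 : ((g z : S) : V) = y := congrArg Subtype.val hz
    rw [← h3]
    exact (g z).2

end Retracts

/-! ### Chains of maps between indecomposables of add T -/

/-- Let `T` be a rigid module over a hereditary Artinian ring and `Λ = End T`. A projective and
injective `Λ`-module all of whose simple submodules are quotients is semisimple. -/
theorem ActsAsEnd.isSemisimpleModule {Λ H T : Type u} [Ring Λ] [Ring H] [AddCommGroup T]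
    [Module Λ T] [Module H T] [SMulCommClass Λ H T] (h : ActsAsEnd Λ H T) [IsArtinianRing Λ]
    [IsArtinianRing H] (hH : IsHereditary H) [Module.Finite H T]
    (hext : Subsingleton (Abelian.Ext.{u} (ModuleCat.of H T) (ModuleCat.of H T) 1))
    {V : Type u} [AddCommGroup V] [Module Λ V] [Module.Finite Λ V] [Module.Projective Λ V]
    [Module.Injective Λ V]
    (hV : ∀ S : Submodule Λ V, IsSimpleModule Λ S → ∃ g : V →ₗ[Λ] S, g ≠ 0) :
    IsSemisimpleModule Λ V := by
  by_contra hss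
  obtain ⟨E₀, hE₀⟩ := exists_nonsemisimpleSummand hss
  have hadd : ∀ E : Submodule Λ V, E.IsRetract → MemAdd H T (E →ₗ[Λ] T) := fun E hE =>
    haveI := hE.finite
    haveI := hE.projective
    memAdd_hom
  have hfin : ∀ E : Submodule Λ V, E.IsRetract → Module.Finite H (E →ₗ[Λ] T) := fun E hE =>
    (hadd E hE).finite inferInstance
  have hHR : ∀ {E E' : Submodule Λ V}, NonsemisimpleSummand E → NonsemisimpleSummand E' →
      ∀ f : E' →ₗ[Λ] E, f ≠ 0 →
      Function.Injective (precompHom H T f) ∨ Function.Surjective (precompHom H T f) := by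
    intro E E' hE hE' f hf
    have := hE.1.finite
    have := hE.1.projective
    have := hE'.1.finite
    have := hE'.1.projective
    have := hfin E hE.1
    have := hfin E' hE'.1
    exact hH.injective_or_surjective (h.hasTrivialIdempotents hE.2.1)
      (h.hasTrivialIdempotents hE'.2.1)
      (subsingleton_ext_one_of_memAdd hext (hadd E' hE'.1) (hadd E hE.1)) _
      fun h0 => hf (h.precompHom_injective (h0.trans precompHom_zero.symm))
  have hstep : ∀ E : Submodule Λ V, NonsemisimpleSummand E → ∃ E' : Submodule Λ V,
      NonsemisimpleSummand E' ∧ ∃ f : E' →ₗ[Λ] E, f ≠ 0 ∧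
      ¬ Function.Bijective (precompHom H T f) := by
    intro E hE
    obtain ⟨E', hE', f, hf, hb⟩ := hE.exists_map hV
    have := hE.1.finite
    have := hE.1.projective
    have := hE'.1.finite
    have := hE'.1.projective
    exact ⟨E', hE', f, hf, fun hb' => hb (h.bijective_of_precompHom f hb')⟩
  let ℓ : Submodule Λ V → ℕ∞ := fun E => Module.length H (E →ₗ[Λ] T)
  -- no surjection that is not injective
  have hinj : ∀ {E E' : Submodule Λ V}, NonsemisimpleSummand E → NonsemisimpleSummand E' →
      ∀ f : E' →ₗ[Λ] E, ¬ Function.Bijective (precompHom H T f) →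
      ¬ Function.Surjective (precompHom H T f) := by
    -- Induction on the length of the dual of E'. The next map of the chain is either again a proper
    -- surjection, onto a shorter dual, or an injection.
    have main : ∀ n : ℕ∞, ∀ E E' : Submodule Λ V, ℓ E' = n → NonsemisimpleSummand E →
        NonsemisimpleSummand E' → ∀ f : E' →ₗ[Λ] E, ¬ Function.Bijective (precompHom H T f) →
        ¬ Function.Surjective (precompHom H T f) := by
      intro n
      induction n using WellFoundedLT.induction with
      | ind n ih =>
        intro E E' hn hE hE' f hb hs
        obtain ⟨E'', hE'', f', hf', hb'⟩ := hstep E' hE'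
        have := hE'.1.finite
        have := hE'.1.projective
        have := hE.1.projective
        have := hfin E' hE'.1
        rcases hHR hE' hE'' f' hf' with hi' | hs'
        · have hf0 : f ∘ₗ f' ≠ 0 := by
            intro h0
            refine hf' (h.precompHom_injective (H := H) (T := T) (LinearMap.ext fun φ => ?_))
            obtain ⟨ψ, rfl⟩ := hs φ
            change ψ ∘ₗ f ∘ₗ f' = (ψ ∘ₗ f) ∘ₗ 0
            rw [h0, LinearMap.comp_zero, LinearMap.comp_zero]
          -- A noninjective surjection followed by a nonsurjective injection would be neither
          -- injective nor surjective.
          rcases hHR hE hE'' (f ∘ₗ f') hf0 with hi | hs''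
          · exact hb ⟨Function.Injective.of_comp (f := precompHom H T f') hi, hs⟩
          · exact hb' ⟨hi', Function.Surjective.of_comp (g := precompHom H T f) hs''⟩
        · refine ih (ℓ E'') ?_ _ _ rfl hE' hE'' f' hb' hs'
          rw [← hn]
          exact LinearMap.length_lt_of_surjective _ hs' fun hi => hb' ⟨hi, hs'⟩
    exact @fun E E' hE hE' f => main _ E E' rfl hE hE' f
  have hle : ∀ E : Submodule Λ V, E.IsRetract → ℓ E ≤ Module.length H (V →ₗ[Λ] T) := by
    rintro E ⟨r, hr⟩
    refine Module.length_le_of_injective (precompHom H T r) fun φ ψ hφ => LinearMap.ext fun x => ?_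
    have := LinearMap.congr_fun hφ x
    change φ (r x) = ψ (r x) at this
    rwa [hr] at this
  have hVfin : Module.length H (V →ₗ[Λ] T) ≠ ⊤ := by
    have : Module.Finite H (V →ₗ[Λ] T) := memAdd_hom.finite (inferInstance : Module.Finite H T)
    exact Module.length_ne_top
  -- All the dual maps are now proper injections, so the gap to the finite length of the dual of V
  -- drops at each step.
  have main : ∀ n : ℕ∞, ∀ E : Submodule Λ V, NonsemisimpleSummand E →
      Module.length H (V →ₗ[Λ] T) - ℓ E ≠ n := by
    intro n
    induction n using WellFoundedLT.induction with
    | ind n ih =>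
      intro E hE hn
      obtain ⟨E', hE', f, hf, hb⟩ := hstep E hE
      have hi := (hHR hE hE' f hf).resolve_right (hinj hE hE' f hb)
      have := hfin E' hE'.1
      have hlt : ℓ E < ℓ E' := LinearMap.length_lt_of_injective _ hi fun hs => hb ⟨hi, hs⟩
      refine ih _ ?_ E' hE' rfl
      rw [← hn]
      have h1 := hle E' hE'.1
      generalize ℓ E = a at *
      generalize ℓ E' = b at *
      generalize Module.length H (V →ₗ[Λ] T) = c at *
      lift c to ℕ using hVfin
      lift b to ℕ using ne_top_of_le_ne_top (ENat.natCast_ne_top c) h1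
      lift a to ℕ using ne_top_of_lt hlt
      norm_cast at *
      omega
  exact main _ E₀ hE₀ rfl

/-! ### Central nilpotents, and splitting over the base ring -/

/-- A hereditary ring has no nonzero central nilpotent elements. -/
theorem IsHereditary.eq_zero_of_isNilpotent {H : Type u} [Ring H] (hH : IsHereditary H) {z : H}
    (hz : ∀ h, z * h = h * z) (hn : IsNilpotent z) : z = 0 := by
  let I : Submodule H H := Submodule.span H {z}
  have hzI : z ∈ I := Submodule.mem_span_singleton_self z
  have := hH I
  let φ : H →ₗ[H] I := LinearMap.toSpanSingleton H I ⟨z, hzI⟩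
  have hφ : Function.Surjective φ := by
    rintro ⟨y, hy⟩
    obtain ⟨a, rfl⟩ := Submodule.mem_span_singleton.1 hy
    exact ⟨a, rfl⟩
  obtain ⟨s, hs⟩ := Module.projective_lifting_property φ LinearMap.id hφ
  let w : H := s ⟨z, hzI⟩
  -- A section of h ↦ hz sends z to an element w with wz = z, and everything annihilating z
  -- annihilates w.
  have hw : w * z = z := congrArg Subtype.val (LinearMap.congr_fun hs ⟨z, hzI⟩)
  have hann : ∀ h, h * z = 0 → h * w = 0 := by
    intro h hh
    have : h • (⟨z, hzI⟩ : I) = 0 := Subtype.ext hh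
    change h • s ⟨z, hzI⟩ = 0
    rw [← map_smul, this, map_zero]
  classical
  by_contra h0
  have hfind := Nat.find_spec hn
  have hmin : ∀ m < Nat.find hn, z ^ m ≠ 0 := fun m hm => Nat.find_min hn hm
  generalize Nat.find hn = n at hfind hmin
  rcases n with _ | _ | n
  · rw [pow_zero] at hfind
    exact h0 (by rw [← mul_one z, hfind, mul_zero])
  · exact h0 (by simpa using hfind)
  -- With z^(n+2) = 0 minimal, z^(n+1) kills z, hence w. But z^(n+1) w = z^n w z = z^(n+1),
  -- contradicting minimality.
  · have h1 := hann (z ^ (n + 1)) (by rw [← pow_succ]; exact hfind)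
    refine hmin (n + 1) (Nat.lt_succ_self _) ?_
    rw [pow_succ, mul_assoc, hz w, hw, ← pow_succ] at h1
    exact h1

/-- The Jacobson radical of `R` acts as zero on tilted algebras. -/
theorem IsTiltedAlgebra.algebraMap_eq_zero {R : Type v} [CommRing R] {Λ : Type u} [Ring Λ]
    [Algebra R Λ] (h : IsTiltedAlgebra R Λ) {r : R} (hr : IsNilpotent r) :
    algebraMap R Λ r = 0 := by
  obtain ⟨H, _, _, T, _, _, _, _, -, hH, -, ⟨e⟩⟩ := h
  have h0 : algebraMap R H r = 0 :=
    hH.eq_zero_of_isNilpotent (fun x => Algebra.commutes r x) (hr.map (algebraMap R H))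
  refine e.injective ?_
  rw [AlgEquiv.commutes, map_zero]
  ext t
  rw [Module.algebraMap_end_apply, ← algebraMap_smul H r t, h0, zero_smul]
  rfl

/-- A surjection of modules over a commutative Artinian ring splits if every nilpotent element of
the ring acts as zero on the source. -/
theorem LinearMap.exists_rightInverse_of_isNilpotent_smul {R : Type*} [CommRing R]
    [IsArtinianRing R] {Y Z : Type*} [AddCommGroup Y] [Module R Y] [AddCommGroup Z] [Module R Z]
    (hY : ∀ r : R, IsNilpotent r → ∀ y : Y, r • y = 0) (f : Y →ₗ[R] Z)
    (hf : Function.Surjective f) : ∃ g : Z →ₗ[R] Y, f ∘ₗ g = LinearMap.id := by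
  -- The radical of an Artinian ring is nilpotent, so Y is a module over the semisimple ring R/rad
  -- R.
  have hY' : Module.IsTorsionBySet R Y (Ring.jacobson R : Set R) := fun y r => by
    refine hY r ?_ y
    obtain ⟨n, hn⟩ := IsSemiprimaryRing.isNilpotent (R := R)
    refine ⟨n, ?_⟩
    have := Ideal.pow_mem_pow r.2 n
    rw [hn] at this
    exact this
  have : IsSemisimpleModule R Y := by
    let := hY'.module
    have : IsSemisimpleRing (R ⧸ Ring.jacobson R) := IsSemiprimaryRing.isSemisimpleRing
    exact hY'.isSemisimpleModule_iff.1 inferInstance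
  exact IsSemisimpleModule.lifting_property f hf LinearMap.id

/-- The quotient map Y → Y/f(Z) has a section s, and subtracting s of the class of y projects Y onto
f(Z). -/
theorem LinearMap.exists_leftInverse_of_isNilpotent_smul {R : Type*} [CommRing R]
    [IsArtinianRing R] {Y Z : Type*} [AddCommGroup Y] [Module R Y] [AddCommGroup Z] [Module R Z]
    (hY : ∀ r : R, IsNilpotent r → ∀ y : Y, r • y = 0) (f : Z →ₗ[R] Y)
    (hf : Function.Injective f) : ∃ g : Y →ₗ[R] Z, g ∘ₗ f = LinearMap.id := by
  obtain ⟨s, hs⟩ := LinearMap.exists_rightInverse_of_isNilpotent_smul hY (LinearMap.range f).mkQ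
    (Submodule.mkQ_surjective _)
  have hmem : ∀ y, y - s ((LinearMap.range f).mkQ y) ∈ LinearMap.range f := fun y => by
    rw [← Submodule.Quotient.mk_eq_zero, ← Submodule.mkQ_apply, map_sub, sub_eq_zero]
    exact (LinearMap.congr_fun hs _).symm
  let e := LinearEquiv.ofInjective f hf
  refine ⟨e.symm.toLinearMap ∘ₗ (LinearMap.id - s ∘ₗ (LinearMap.range f).mkQ).codRestrict _ hmem,
    LinearMap.ext fun z => (LinearEquiv.symm_apply_eq e).2 (Subtype.ext ?_)⟩
  have : (LinearMap.range f).mkQ (f z) = 0 := (Submodule.Quotient.mk_eq_zero _).2 ⟨z, rfl⟩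
  change f z - s ((LinearMap.range f).mkQ (f z)) = f z
  rw [this, map_zero, sub_zero]

/-! ### Universal property, finiteness and right exactness of the balanced tensor product -/

namespace BalancedTensor

section Lift

variable {A B M X : Type u} [Ring A] [Ring B] [AddCommGroup M] [Module A M] [Module Bᵐᵒᵖ M]
  [AddCommGroup X] [Module B X] {W : Type*} [AddCommGroup W] [Module A W]

theorem add_tmul (m m' : M) (x : X) :
    (tmul (m + m') x : BalancedTensor A B M X) = tmul m x + tmul m' x := by
  simp only [tmul, TensorProduct.add_tmul, map_add]

theorem zero_tmul (x : X) : (tmul (0 : M) x : BalancedTensor A B M X) = 0 := by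
  simp only [tmul, TensorProduct.zero_tmul, map_zero]

/-- The additive map `M ⊗_B X → W` defined by a balanced, biadditive map. -/
def liftAdd [SMulCommClass A Bᵐᵒᵖ M] {W : Type*} [AddCommGroup W] (f : M → X → W)
    (hadd : ∀ m m' x, f (m + m') x = f m x + f m' x)
    (hadd' : ∀ m x x', f m (x + x') = f m x + f m x')
    (hbal : ∀ m (b : B) x, f (MulOpposite.op b • m) x = f m (b • x)) :
    BalancedTensor A B M X →+ W :=
  let g : M →+ X →+ W := AddMonoidHom.mk' (fun m => AddMonoidHom.mk' (f m) (hadd' m))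
    fun m m' => AddMonoidHom.ext (hadd m m')
  let h : M ⊗[ℤ] X →+ W := TensorProduct.liftAddHom g fun n m x => by
    rw [map_zsmul, map_zsmul, AddMonoidHom.zsmul_apply]
  QuotientAddGroup.lift (balancedRel A B M X).toAddSubgroup h fun t ht => by
    -- The relations form an A-span while h is only additive, so the induction must carry all
    -- A-multiples of t.
    have key : ∀ a : A, h (a • t) = 0 := by
      refine Submodule.span_induction (p := fun t _ => ∀ a : A, h (a • t) = 0) ?_ (by simp)
        (fun s t _ _ hs ht a => by rw [smul_add, h.map_add, hs, ht, add_zero])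
        (fun a' t _ ht a => by rw [smul_smul]; exact ht _) ht
      rintro _ ⟨m, b, x, rfl⟩ a
      rw [smul_sub, h.map_sub, sub_eq_zero]
      change f (a • MulOpposite.op b • m) x = f (a • m) (b • x)
      rw [smul_comm]
      exact hbal (a • m) b x
    simpa using key 1

@[simp]
theorem liftAdd_tmul [SMulCommClass A Bᵐᵒᵖ M] {W : Type*} [AddCommGroup W] (f : M → X → W)
    (hadd hadd' hbal) (m : M) (x : X) :
    liftAdd (A := A) (B := B) f hadd hadd' hbal (tmul m x) = f m x := rfl

theorem induction {p : BalancedTensor A B M X → Prop} (t : BalancedTensor A B M X) (h0 : p 0)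
    (htmul : ∀ m x, p (tmul m x)) (hadd : ∀ s t, p s → p t → p (s + t)) : p t := by
  obtain ⟨t, rfl⟩ := Submodule.mkQ_surjective _ t
  induction t using TensorProduct.induction_on with
  | zero => rw [map_zero]; exact h0
  | tmul m x => exact htmul m x
  | add s t hs ht => rw [map_add]; exact hadd _ _ hs ht

/-- The linear map `M ⊗_B X → W` defined by an `A`-linear, balanced, biadditive map. -/
def lift [SMulCommClass A Bᵐᵒᵖ M] (f : M → X → W)
    (hadd : ∀ m m' x, f (m + m') x = f m x + f m' x)
    (hadd' : ∀ m x x', f m (x + x') = f m x + f m x')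
    (hsmul : ∀ (a : A) m x, f (a • m) x = a • f m x)
    (hbal : ∀ m (b : B) x, f (MulOpposite.op b • m) x = f m (b • x)) :
    BalancedTensor A B M X →ₗ[A] W :=
  { liftAdd f hadd hadd' hbal with
    map_smul' := fun a t => by
      change liftAdd f hadd hadd' hbal (a • t) = a • liftAdd f hadd hadd' hbal t
      induction t using induction with
      | h0 => rw [smul_zero, _root_.map_zero, smul_zero]
      | htmul m x => exact hsmul a m x
      | hadd s t hs ht => rw [smul_add, _root_.map_add, hs, ht, _root_.map_add, smul_add] }

variable (A B) in
/-- The map `m ↦ m ⊗ x`. -/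
def mkLeft (x : X) : M →ₗ[A] BalancedTensor A B M X where
  toFun m := tmul m x
  map_add' m m' := add_tmul m m' x
  map_smul' _ _ := rfl

instance finite [Module.Finite A M] [Module.Finite B X] :
    Module.Finite A (BalancedTensor A B M X) := by
  obtain ⟨n, p, hp⟩ := Module.Finite.exists_fin' B X
  let φ : (Fin n → M) →ₗ[A] BalancedTensor A B M X :=
    ∑ j, mkLeft A B (p (Pi.single j 1)) ∘ₗ LinearMap.proj j
  have hφ : ∀ m, φ m = ∑ j, tmul (m j) (p (Pi.single j 1)) := fun m => by
    simp only [φ, LinearMap.sum_apply]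
    rfl
  refine Module.Finite.of_surjective φ fun t => ?_
  induction t using induction with
  | h0 => exact ⟨0, map_zero φ⟩
  | htmul m x =>
    obtain ⟨y, rfl⟩ := hp x
    refine ⟨fun j => MulOpposite.op (y j) • m, ?_⟩
    rw [hφ]
    simp only [smul_tmul, ← map_smul]
    have hy : ∑ j, y j • (Pi.single j 1 : Fin n → B) = y := by
      ext k
      simp [Finset.sum_apply, Pi.single_apply]
    have hsum : ∀ s : Finset (Fin n), ∑ j ∈ s, (tmul m (p (y j • Pi.single j 1)) :
        BalancedTensor A B M X) = tmul m (p (∑ j ∈ s, y j • (Pi.single j 1 : Fin n → B))) := by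
      classical
      intro s
      induction s using Finset.induction_on with
      | empty => simp [tmul_zero]
      | insert a s ha ih => rw [Finset.sum_insert ha, Finset.sum_insert ha, ih, map_add, tmul_add]
    rw [hsum, hy]
  | hadd s t hs ht =>
    obtain ⟨a, rfl⟩ := hs
    obtain ⟨b, rfl⟩ := ht
    exact ⟨a + b, map_add φ a b⟩

variable {Y : Type u} [AddCommGroup Y] [Module B Y]

theorem map_add (f g : X →ₗ[B] Y) : map A B M (f + g) = map A B M f + map A B M g :=
  linearMap_ext fun m x => by simp [tmul_add]

theorem map_surjective (f : X →ₗ[B] Y) (hf : Function.Surjective f) :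
    Function.Surjective (map A B M f) := fun t => by
  induction t using induction with
  | h0 => exact ⟨0, _root_.map_zero _⟩
  | htmul m y =>
    obtain ⟨x, rfl⟩ := hf y
    exact ⟨tmul m x, rfl⟩
  | hadd s t hs ht =>
    obtain ⟨a, rfl⟩ := hs
    obtain ⟨b, rfl⟩ := ht
    exact ⟨a + b, _root_.map_add _ a b⟩

end Lift

end BalancedTensor

/-! ### The decomposition M ⊗ (N ⊗ X) ≅ X ⊕ P ⊗ X -/

namespace CentralBimodule

open BalancedTensor

variable {R : Type v} [CommRing R] {A B C : Type u} [Ring A] [Algebra R A] [Ring B] [Algebra R B]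
  [Ring C] [Algebra R C] {X : Type u} [AddCommGroup X] [Module C X]

/-- For `x : X`, the map `M ⊗_B N → M ⊗_B (N ⊗_C X)`, `m ⊗ n ↦ m ⊗ (n ⊗ x)`. -/
noncomputable def assocAux (M : CentralBimodule R A B) (N : CentralBimodule R B C) (x : X) :
    BalancedTensor A B M N →ₗ[A] BalancedTensor A B M (BalancedTensor B C N X) :=
  BalancedTensor.map A B M (mkLeft B C x)

theorem assocAux_tmul (M : CentralBimodule R A B) (N : CentralBimodule R B C) (x : X) (m : M)
    (n : N) : assocAux M N x (tmul m n) = tmul m (tmul n x) := rfl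

theorem assocAux_add (M : CentralBimodule R A B) (N : CentralBimodule R B C) (x y : X)
    (t : BalancedTensor A B M N) :
    assocAux M N (x + y) t = assocAux M N x t + assocAux M N y t := by
  have : assocAux M N (x + y) = assocAux M N x + assocAux M N y := linearMap_ext fun m n => by
    rw [LinearMap.add_apply, assocAux_tmul, assocAux_tmul, assocAux_tmul, BalancedTensor.tmul_add, BalancedTensor.tmul_add]
  rw [this, LinearMap.add_apply]

theorem assocAux_smul (M : CentralBimodule R A B) (N : CentralBimodule R B C) (c : C) (x : X)
    (t : BalancedTensor A B M N) :
    assocAux M N (c • x) t = assocAux M N x (M.tensorRight N (MulOpposite.op c) t) := by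
  have : assocAux M N (c • x) = assocAux M N x ∘ₗ M.tensorRight N (MulOpposite.op c) :=
    linearMap_ext fun m n => by
      change tmul m (tmul n (c • x)) = tmul m (tmul (MulOpposite.op c • n) x)
      rw [BalancedTensor.smul_tmul]
  rw [this, LinearMap.comp_apply]

section Decomp

variable (X) (M : CentralBimodule R C B) (N : CentralBimodule R B C) (P : CentralBimodule R C C)
  (e : BalancedTensor C B M N ≃ₗ[C] C × P)
  (he : ∀ (b : Cᵐᵒᵖ) (t : BalancedTensor C B M N), e (M.tensorRight N b t) = b • e t)

/-- The additive map `n ⊗ x ↦ e (m ⊗ n) ⊗ x`. -/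
noncomputable def tensorDecompAux (m : M) :
    BalancedTensor B C N X →+ X × BalancedTensor C C P X :=
  liftAdd (fun n x => ((e (tmul m n)).1 • x, tmul (e (tmul m n)).2 x))
    (fun n n' x => by
      simp only [BalancedTensor.tmul_add, _root_.map_add, Prod.fst_add, Prod.snd_add, add_smul, BalancedTensor.add_tmul,
        Prod.mk_add_mk])
    (fun n x x' => by simp only [BalancedTensor.tmul_add, smul_add, Prod.mk_add_mk])
    (fun n c x => by
      have h := he (MulOpposite.op c) (tmul m n)
      have h1 : e (tmul m (MulOpposite.op c • n)) = MulOpposite.op c • e (tmul m n) := h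
      rw [h1, Prod.smul_fst, Prod.smul_snd, BalancedTensor.smul_tmul, op_smul_eq_mul, mul_smul])

/-- The map `M ⊗_B (N ⊗_C X) → X ⊕ P ⊗_C X` induced by `M ⊗_B N ≅ C ⊕ P`. -/
noncomputable def tensorDecompFwd :
    BalancedTensor C B M (BalancedTensor B C N X) →ₗ[C] X × BalancedTensor C C P X :=
  lift (fun m t => tensorDecompAux X M N P e he m t)
    (fun m m' t => by
      induction t using induction with
      | h0 => simp
      | htmul n x =>
        simp only [tensorDecompAux, liftAdd_tmul, BalancedTensor.add_tmul, _root_.map_add, Prod.fst_add,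
          Prod.snd_add, add_smul, Prod.mk_add_mk]
      | hadd s t hs ht => rw [_root_.map_add, hs, ht, _root_.map_add, _root_.map_add]; abel)
    (fun m t t' => _root_.map_add _ t t')
    (fun c m t => by
      induction t using induction with
      | h0 => simp
      | htmul n x =>
        simp only [tensorDecompAux, liftAdd_tmul, ← left_smul_tmul, _root_.map_smul, Prod.smul_fst,
          Prod.smul_snd, smul_assoc, Prod.smul_mk]
      | hadd s t hs ht => rw [_root_.map_add, hs, ht, _root_.map_add, smul_add])
    (fun m b t => by
      induction t using induction with
      | h0 => simp
      | htmul n x =>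
        simp only [tensorDecompAux, liftAdd_tmul, left_smul_tmul, BalancedTensor.smul_tmul]
      | hadd s t hs ht => rw [_root_.map_add, hs, ht, smul_add, _root_.map_add])

theorem tensorDecompFwd_tmul (m : M) (n : N) (x : X) :
    tensorDecompFwd X M N P e he (tmul m (tmul n x))
      = ((e (tmul m n)).1 • x, tmul (e (tmul m n)).2 x) := rfl

theorem tensorDecompFwd_assocAux (x : X) (t : BalancedTensor C B M N) :
    tensorDecompFwd X M N P e he (assocAux M N x t) = ((e t).1 • x, tmul (e t).2 x) := by
  induction t using induction with
  | h0 => simp [BalancedTensor.zero_tmul, Prod.mk_zero_zero]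
  | htmul m n => rfl
  | hadd s t hs ht =>
    simp only [_root_.map_add, hs, ht, Prod.fst_add, Prod.snd_add, add_smul, BalancedTensor.add_tmul,
      Prod.mk_add_mk]

theorem symm_op_smul
    (he : ∀ (b : Cᵐᵒᵖ) (t : BalancedTensor C B M N), e (M.tensorRight N b t) = b • e t) (b : Cᵐᵒᵖ) (y : C × P) :
    M.tensorRight N b (e.symm y) = e.symm (b • y) := by
  rw [LinearEquiv.eq_symm_apply, he, LinearEquiv.apply_symm_apply]

/-- The map `X ⊕ P ⊗_C X → M ⊗_B (N ⊗_C X)` induced by `M ⊗_B N ≅ C ⊕ P`. -/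
noncomputable def tensorDecompBwd :
    X × BalancedTensor C C P X →ₗ[C] BalancedTensor C B M (BalancedTensor B C N X) :=
  LinearMap.coprod
    { toFun := fun x => assocAux M N x (e.symm (1, 0))
      map_add' := fun x y => assocAux_add M N x y _
      map_smul' := fun c x => by
        rw [assocAux_smul, symm_op_smul M N P e he, RingHom.id_apply, ← _root_.map_smul,
          ← _root_.map_smul]
        congr 2
        ext <;> simp }
    (lift (fun q x => assocAux M N x (e.symm (0, q)))
      (fun q q' x => by
        rw [← _root_.map_add, ← _root_.map_add, Prod.mk_add_mk, add_zero])
      (fun q x x' => assocAux_add M N x x' _)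
      (fun c q x => by
        rw [← _root_.map_smul, ← _root_.map_smul, Prod.smul_mk, smul_zero])
      (fun q c x => by
        rw [assocAux_smul, symm_op_smul M N P e he, Prod.smul_mk, smul_zero]))

theorem tensorDecompBwd_inl (x : X) : tensorDecompBwd X M N P e he (x, 0)
    = assocAux M N x (e.symm (1, 0)) := by
  rw [tensorDecompBwd, LinearMap.coprod_apply, _root_.map_zero, add_zero]
  rfl

theorem tensorDecompBwd_inr (q : P) (x : X) : tensorDecompBwd X M N P e he (0, tmul q x)
    = assocAux M N x (e.symm (0, q)) := by
  rw [tensorDecompBwd, LinearMap.coprod_apply, _root_.map_zero, zero_add]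
  rfl

/-- A bimodule isomorphism `M ⊗_B N ≅ C ⊕ P` of `C`-`C`-bimodules induces isomorphisms
`M ⊗_B (N ⊗_C X) ≅ X ⊕ P ⊗_C X`. -/
noncomputable def tensorDecomp :
    BalancedTensor C B M (BalancedTensor B C N X) ≃ₗ[C] X × BalancedTensor C C P X :=
  LinearEquiv.ofLinearMap (tensorDecompFwd X M N P e he) (tensorDecompBwd X M N P e he)
    (by
      refine LinearMap.ext fun y => ?_
      obtain ⟨x, t⟩ := y
      have hx : tensorDecompFwd X M N P e he (tensorDecompBwd X M N P e he (x, 0)) = (x, 0) := by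
        rw [tensorDecompBwd_inl, tensorDecompFwd_assocAux, LinearEquiv.apply_symm_apply, one_smul,
          BalancedTensor.zero_tmul]
      have ht : tensorDecompFwd X M N P e he (tensorDecompBwd X M N P e he (0, t)) = (0, t) := by
        induction t using induction with
        | h0 => rw [← Prod.zero_eq_mk, _root_.map_zero, _root_.map_zero]
        | htmul q x =>
          rw [tensorDecompBwd_inr, tensorDecompFwd_assocAux, LinearEquiv.apply_symm_apply,
            zero_smul]
        | hadd s t hs ht =>
          have : ((0 : X), s + t) = (0, s) + (0, t) := by rw [Prod.mk_add_mk, add_zero]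
          rw [this, _root_.map_add, _root_.map_add, hs, ht]
      have : (x, t) = (x, 0) + (0, t) := by rw [Prod.mk_add_mk, add_zero, zero_add]
      rw [LinearMap.comp_apply, LinearMap.id_apply, this, _root_.map_add, _root_.map_add, hx, ht])
    (by
      refine linearMap_ext fun m t => ?_
      rw [LinearMap.comp_apply, LinearMap.id_apply]
      induction t using induction with
      | h0 => rw [BalancedTensor.tmul_zero, _root_.map_zero, _root_.map_zero]
      | htmul n x =>
        rw [tensorDecompFwd_tmul]
        have : ∀ y : C × P, tensorDecompBwd X M N P e he (y.1 • x, tmul y.2 x)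
            = assocAux M N x (e.symm y) := by
          rintro ⟨c, q⟩
          have : (c • x, (tmul q x : BalancedTensor C C P X)) = (c • x, 0) + (0, tmul q x) := by
            rw [Prod.mk_add_mk, add_zero, zero_add]
          rw [this, _root_.map_add, tensorDecompBwd_inl, tensorDecompBwd_inr, assocAux_smul,
            symm_op_smul M N P e he, ← _root_.map_add, ← _root_.map_add]
          congr 2
          ext <;> simp
        rw [this, LinearEquiv.symm_apply_apply, assocAux_tmul]
      | hadd s t hs ht => rw [BalancedTensor.tmul_add, _root_.map_add, _root_.map_add, hs, ht])

end Decomp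

end CentralBimodule

/-! ### Tensoring with a projective bimodule -/

namespace CentralBimodule

variable {R : Type v} [CommRing R] {A B : Type u} [Ring A] [Algebra R A] [Ring B] [Algebra R B]

/-- Bimodule maps out of a projective bimodule lift along surjective bimodule maps. -/
theorem IsProjective.exists_lift {P : CentralBimodule R A B} (hP : P.IsProjective)
    {V W : CentralBimodule R A B} (f : V →ₗ[A] W) (hf : ∀ (b : Bᵐᵒᵖ) m, f (b • m) = b • f m)
    (hsurj : Function.Surjective f) (g : P →ₗ[A] W) (hg : ∀ (b : Bᵐᵒᵖ) m, g (b • m) = b • g m) :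
    ∃ h : P →ₗ[A] V, (∀ (b : Bᵐᵒᵖ) m, h (b • m) = b • h m) ∧ ∀ p, f (h p) = g p := by
  let : Module (A ⊗[R] Bᵐᵒᵖ) P := P.envelopingModule
  let : Module (A ⊗[R] Bᵐᵒᵖ) V := V.envelopingModule
  let : Module (A ⊗[R] Bᵐᵒᵖ) W := W.envelopingModule
  have : Module.Projective (A ⊗[R] Bᵐᵒᵖ) P := hP
  have hsmul : ∀ (U : CentralBimodule R A B) (a : A) (b : Bᵐᵒᵖ) (m : U),
      letI := U.envelopingModule
      (a ⊗ₜ[R] b) • m = a • b • m := fun U a b m => rfl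
  have hlin : ∀ (U U' : CentralBimodule R A B) (φ : U →ₗ[A] U')
      (_ : ∀ (b : Bᵐᵒᵖ) m, φ (b • m) = b • φ m) (t : A ⊗[R] Bᵐᵒᵖ) (m : U),
      letI := U.envelopingModule
      letI := U'.envelopingModule
      φ (t • m) = t • φ m := by
    intro U U' φ hφ t m
    let := U.envelopingModule
    let := U'.envelopingModule
    induction t using TensorProduct.induction_on with
    | zero =>
      exact (congrArg φ (zero_smul (A ⊗[R] Bᵐᵒᵖ) m)).trans
        ((map_zero φ).trans (zero_smul (A ⊗[R] Bᵐᵒᵖ) (φ m)).symm)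
    | tmul a b => rw [hsmul, hsmul, map_smul, hφ]
    | add s t hs ht => rw [add_smul, add_smul, map_add, hs, ht]
  let f' : V →ₗ[A ⊗[R] Bᵐᵒᵖ] W := { f.toAddMonoidHom with map_smul' := hlin V W f hf }
  let g' : P →ₗ[A ⊗[R] Bᵐᵒᵖ] W := { g.toAddMonoidHom with map_smul' := hlin P W g hg }
  obtain ⟨h, hh⟩ := Module.projective_lifting_property f' g' hsurj
  have hl : ∀ (a : A) (p : P), h (a • p) = a • h p := fun a p => by
    have := h.map_smul (a ⊗ₜ[R] 1) p
    rwa [hsmul P, hsmul V, one_smul, one_smul] at this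
  have hr : ∀ (b : Bᵐᵒᵖ) (p : P), h (b • p) = b • h p := fun b p => by
    have := h.map_smul (1 ⊗ₜ[R] b) p
    rwa [hsmul P, hsmul V, one_smul, one_smul] at this
  exact ⟨{ h.toAddMonoidHom with map_smul' := hl }, hr, LinearMap.congr_fun hh⟩

section HomBimodule

variable (R A) (X Y : Type u) [AddCommGroup X] [Module A X] [Module R X] [IsScalarTower R A X]
  [AddCommGroup Y] [Module A Y] [Module R Y] [IsScalarTower R A Y]

/-- The bimodule `Hom_R(X, Y)` for two left `A`-modules `X` and `Y`. -/
noncomputable abbrev homBimodule : CentralBimodule R A A :=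
  letI : Module Aᵐᵒᵖ (X →ₗ[R] Y) :=
    { smul := fun b φ => φ ∘ₗ Algebra.lsmul R R X b.unop
      one_smul := fun φ => LinearMap.ext fun x => congrArg φ (one_smul A x)
      mul_smul := fun b c φ => LinearMap.ext fun x => congrArg φ (mul_smul c.unop b.unop x)
      smul_zero := fun b => rfl
      smul_add := fun b φ ψ => rfl
      add_smul := fun b c φ => LinearMap.ext fun x => by
        change φ ((b + c).unop • x) = φ (b.unop • x) + φ (c.unop • x)
        rw [MulOpposite.unop_add, add_smul, map_add]
      zero_smul := fun φ => LinearMap.ext fun x => by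
        change φ ((0 : Aᵐᵒᵖ).unop • x) = 0
        rw [MulOpposite.unop_zero, zero_smul, map_zero] }
  { carrier := X →ₗ[R] Y
    smulComm := ⟨fun a b φ => rfl⟩
    central := fun r φ => LinearMap.ext fun x => by
      change algebraMap R A r • φ x = φ (algebraMap R A r • x)
      rw [algebraMap_smul, algebraMap_smul, map_smul] }

end HomBimodule

section Projectivity

open BalancedTensor

variable {P : CentralBimodule R A A} {X X' Y Z : Type u} [AddCommGroup X] [Module A X]
  [AddCommGroup X'] [Module A X'] [AddCommGroup Y] [Module A Y] [AddCommGroup Z] [Module A Z]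

theorem tmul_algebraMap_smul (P : CentralBimodule R A B) {X : Type u} [AddCommGroup X]
    [Module B X] (r : R) (p : P) (x : X) :
    (tmul p (algebraMap R B r • x) : BalancedTensor A B P X) = algebraMap R A r • tmul p x := by
  rw [← BalancedTensor.smul_tmul, ← P.central, left_smul_tmul]

/-- The map `p ↦ (x ↦ g (p ⊗ x))`. -/
noncomputable def curryHom [Module R X] [IsScalarTower R A X] [Module R Z] [IsScalarTower R A Z]
    (g : BalancedTensor A A P X →ₗ[A] Z) : P →ₗ[A] homBimodule R A X Z where
  toFun p :=
    ({ toFun := fun x => g (tmul p x)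
       map_add' := fun x y => by rw [BalancedTensor.tmul_add, _root_.map_add]
       map_smul' := fun r x => by
        rw [← algebraMap_smul A r x, tmul_algebraMap_smul, map_smul, algebraMap_smul]
        rfl } : X →ₗ[R] Z)
  map_add' p q := LinearMap.ext fun x => by
    change g (tmul (p + q) x) = g (tmul p x) + g (tmul q x)
    rw [BalancedTensor.add_tmul, _root_.map_add]
  map_smul' a p := LinearMap.ext fun x => by
    change g (tmul (a • p) x) = a • g (tmul p x)
    rw [← left_smul_tmul, map_smul]

/-- The map `p ⊗ x ↦ h p x`. -/
noncomputable def uncurryHom [Module R X] [IsScalarTower R A X] [Module R Z] [IsScalarTower R A Z]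
    (h : P →ₗ[A] (homBimodule R A X Z).carrier)
    (hh : ∀ (b : A) p x, (h (MulOpposite.op b • p) : X →ₗ[R] Z) x = (h p : X →ₗ[R] Z) (b • x)) :
    BalancedTensor A A P X →ₗ[A] Z :=
  lift (fun p x => (h p : X →ₗ[R] Z) x)
    (fun p q x => by rw [_root_.map_add]; rfl)
    (fun p x y => LinearMap.map_add (h p : X →ₗ[R] Z) x y)
    (fun a p x => by rw [map_smul]; rfl) (fun p b x => hh b p x)

theorem uncurryHom_tmul [Module R X] [IsScalarTower R A X] [Module R Z] [IsScalarTower R A Z]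
    (h : P →ₗ[A] (homBimodule R A X Z).carrier) (hh) (p : P) (x : X) :
    uncurryHom h hh (tmul p x) = (h p : X →ₗ[R] Z) x := rfl

/-- The tensor product of a projective bimodule with a module is relatively projective. -/
theorem IsProjective.exists_lift_tensor [IsArtinianRing R] (hP : P.IsProjective)
    (hA : ∀ r : R, IsNilpotent r → algebraMap R A r = 0) (q : Y →ₗ[A] Z)
    (hq : Function.Surjective q) (g : BalancedTensor A A P X →ₗ[A] Z) :
    ∃ h : BalancedTensor A A P X →ₗ[A] Y, q ∘ₗ h = g := by
  let : Module R X := Module.compHom X (algebraMap R A)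
  have : IsScalarTower R A X := ⟨fun r a x => by
    rw [Algebra.smul_def, mul_smul]; rfl⟩
  let : Module R Y := Module.compHom Y (algebraMap R A)
  have : IsScalarTower R A Y := ⟨fun r a x => by
    rw [Algebra.smul_def, mul_smul]; rfl⟩
  let : Module R Z := Module.compHom Z (algebraMap R A)
  have : IsScalarTower R A Z := ⟨fun r a x => by
    rw [Algebra.smul_def, mul_smul]; rfl⟩
  -- An R-linear section of q makes Hom_R(X, Y) → Hom_R(X, Z) a surjection of bimodules. Maps P ⊗ X
  -- → Z are bimodule maps P → Hom_R(X, Z), and these lift.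
  obtain ⟨s, hs⟩ := LinearMap.exists_rightInverse_of_isNilpotent_smul (R := R)
    (fun r hr y => by rw [← algebraMap_smul A r y, hA r hr, zero_smul]) (q.restrictScalars R) hq
  let f : homBimodule R A X Y →ₗ[A] homBimodule R A X Z :=
    { toFun := fun φ => ((q.restrictScalars R) ∘ₗ φ : X →ₗ[R] Z)
      map_add' := fun φ ψ => LinearMap.ext fun x => _root_.map_add q _ _
      map_smul' := fun a φ => LinearMap.ext fun x => map_smul q a _ }
  obtain ⟨h, hh, hfh⟩ := hP.exists_lift (V := homBimodule R A X Y) (W := homBimodule R A X Z)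
    f (fun b φ => rfl) (fun φ => ⟨(s ∘ₗ φ : X →ₗ[R] Y), LinearMap.ext fun x =>
      LinearMap.congr_fun hs ((φ : X →ₗ[R] Z) x)⟩) (curryHom g) (fun b p => LinearMap.ext fun x => by
      change g (tmul (b • p) x) = g (tmul p (b.unop • x))
      rw [← BalancedTensor.smul_tmul]; rfl)
  refine ⟨uncurryHom h fun b p x => ?_, linearMap_ext fun p x => ?_⟩
  · rw [hh]
    rfl
  · rw [LinearMap.comp_apply, uncurryHom_tmul]
    exact LinearMap.congr_fun (hfh p) x

theorem IsProjective.projective_tensor [IsArtinianRing R] (hP : P.IsProjective)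
    (hA : ∀ r : R, IsNilpotent r → algebraMap R A r = 0) :
    Module.Projective A (BalancedTensor A A P X) :=
  Module.Projective.of_lifting_property'' fun f hf => hP.exists_lift_tensor hA f hf _

/-- Maps from `P ⊗ X` extend along `P ⊗ X → P ⊗ X'` for `X ⊆ X'` and a projective bimodule `P`. -/
theorem IsProjective.exists_extend_tensor [IsArtinianRing R] (hP : P.IsProjective)
    (hA : ∀ r : R, IsNilpotent r → algebraMap R A r = 0) (i : X →ₗ[A] X')
    (hi : Function.Injective i) (g : BalancedTensor A A P X →ₗ[A] Y) :
    ∃ h : BalancedTensor A A P X' →ₗ[A] Y, h ∘ₗ BalancedTensor.map A A P i = g := by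
  let : Module R X := Module.compHom X (algebraMap R A)
  have : IsScalarTower R A X := ⟨fun r a x => by
    rw [Algebra.smul_def, mul_smul]; rfl⟩
  let : Module R Y := Module.compHom Y (algebraMap R A)
  have : IsScalarTower R A Y := ⟨fun r a x => by
    rw [Algebra.smul_def, mul_smul]; rfl⟩
  let : Module R X' := Module.compHom X' (algebraMap R A)
  have : IsScalarTower R A X' := ⟨fun r a x => by
    rw [Algebra.smul_def, mul_smul]; rfl⟩
  -- Dually, an R-linear retraction of i makes restriction Hom_R(X', Y) → Hom_R(X, Y) surjective.
  obtain ⟨s, hs⟩ := LinearMap.exists_leftInverse_of_isNilpotent_smul (R := R)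
    (fun r hr y => by rw [← algebraMap_smul A r y, hA r hr, zero_smul]) (i.restrictScalars R) hi
  let f : homBimodule R A X' Y →ₗ[A] homBimodule R A X Y :=
    { toFun := fun φ => ((φ : X' →ₗ[R] Y) ∘ₗ (i.restrictScalars R) : X →ₗ[R] Y)
      map_add' := fun φ ψ => rfl
      map_smul' := fun a φ => rfl }
  obtain ⟨h, hh, hfh⟩ := hP.exists_lift (V := homBimodule R A X' Y) (W := homBimodule R A X Y)
    f (fun b φ => LinearMap.ext fun x => by
      change (φ : X' →ₗ[R] Y) (b.unop • i x) = (φ : X' →ₗ[R] Y) (i (b.unop • x))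
      rw [i.map_smul]) (fun φ => ⟨((φ : X →ₗ[R] Y) ∘ₗ s : X' →ₗ[R] Y), LinearMap.ext fun x =>
      congrArg (φ : X →ₗ[R] Y) (LinearMap.congr_fun hs x)⟩) (curryHom g)
      (fun b p => LinearMap.ext fun x => by
      change g (tmul (b • p) x) = g (tmul p (b.unop • x))
      rw [← BalancedTensor.smul_tmul]; rfl)
  refine ⟨uncurryHom h fun b p x => ?_, linearMap_ext fun p x => ?_⟩
  · rw [hh]
    rfl
  · rw [LinearMap.comp_apply, BalancedTensor.map_tmul, uncurryHom_tmul]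
    exact LinearMap.congr_fun (hfh p) x

end Projectivity

end CentralBimodule

/-! ### Lengths of Hom-modules over the base ring -/

section HomLength

variable (R : Type v) [CommRing R] {A : Type u} [Ring A] [Algebra R A]

variable (A) in
/-- Multiplication by a scalar of `R`, as an `A`-linear map. -/
def centralMul (r : R) (X : Type u) [AddCommGroup X] [Module A X] : X →ₗ[A] X where
  toFun x := algebraMap R A r • x
  map_add' := smul_add _
  map_smul' a x := by
    rw [RingHom.id_apply, smul_smul, smul_smul, Algebra.commutes]

variable (A) in
/-- A module over an `R`-algebra as an `R`-module. -/
abbrev restrictModule (X : Type u) [AddCommGroup X] [Module A X] : Module R X :=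
  Module.compHom X (algebraMap R A)

variable (A) in
theorem restrictModule_isScalarTower (X : Type u) [AddCommGroup X] [Module A X] :
    letI := restrictModule R A X
    IsScalarTower R A X :=
  letI := restrictModule R A X
  ⟨fun r a x => by rw [Algebra.smul_def, mul_smul]; rfl⟩

section

variable (X Y : Type u) [AddCommGroup X] [Module A X] [AddCommGroup Y] [Module A Y]

variable (A) in
/-- `Hom_A(X, Y)` as an `R`-module. -/
abbrev homModule : Module R (X →ₗ[A] Y) :=
  letI := restrictModule R A Y
  haveI := restrictModule_isScalarTower R A Y
  LinearMap.module

variable (A) in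
/-- The length of `Hom_A(X, Y)` over `R`. -/
noncomputable def homLength : ℕ∞ :=
  letI := homModule R A X Y
  Module.length R (X →ₗ[A] Y)

end

variable {X X' X'' Y Y' : Type u} [AddCommGroup X] [Module A X] [AddCommGroup X'] [Module A X']
  [AddCommGroup X''] [Module A X''] [AddCommGroup Y] [Module A Y] [AddCommGroup Y'] [Module A Y']

variable {R}

theorem homLength_congr {B : Type u} [Ring B] [Algebra R B] {Z Z' : Type u} [AddCommGroup Z]
    [Module B Z] [AddCommGroup Z'] [Module B Z'] (e : (X →ₗ[A] Y) ≃+ (Z →ₗ[B] Z'))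
    (he : ∀ (r : R) f, e (f ∘ₗ centralMul R A r X) = e f ∘ₗ centralMul R B r Z) :
    homLength R A X Y = homLength R B Z Z' := by
  let := homModule R A X Y
  let := homModule R B Z Z'
  have h1 : ∀ (r : R) (f : X →ₗ[A] Y), f ∘ₗ centralMul R A r X = r • f := fun r f =>
    LinearMap.ext fun x => f.map_smul _ x
  have h2 : ∀ (r : R) (f : Z →ₗ[B] Z'), f ∘ₗ centralMul R B r Z = r • f := fun r f =>
    LinearMap.ext fun x => f.map_smul _ x
  have hsmul : ∀ (r : R) (f : X →ₗ[A] Y), e (r • f) = r • e f := fun r f => by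
    rw [← h1, he, h2]
  exact LinearEquiv.length_eq
    ({ e with map_smul' := hsmul } : (X →ₗ[A] Y) ≃ₗ[R] (Z →ₗ[B] Z'))

theorem homLength_eq_zero_iff : homLength R A X Y = 0 ↔ ∀ f : X →ₗ[A] Y, f = 0 := by
  let := homModule R A X Y
  change Module.length R (X →ₗ[A] Y) = 0 ↔ _
  rw [Module.length_eq_zero_iff]
  exact ⟨fun _ f => Subsingleton.elim _ _, fun h => ⟨fun f g => by rw [h f, h g]⟩⟩

/-- Evaluation on finitely many generators of X embeds Hom(X, Y) in a power of Y. Finiteness is what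
permits cancelling lengths. -/
theorem homLength_ne_top [IsArtinianRing R] [Module.Finite R A] [Module.Finite A X]
    [Module.Finite A Y] : homLength R A X Y ≠ ⊤ := by
  let := restrictModule R A Y
  have := restrictModule_isScalarTower R A Y
  have : Module.Finite R Y := Module.Finite.trans A Y
  change Module.length R (X →ₗ[A] Y) ≠ ⊤
  obtain ⟨n, p, hp⟩ := Module.Finite.exists_fin' A X
  let φ : (X →ₗ[A] Y) →ₗ[R] (Fin n → Y) :=
    { toFun := fun f j => f (p (Pi.single j 1))
      map_add' := fun f g => rfl
      map_smul' := fun r f => rfl }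
  have hφ : Function.Injective φ := fun f g hfg => by
    have : f ∘ₗ p = g ∘ₗ p := LinearMap.pi_ext fun j a => by
      have h1 : (Pi.single j a : Fin n → A) = a • Pi.single j 1 := by
        rw [← Pi.single_smul, smul_eq_mul, mul_one]
      have h2 : f (p (Pi.single j 1)) = g (p (Pi.single j 1)) := congrFun hfg j
      rw [h1, map_smul, map_smul, LinearMap.comp_apply, LinearMap.comp_apply, h2]
    exact LinearMap.ext fun x => by
      obtain ⟨y, rfl⟩ := hp x
      exact LinearMap.congr_fun this y
  have := isNoetherian_of_injective φ hφ
  have := isArtinian_of_injective φ hφ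
  exact Module.length_ne_top

/-- Precomposition with `p`, as an `R`-linear map. -/
def homPrecomp (p : X →ₗ[A] X') (Y : Type u) [AddCommGroup Y] [Module A Y] :
    letI := homModule R A X Y
    letI := homModule R A X' Y
    (X' →ₗ[A] Y) →ₗ[R] (X →ₗ[A] Y) :=
  letI := homModule R A X Y
  letI := homModule R A X' Y
  { toFun := fun f => f ∘ₗ p
    map_add' := fun _ _ => rfl
    map_smul' := fun _ _ => rfl }

theorem homLength_prod_left :
    homLength R A (X × X') Y = homLength R A X Y + homLength R A X' Y := by
  let := restrictModule R A Y
  have := restrictModule_isScalarTower R A Y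
  refine Module.length_eq_add_of_exact (R := R) (N := X →ₗ[A] Y) (P := X' →ₗ[A] Y)
    (homPrecomp (LinearMap.fst A X X') Y) (homPrecomp (LinearMap.inr A X X') Y)
    (fun f g h => ?_) (fun f => ⟨f ∘ₗ LinearMap.snd A X X', ?_⟩) (fun f => ⟨fun h => ?_, ?_⟩)
  · exact LinearMap.ext fun x => LinearMap.congr_fun h (x, 0)
  · exact LinearMap.ext fun x => rfl
  · refine ⟨f ∘ₗ LinearMap.inl A X X', LinearMap.ext fun x => ?_⟩
    have h1 : f (0, x.2) = 0 := LinearMap.congr_fun h x.2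
    change f (x.1, 0) = f x
    have h2 : x = (x.1, 0) + (0, x.2) := by simp
    conv_rhs => rw [h2]
    rw [map_add, h1, add_zero]
  · rintro ⟨g, rfl⟩
    exact LinearMap.ext fun x => map_zero g

theorem homLength_prod_right :
    homLength R A X (Y × Y') = homLength R A X Y + homLength R A X Y' := by
  let := restrictModule R A Y
  have := restrictModule_isScalarTower R A Y
  let := restrictModule R A Y'
  have := restrictModule_isScalarTower R A Y'
  rw [homLength, homLength, homLength]
  change Module.length R (X →ₗ[A] (Y × Y')) = Module.length R (X →ₗ[A] Y) +
    Module.length R (X →ₗ[A] Y')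
  rw [← Module.length_prod]
  exact (LinearMap.prodEquiv (R := A) (M := X) (M₂ := Y) (M₃ := Y') R).symm.length_eq

theorem homLength_congr_left (e : X ≃ₗ[A] X') : homLength R A X Y = homLength R A X' Y :=
  homLength_congr
    { toFun := fun f => f ∘ₗ e.symm.toLinearMap
      invFun := fun f => f ∘ₗ e.toLinearMap
      left_inv := fun f => LinearMap.ext fun x => congrArg f (e.symm_apply_apply x)
      right_inv := fun f => LinearMap.ext fun x => congrArg f (e.apply_symm_apply x)
      map_add' := fun _ _ => rfl }
    fun r f => LinearMap.ext fun x => congrArg f (e.symm.map_smul (algebraMap R A r) x).symm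

theorem homLength_congr_right (e : Y ≃ₗ[A] Y') : homLength R A X Y = homLength R A X Y' :=
  homLength_congr
    { toFun := fun f => e.toLinearMap ∘ₗ f
      invFun := fun f => e.symm.toLinearMap ∘ₗ f
      left_inv := fun f => LinearMap.ext fun x => e.symm_apply_apply _
      right_inv := fun f => LinearMap.ext fun x => e.apply_symm_apply _
      map_add' := fun f g => LinearMap.ext fun x => map_add e _ _ }
    fun r f => rfl

/-- Restriction along j is onto, and its kernel contains the maps factoring through p. -/
theorem homLength_add_le (j : X →ₗ[A] X') (p : X' →ₗ[A] X'') (hp : Function.Surjective p)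
    (hjp : p ∘ₗ j = 0) (hext : ∀ f : X →ₗ[A] Y, ∃ g : X' →ₗ[A] Y, g ∘ₗ j = f) :
    homLength R A X Y + homLength R A X'' Y ≤ homLength R A X' Y := by
  let := homModule R A X Y
  let := homModule R A X' Y
  let := homModule R A X'' Y
  let φ : (X' →ₗ[A] Y) →ₗ[R] (X →ₗ[A] Y) := homPrecomp j Y
  let ψ : (X'' →ₗ[A] Y) →ₗ[R] LinearMap.ker φ := (homPrecomp p Y).codRestrict _ fun f => by
    change (f ∘ₗ p) ∘ₗ j = 0
    rw [LinearMap.comp_assoc, hjp, LinearMap.comp_zero]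
  have hψ : Function.Injective ψ := fun f g h => LinearMap.ext fun x => by
    obtain ⟨y, rfl⟩ := hp x
    exact LinearMap.congr_fun (congrArg Subtype.val h) y
  change Module.length R (X →ₗ[A] Y) + Module.length R (X'' →ₗ[A] Y)
    ≤ Module.length R (X' →ₗ[A] Y)
  rw [Module.length_eq_add_of_exact (LinearMap.ker φ).subtype φ Subtype.val_injective
    hext (LinearMap.exact_subtype_ker_map φ), add_comm]
  exact add_le_add_left (Module.length_le_of_injective ψ hψ) _

/-- The maps X' → Y killed by j are exactly those from X''. The assumed inequality therefore forces
the image of restriction to have full length. Together with `homLength_add_le` this turns an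
equality of lengths into a transfer of the extension property. -/
theorem exists_extend_of_homLength [IsArtinianRing R] [Module.Finite R A] [Module.Finite A X]
    [Module.Finite A X'] [Module.Finite A X''] [Module.Finite A Y] (j : X →ₗ[A] X')
    (p : X' →ₗ[A] X'') (hp : Function.Surjective p) (hjp : Function.Exact j p)
    (h : homLength R A X Y + homLength R A X'' Y ≤ homLength R A X' Y) (f : X →ₗ[A] Y) :
    ∃ g : X' →ₗ[A] Y, g ∘ₗ j = f := by
  let := homModule R A X Y
  let := homModule R A X' Y
  let := homModule R A X'' Y
  have hfin1 : Module.length R (X →ₗ[A] Y) ≠ ⊤ := homLength_ne_top (R := R) (A := A)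
  have hfin3 : Module.length R (X'' →ₗ[A] Y) ≠ ⊤ := homLength_ne_top (R := R) (A := A)
  change Module.length R (X →ₗ[A] Y) + Module.length R (X'' →ₗ[A] Y)
    ≤ Module.length R (X' →ₗ[A] Y) at h
  let φ : (X' →ₗ[A] Y) →ₗ[R] (X →ₗ[A] Y) := homPrecomp j Y
  have hexact : Function.Exact (homPrecomp p Y : (X'' →ₗ[A] Y) →ₗ[R] (X' →ₗ[A] Y))
      φ.rangeRestrict := fun g => by
    constructor
    · intro hg
      have hg' : g ∘ₗ j = 0 := congrArg Subtype.val hg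
      obtain ⟨s, hs⟩ := LinearMap.exists_factor_of_surjective p hp g fun x hx => by
        obtain ⟨y, rfl⟩ := (hjp x).1 hx
        exact LinearMap.congr_fun hg' y
      exact ⟨s, LinearMap.ext hs⟩
    · rintro ⟨s, rfl⟩
      refine Subtype.ext (LinearMap.ext fun x => ?_)
      change s (p (j x)) = 0
      rw [hjp.apply_apply_eq_zero, map_zero]
  have hinj : Function.Injective (homPrecomp p Y : (X'' →ₗ[A] Y) →ₗ[R] (X' →ₗ[A] Y)) :=
    fun f g h => LinearMap.ext fun x => by
      obtain ⟨y, rfl⟩ := hp x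
      exact LinearMap.congr_fun h y
  have hlen := Module.length_eq_add_of_exact _ _ hinj φ.surjective_rangeRestrict hexact
  have htop : LinearMap.range φ = ⊤ := by
    by_contra hne
    have hf := Module.length_ne_top_iff.1 hfin1
    rw [isFiniteLength_iff_isNoetherian_isArtinian] at hf
    have := hf.1
    have := hf.2
    have hlt := Submodule.length_lt hne
    rw [hlen, add_comm] at h
    exact absurd ((ENat.add_le_add_iff_left hfin3).1 h) (not_le.2 hlt)
  have : f ∈ LinearMap.range φ := htop ▸ trivial
  exact this

/-- An injective additive map between Hom-groups compatible with scalars is surjective when the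
lengths agree. -/
theorem surjective_of_homLength_le [IsArtinianRing R] {B : Type u} [Ring B] [Algebra R B]
    {Z Z' : Type u} [AddCommGroup Z] [Module B Z] [AddCommGroup Z'] [Module B Z']
    (e : (X →ₗ[A] Y) →+ (Z →ₗ[B] Z')) (hinj : Function.Injective e)
    (he : ∀ (r : R) f, e (f ∘ₗ centralMul R A r X) = e f ∘ₗ centralMul R B r Z)
    (hfin : homLength R B Z Z' ≠ ⊤) (hle : homLength R B Z Z' ≤ homLength R A X Y) :
    Function.Surjective e := by
  let := homModule R A X Y
  let := homModule R B Z Z'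
  have h1 : ∀ (r : R) (f : X →ₗ[A] Y), f ∘ₗ centralMul R A r X = r • f := fun r f =>
    LinearMap.ext fun x => f.map_smul _ x
  have h2 : ∀ (r : R) (f : Z →ₗ[B] Z'), f ∘ₗ centralMul R B r Z = r • f := fun r f =>
    LinearMap.ext fun x => f.map_smul _ x
  have hsmul : ∀ (r : R) (f : X →ₗ[A] Y), e (r • f) = r • e f := fun r f => by
    rw [← h1, he, h2]
  let φ : (X →ₗ[A] Y) →ₗ[R] (Z →ₗ[B] Z') := { e with map_smul' := hsmul }
  by_contra hs
  have : IsFiniteLength R (Z →ₗ[B] Z') := Module.length_ne_top_iff.1 hfin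
  rw [isFiniteLength_iff_isNoetherian_isArtinian] at this
  have h3 := this.1
  have h4 := this.2
  exact absurd hle (not_le.2 (φ.length_lt_of_injective hinj hs))

end HomLength

/-! ### Consequences of the adjunctions -/

namespace CentralBimodule

open BalancedTensor

variable {R : Type v} [CommRing R] {A B : Type u} [Ring A] [Algebra R A] [Ring B] [Algebra R B]

theorem map_centralMul (M : CentralBimodule R A B) (r : R) (X : Type u) [AddCommGroup X]
    [Module B X] : BalancedTensor.map A B M (centralMul R B r X)
      = centralMul R A r (BalancedTensor A B M X) :=
  linearMap_ext fun m x => tmul_algebraMap_smul M r m x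

/-- The adjunction isomorphism `Hom_A(M ⊗_B X, Y) ≅ Hom_B(X, N ⊗_A Y)`. -/
noncomputable def adjEquiv {M : CentralBimodule R A B} {N : CentralBimodule R B A}
    (adj : M.tensorFunctor ⊣ N.tensorFunctor) (X Y : Type u) [AddCommGroup X] [Module B X]
    [AddCommGroup Y] [Module A Y] :
    (BalancedTensor A B M X →ₗ[A] Y) ≃+ (X →ₗ[B] BalancedTensor B A N Y) where
  toFun f := (adj.homEquiv (ModuleCat.of B X) (ModuleCat.of A Y) (ModuleCat.ofHom f)).hom
  invFun g := ((adj.homEquiv (ModuleCat.of B X) (ModuleCat.of A Y)).symm (ModuleCat.ofHom g)).hom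
  left_inv f := congrArg ModuleCat.Hom.hom
    ((adj.homEquiv (ModuleCat.of B X) (ModuleCat.of A Y)).symm_apply_apply (ModuleCat.ofHom f))
  right_inv g := congrArg ModuleCat.Hom.hom
    ((adj.homEquiv (ModuleCat.of B X) (ModuleCat.of A Y)).apply_symm_apply (ModuleCat.ofHom g))
  map_add' f g := by
    -- The adjoint of f is N ⊗ f after the unit, which makes additivity visible.
    have key : ∀ f : BalancedTensor A B M X →ₗ[A] Y,
        (adj.homEquiv (ModuleCat.of B X) (ModuleCat.of A Y) (ModuleCat.ofHom f)).hom
          = BalancedTensor.map B A N f ∘ₗ (adj.unit.app (ModuleCat.of B X)).hom := fun f =>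
      congrArg ModuleCat.Hom.hom (adj.homEquiv_unit (X := ModuleCat.of B X)
        (Y := ModuleCat.of A Y) (f := ModuleCat.ofHom f))
    exact (key (f + g)).trans ((congrArg (· ∘ₗ _) (BalancedTensor.map_add f g)).trans
      ((LinearMap.add_comp _ _ _).trans (congrArg₂ (· + ·) (key f) (key g)).symm))

theorem homLength_adj {M : CentralBimodule R A B} {N : CentralBimodule R B A}
    (adj : M.tensorFunctor ⊣ N.tensorFunctor) (X Y : Type u) [AddCommGroup X] [Module B X]
    [AddCommGroup Y] [Module A Y] :
    homLength R A (BalancedTensor A B M X) Y = homLength R B X (BalancedTensor B A N Y) :=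
  homLength_congr (adjEquiv adj X Y) fun r f => by
    rw [← map_centralMul]
    have := adj.homEquiv_naturality_left (ModuleCat.ofHom (centralMul R B r X))
      (ModuleCat.ofHom f : M.tensorFunctor.obj (ModuleCat.of B X) ⟶ ModuleCat.of A Y)
    exact congrArg ModuleCat.Hom.hom this

/-- A right adjoint preserves monomorphisms. -/
theorem map_injective_of_adj {M : CentralBimodule R A B} {N : CentralBimodule R B A}
    (adj : M.tensorFunctor ⊣ N.tensorFunctor) {X Y : Type u} [AddCommGroup X] [Module A X]
    [AddCommGroup Y] [Module A Y] (f : X →ₗ[A] Y) (hf : Function.Injective f) :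
    Function.Injective (BalancedTensor.map B A N f) := by
  have := adj.rightAdjoint_preservesLimits
  have : Mono (ModuleCat.ofHom f) := (ModuleCat.mono_iff_injective _).2 hf
  exact (ModuleCat.mono_iff_injective (N.tensorFunctor.map (ModuleCat.ofHom f))).1 inferInstance

/-- M ⊗ - is left adjoint to N ⊗ -, which preserves surjections, so lifting problems transpose. -/
theorem projective_of_adj {M : CentralBimodule R A B} {N : CentralBimodule R B A}
    (adj : M.tensorFunctor ⊣ N.tensorFunctor) (X : Type u) [AddCommGroup X] [Module B X]
    [h : Module.Projective B X] : Module.Projective A (BalancedTensor A B M X) := by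
  refine Module.Projective.of_lifting_property'' fun f hf => ?_
  obtain ⟨g, hg⟩ := Module.projective_lifting_property (BalancedTensor.map B A N f)
    (adjEquiv adj X _ LinearMap.id) (BalancedTensor.map_surjective f hf)
  refine ⟨(adjEquiv adj X _).symm g, (adjEquiv adj X _).injective ?_⟩
  rw [← hg]
  have := adj.homEquiv_naturality_right (ModuleCat.ofHom ((adjEquiv adj X _).symm g) :
      M.tensorFunctor.obj (ModuleCat.of B X) ⟶ _) (ModuleCat.ofHom f)
  have h2 := congrArg ModuleCat.Hom.hom this
  refine h2.trans ?_
  change BalancedTensor.map B A N f ∘ₗ (adjEquiv adj X _ ((adjEquiv adj X _).symm g)) = _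
  rw [AddEquiv.apply_symm_apply]

/-- N ⊗ - is right adjoint to M ⊗ -, assumed to preserve injections, so extension problems
transpose. -/
theorem injective_of_adj {M : CentralBimodule R A B} {N : CentralBimodule R B A}
    (adj : M.tensorFunctor ⊣ N.tensorFunctor)
    (hM : ∀ {X Y : Type u} [AddCommGroup X] [Module B X] [AddCommGroup Y] [Module B Y]
      (f : X →ₗ[B] Y), Function.Injective f → Function.Injective (BalancedTensor.map A B M f))
    (Y : Type u) [AddCommGroup Y] [Module A Y] [h : Module.Injective A Y] :
    Module.Injective B (BalancedTensor B A N Y) := by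
  refine ⟨fun X X' _ _ _ _ i hi g => ?_⟩
  obtain ⟨k, hk⟩ := Module.Injective.extension_property A Y _ _ (BalancedTensor.map A B M i)
    (hM i hi) ((adjEquiv adj X Y).symm g)
  suffices adjEquiv adj X' Y k ∘ₗ i = g from
    ⟨adjEquiv adj X' Y k, fun x => LinearMap.congr_fun this x⟩
  have := adj.homEquiv_naturality_left (ModuleCat.ofHom i)
    (ModuleCat.ofHom k : M.tensorFunctor.obj (ModuleCat.of B X') ⟶ ModuleCat.of A Y)
  have h2 := congrArg ModuleCat.Hom.hom this
  refine h2.symm.trans ?_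
  change adjEquiv adj X Y (k ∘ₗ BalancedTensor.map A B M i) = g
  rw [hk, AddEquiv.apply_symm_apply]

end CentralBimodule

/-! ### Self-adjointness of Q ⊗ - at the level of lengths -/

namespace CentralBimodule

open BalancedTensor

variable {R : Type v} [CommRing R] {A B : Type u} [Ring A] [Algebra R A] [Ring B] [Algebra R B]

/-- A two-sided adjunction between `M ⊗_B -` and `N ⊗_A -` together with a decomposition
`N ⊗_A M ≅ B ⊕ Q` for a projective bimodule `Q`. -/
structure StableAdjunction (M : CentralBimodule R A B) (N : CentralBimodule R B A)
    (Q : CentralBimodule R B B) where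
  finite_left : Module.Finite A M
  finite_right : Module.Finite B N
  isProjective : Q.IsProjective
  decomp : BalancedTensor B A N M ≃ₗ[B] B × Q
  decomp_op_smul : ∀ (b : Bᵐᵒᵖ) (t : BalancedTensor B A N M),
    decomp (N.tensorRight M b t) = b • decomp t
  adj : M.tensorFunctor ⊣ N.tensorFunctor
  adj' : N.tensorFunctor ⊣ M.tensorFunctor
  algebraMap_eq_zero : ∀ r : R, IsNilpotent r → algebraMap R B r = 0

variable {M : CentralBimodule R A B} {N : CentralBimodule R B A} {Q : CentralBimodule R B B}
  {X Y : Type u} [AddCommGroup X] [Module B X] [AddCommGroup Y] [Module B Y]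

namespace StableAdjunction

/-- The decomposition `N ⊗_A (M ⊗_B X) ≅ X ⊕ Q ⊗_B X`. -/
noncomputable def equivProd (S : StableAdjunction M N Q) (X : Type u) [AddCommGroup X]
    [Module B X] :
    BalancedTensor B A N (BalancedTensor A B M X) ≃ₗ[B] X × BalancedTensor B B Q X :=
  tensorDecomp X N M Q S.decomp S.decomp_op_smul

theorem equivProd_tmul (S : StableAdjunction M N Q) (n : N) (m : M) (x : X) :
    S.equivProd X (tmul n (tmul m x))
      = ((S.decomp (tmul n m)).1 • x, tmul (S.decomp (tmul n m)).2 x) :=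
  tensorDecompFwd_tmul X N M Q S.decomp S.decomp_op_smul n m x

theorem equivProd_map_fst (S : StableAdjunction M N Q) (f : X →ₗ[B] Y)
    (t : BalancedTensor B A N (BalancedTensor A B M X)) :
    (S.equivProd Y (BalancedTensor.map B A N (BalancedTensor.map A B M f) t)).1
      = f (S.equivProd X t).1 := by
  have : (LinearMap.fst B Y (BalancedTensor B B Q Y) ∘ₗ (S.equivProd Y).toLinearMap) ∘ₗ
      BalancedTensor.map B A N (BalancedTensor.map A B M f)
      = f ∘ₗ LinearMap.fst B X (BalancedTensor B B Q X) ∘ₗ (S.equivProd X).toLinearMap := by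
    refine linearMap_ext fun n t => ?_
    induction t using BalancedTensor.induction with
    | h0 => rw [BalancedTensor.tmul_zero, _root_.map_zero, _root_.map_zero]
    | htmul m x =>
      change (S.equivProd Y (tmul n (tmul m (f x)))).1 = f (S.equivProd X (tmul n (tmul m x))).1
      rw [equivProd_tmul, equivProd_tmul, map_smul]
    | hadd s t hs ht => rw [BalancedTensor.tmul_add, _root_.map_add, hs, ht, _root_.map_add]
  exact LinearMap.congr_fun this t

/-- The X-component of N ⊗ (M ⊗ X) is natural in X, so f can be read off from N ⊗ (M ⊗ f). -/
theorem map_injective (S : StableAdjunction M N Q) :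
    Function.Injective (BalancedTensor.map A B M : (X →ₗ[B] Y) → _) := fun f g hfg => by
  refine LinearMap.ext fun x => ?_
  have h := fun f : X →ₗ[B] Y => S.equivProd_map_fst f ((S.equivProd X).symm (x, 0))
  simp only [LinearEquiv.apply_symm_apply] at h
  rw [← h, ← h, hfg]

theorem finite (S : StableAdjunction M N Q) : Module.Finite B Q := by
  have := S.finite_left
  have := S.finite_right
  exact Module.Finite.of_surjective (LinearMap.snd B B Q ∘ₗ S.decomp.toLinearMap)
    (Prod.snd_surjective.comp S.decomp.surjective)

theorem map_injective_left (S : StableAdjunction M N Q) (f : X →ₗ[B] Y)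
    (hf : Function.Injective f) : Function.Injective (BalancedTensor.map A B M f) :=
  map_injective_of_adj S.adj' f hf

section Finite

variable [IsArtinianRing R]

theorem projective_tensor (S : StableAdjunction M N Q) :
    Module.Projective B (BalancedTensor B B Q X) :=
  S.isProjective.projective_tensor S.algebraMap_eq_zero

variable [Module.Finite R B]

/-- Hom(M ⊗ X, M ⊗ Y) is both Hom(N ⊗ M ⊗ X, Y) and Hom(X, N ⊗ M ⊗ Y). Decomposing N ⊗ M ⊗ - in each
and cancelling the finite length of Hom(X, Y) leaves the two terms with Q. -/
theorem homLength_tensor_left (S : StableAdjunction M N Q) [Module.Finite B X]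
    [Module.Finite B Y] :
    homLength R B (BalancedTensor B B Q X) Y = homLength R B X (BalancedTensor B B Q Y) := by
  have h1 := homLength_adj S.adj' (BalancedTensor A B M X) Y
  have h2 := homLength_adj S.adj X (BalancedTensor A B M Y)
  rw [homLength_congr_left (S.equivProd X), homLength_prod_left] at h1
  rw [homLength_congr_right (S.equivProd Y), homLength_prod_right] at h2
  rw [h2] at h1
  exact (ENat.addLECancellable_of_ne_top homLength_ne_top).inj.1 h1

/-- By Baer it is enough to extend from left ideals I ⊆ B. The required length inequality for Hom(-,
Q ⊗ Y) is the one for Hom(Q ⊗ -, Y), which holds because maps from Q ⊗ I extend to Q ⊗ B. -/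
theorem injective_tensor (S : StableAdjunction M N Q) [Module.Finite B Y] :
    Module.Injective B (BalancedTensor B B Q Y) := by
  have : IsNoetherian R B := inferInstance
  have : IsNoetherianRing B := isNoetherian_of_tower R this
  have := S.finite
  refine Module.Baer.injective fun I g => ?_
  obtain ⟨h, hh⟩ := exists_extend_of_homLength (R := R) I.subtype I.mkQ I.mkQ_surjective
    (LinearMap.exact_subtype_mkQ I) (by
      rw [← S.homLength_tensor_left, ← S.homLength_tensor_left, ← S.homLength_tensor_left]
      refine homLength_add_le (BalancedTensor.map B B Q I.subtype)
        (BalancedTensor.map B B Q I.mkQ) (BalancedTensor.map_surjective _ I.mkQ_surjective)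
        (linearMap_ext fun q x => ?_)
        fun f => S.isProjective.exists_extend_tensor S.algebraMap_eq_zero _
          Subtype.val_injective f
      change tmul q (I.mkQ x) = (0 : BalancedTensor B B Q (B ⧸ I))
      rw [show I.mkQ x = 0 from (Submodule.Quotient.mk_eq_zero I).2 x.2, BalancedTensor.tmul_zero]) g
  exact ⟨h, fun x hx => LinearMap.congr_fun hh ⟨x, hx⟩⟩

/-- The inclusion of W gives N ⊗ W → Q ⊗ B nonzero, hence Hom(Q ⊗ (N ⊗ W), B) ≠ 0 and Q ⊗ (N ⊗ W) ≠
0. Viewing the latter as maps from B, Hom(Q ⊗ B, N ⊗ W) ≠ 0, and the other adjunction gives a map to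
W. -/
theorem exists_ne_zero [Module.Finite R A] (S : StableAdjunction M N Q)
    (W : Submodule A (BalancedTensor A B M (BalancedTensor B B Q B))) (hW : W ≠ ⊥) :
    ∃ g : BalancedTensor A B M (BalancedTensor B B Q B) →ₗ[A] W, g ≠ 0 := by
  have := S.finite
  have := S.finite_left
  have := S.finite_right
  have : IsNoetherian R A := inferInstance
  have : IsNoetherianRing A := isNoetherian_of_tower R this
  obtain ⟨f, hf⟩ : ∃ f : BalancedTensor B A N W →ₗ[B] BalancedTensor B B Q B, f ≠ 0 := by
    refine ⟨(adjEquiv S.adj' W (BalancedTensor B B Q B)).symm W.subtype, fun h => ?_⟩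
    have h' : W.subtype = 0 := (AddEquiv.map_eq_zero_iff _).1 h
    refine hW ((Submodule.eq_bot_iff _).2 fun x hx => ?_)
    exact DFunLike.congr_fun h' ⟨x, hx⟩
  have h2 : homLength R B (BalancedTensor B A N W) (BalancedTensor B B Q B) ≠ 0 :=
    fun h => hf (homLength_eq_zero_iff.1 h f)
  rw [← S.homLength_tensor_left] at h2
  have h3 : homLength R B B (BalancedTensor B B Q (BalancedTensor B A N W)) ≠ 0 := fun h => by
    have hzero : ∀ x : BalancedTensor B B Q (BalancedTensor B A N W), x = 0 := fun x => by
      have := homLength_eq_zero_iff.1 h (LinearMap.toSpanSingleton B _ x)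
      rwa [LinearMap.toSpanSingleton_eq_zero_iff] at this
    refine h2 (homLength_eq_zero_iff.2 fun f => LinearMap.ext fun x => ?_)
    rw [hzero x]
    exact f.map_zero
  rw [← S.homLength_tensor_left] at h3
  by_contra hall
  push Not at hall
  refine h3 (homLength_eq_zero_iff.2 fun f => ?_)
  exact (AddEquiv.map_eq_zero_iff _).1 (hall ((adjEquiv S.adj (BalancedTensor B B Q B) W).symm f))

/-- For Y inside Q ⊗ B, the module M ⊗ Y is a summand of the injective M ⊗ (Q ⊗ B), so N ⊗ (M ⊗ Y)
is injective. Extending the inclusion of Y in it to Q ⊗ B and projecting back to Y gives a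
retraction. -/
theorem isSemisimpleModule_tensor [IsArtinianRing A] (S : StableAdjunction M N Q)
    (hsemi : IsSemisimpleModule A (BalancedTensor A B M (BalancedTensor B B Q B))) :
    IsSemisimpleModule B (BalancedTensor B B Q B) := by
  have := S.finite
  have := S.injective_tensor (Y := B)
  have hinj := injective_of_adj S.adj'
    (fun f hf => map_injective_of_adj S.adj f hf) (BalancedTensor B B Q B)
  refine { exists_isCompl := fun Y => ?_ }
  obtain ⟨r, hr⟩ := IsSemisimpleModule.extension_property (BalancedTensor.map A B M Y.subtype)
    (S.map_injective_left _ Y.injective_subtype) LinearMap.id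
  have h1 : Module.Injective A (BalancedTensor A B M Y) := ⟨fun X X' _ _ _ _ i hi g => by
    obtain ⟨k, hk⟩ := Module.Injective.extension_property A
      (BalancedTensor A B M (BalancedTensor B B Q B)) _ _ i hi
      (BalancedTensor.map A B M Y.subtype ∘ₗ g)
    refine ⟨r ∘ₗ k, fun x => ?_⟩
    have := LinearMap.congr_fun hk x
    rw [LinearMap.comp_apply] at this
    rw [LinearMap.comp_apply, this]
    exact LinearMap.congr_fun hr (g x)⟩
  have h2 := injective_of_adj S.adj (fun f hf => S.map_injective_left f hf)
    (BalancedTensor A B M Y)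
  obtain ⟨k, hk⟩ := Module.Injective.extension_property B
    (BalancedTensor B A N (BalancedTensor A B M Y)) _ _ Y.subtype Y.injective_subtype
    ((S.equivProd Y).symm.toLinearMap ∘ₗ LinearMap.inl B Y _)
  refine ⟨_, LinearMap.isCompl_of_proj
    (f := LinearMap.fst B Y _ ∘ₗ (S.equivProd Y).toLinearMap ∘ₗ k) fun x => ?_⟩
  have := LinearMap.congr_fun hk x
  simp only [LinearMap.comp_apply, Submodule.subtype_apply] at this
  simp only [LinearMap.comp_apply, this, LinearEquiv.coe_coe, LinearEquiv.apply_symm_apply]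
  rfl

end Finite

end StableAdjunction

end CentralBimodule

/-! ### Splitting off the semisimple block -/

/-- A finitely generated semisimple, projective and injective module over an Artin algebra splits
off a semisimple factor of the algebra. -/
theorem exists_central_idempotent (R : Type v) [CommRing R] [IsArtinianRing R] {B V : Type u}
    [Ring B] [Algebra R B] [Module.Finite R B] [AddCommGroup V] [Module B V] [Module.Finite B V]
    [IsSemisimpleModule B V] [Module.Projective B V] [Module.Injective B V] :
    ∃ c : B, c * c = c ∧ (∀ b, c * b = b * c) ∧ (∀ v : V, c • v = 0) ∧
      IsSemisimpleModule B (B ⧸ Submodule.span B {c}) := by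
  let := restrictModule R B V
  have := restrictModule_isScalarTower R B V
  have : Module.Finite R V := Module.Finite.trans B V
  -- Generators are taken over the central ring R, so that the kernel of b ↦ (b vⱼ) is the whole
  -- annihilator of V and thus two-sided.
  obtain ⟨n, v, hv⟩ := Module.Finite.exists_fin (R := R) (M := V)
  let L : B →ₗ[B] (Fin n → V) := LinearMap.pi fun j => LinearMap.toSpanSingleton B V (v j)
  have hL : ∀ b j, L b j = b • v j := fun b j => rfl
  have hker : ∀ b, L b = 0 → ∀ w : V, b • w = 0 := fun b hb w => by
    have hw : w ∈ Submodule.span R (Set.range v) := hv ▸ trivial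
    induction hw using Submodule.span_induction with
    | mem x hx =>
      obtain ⟨j, rfl⟩ := hx
      exact congrFun hb j
    | zero => exact smul_zero b
    | add x y _ _ hx hy => rw [smul_add, hx, hy, add_zero]
    | smul r x _ hx =>
      have : b • r • x = r • b • x := by
        change b • algebraMap R B r • x = algebraMap R B r • b • x
        rw [smul_smul, smul_smul, Algebra.commutes]
      rw [this, hx, smul_zero]
  have hker' : ∀ b, L b = 0 → ∀ w : Fin n → V, b • w = 0 := fun b hb w =>
    funext fun j => hker b hb (w j)
  have hann : ∀ b, (∀ w : V, b • w = 0) → L b = 0 := fun b hb => funext fun j => hb (v j)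
  let W := LinearMap.range L
  obtain ⟨r, hr⟩ := IsSemisimpleModule.extension_property W.subtype W.injective_subtype
    LinearMap.id
  have : Module.Projective B (Fin n → V) :=
    Module.Projective.of_equiv (DFinsupp.linearEquivFunOnFintype (R := B) (M := fun _ : Fin n => V))
  have : Module.Projective B W := Module.Projective.of_split W.subtype r hr
  have hinj : ∀ (C : Submodule B W), Module.Injective B C := fun C => by
    have hi0 : Function.Injective (W.subtype ∘ₗ C.subtype) :=
      W.injective_subtype.comp C.injective_subtype
    obtain ⟨r, hr⟩ := IsSemisimpleModule.extension_property (R := B) (M := Fin n → V) (N := C) (P := C)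
      (W.subtype ∘ₗ C.subtype) hi0 LinearMap.id
    refine ⟨fun X X' _ _ _ _ i hi g => ?_⟩
    obtain ⟨k, hk⟩ := Module.Injective.extension_property B (Fin n → V) _ _ i hi
      ((W.subtype ∘ₗ C.subtype) ∘ₗ g)
    refine ⟨r ∘ₗ k, fun x => ?_⟩
    have := LinearMap.congr_fun hk x
    rw [LinearMap.comp_apply] at this
    rw [LinearMap.comp_apply, this]
    exact LinearMap.congr_fun hr (g x)
  obtain ⟨t, ht⟩ := Module.projective_lifting_property L.rangeRestrict LinearMap.id
    L.surjective_rangeRestrict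
  have ht' : ∀ w : W, L (t w) = w := fun w => congrArg Subtype.val (LinearMap.congr_fun ht w)
  -- The image W of L is projective, so the annihilator is a summand of B, and c is the component of
  -- 1 in it.
  let c : B := 1 - t (L.rangeRestrict 1)
  have hLc : L c = 0 := by
    rw [map_sub, ht', sub_eq_zero]
    rfl
  have hright : ∀ x, L x = 0 → x * c = x := fun x hx => by
    have h1 : x * t (L.rangeRestrict 1) = 0 := by
      rw [← smul_eq_mul, ← map_smul, ← map_smul, smul_eq_mul, mul_one]
      have : L.rangeRestrict x = 0 := Subtype.ext hx
      rw [this, map_zero]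
    rw [mul_sub, mul_one, h1, sub_zero]
  have hmul_left : ∀ b x, L x = 0 → L (b * x) = 0 := fun b x hx => by
    rw [← smul_eq_mul, map_smul, hx, smul_zero]
  have hmul_right : ∀ b x, L x = 0 → L (x * b) = 0 := fun b x hx => hann _ fun w => by
    rw [mul_smul, hker x hx]
  have hleft : ∀ b, b * c = c * b * c := fun b => by
    have hw : L ((1 - c) * b * c) = 0 := hmul_left _ _ hLc
    set w := (1 - c) * b * c with hwdef
    -- To show w = (1-c)bc = 0: right multiplication by w factors through s : W → B. A complement C
    -- of ker s is injective, so s restricted to C has a retraction ρ : B → C.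
    obtain ⟨s, hs⟩ := LinearMap.exists_factor_of_surjective L.rangeRestrict
      L.surjective_rangeRestrict (LinearMap.toSpanSingleton B B w) fun x hx => by
        have hx' : L x = 0 := congrArg Subtype.val hx
        rw [LinearMap.toSpanSingleton_apply, smul_eq_mul, hwdef, mul_assoc, ← mul_assoc x,
          mul_sub, mul_one, hright x hx', sub_self, zero_mul]
    obtain ⟨C, hC⟩ := exists_isCompl (LinearMap.ker s)
    have := hinj C
    obtain ⟨ρ, hρ⟩ := Module.Injective.extension_property B C _ _ (s ∘ₗ C.subtype)
      (LinearMap.ker_eq_bot.1 (by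
        rw [LinearMap.ker_comp, ← Submodule.disjoint_iff_comap_eq_bot]
        exact hC.disjoint.symm)) LinearMap.id
    -- Since w annihilates V, ρ(w) = w ρ(1) = 0. But w = s(y) with y in C, so y = ρ(w) = 0.
    have hρw : ρ w = 0 := by
      rw [← mul_one w, ← smul_eq_mul, map_smul]
      exact Subtype.ext (Subtype.ext (hker' w hw _))
    obtain ⟨k, hk, y, hy, hky⟩ : ∃ k ∈ LinearMap.ker s, ∃ y ∈ C, k + y = L.rangeRestrict 1 :=
      Submodule.mem_sup.1 (hC.sup_eq_top ▸ trivial)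
    have hwy : w = s y := by
      have := hs 1
      rw [LinearMap.toSpanSingleton_apply, one_smul, ← hky, map_add, LinearMap.mem_ker.1 hk,
        zero_add] at this
      exact this.symm
    have hy0 : (⟨y, hy⟩ : C) = 0 := by
      rw [hwy] at hρw
      rw [← hρw]
      exact (LinearMap.congr_fun hρ ⟨y, hy⟩).symm
    have hw0 : w = 0 := by
      rw [hwy, show y = 0 from congrArg Subtype.val hy0, map_zero]
    rw [hwdef, sub_mul, one_mul, sub_mul, sub_eq_zero] at hw0
    exact hw0
  refine ⟨c, hright c hLc, fun b => ?_, hker c hLc, ?_⟩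
  · rw [hleft b]
    exact (hright _ (hmul_right b c hLc)).symm
  · have hspan : Submodule.span B {c} = LinearMap.ker L := by
      ext x
      rw [Submodule.mem_span_singleton, LinearMap.mem_ker]
      exact ⟨fun ⟨a, ha⟩ => ha ▸ hmul_left a c hLc, fun hx => ⟨x, hright x hx⟩⟩
    rw [hspan]
    exact IsSemisimpleModule.congr L.quotKerEquivRange

/-! ### Endomorphisms of M on the block that annihilates Q -/

namespace CentralBimodule

open BalancedTensor

variable {R : Type v} [CommRing R] {A B : Type u} [Ring A] [Algebra R A] [Ring B] [Algebra R B]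

/-- The isomorphism `M ⊗_B B ≅ M`. -/
noncomputable def tensorUnit (M : CentralBimodule R A B) : BalancedTensor A B M B ≃ₗ[A] M :=
  LinearEquiv.ofLinearMap
    (lift (fun m b => MulOpposite.op b • m) (fun m m' b => smul_add _ m m')
      (fun m b b' => by rw [MulOpposite.op_add, add_smul]) (fun a m b => (smul_comm a _ m).symm)
      (fun m b b' => by rw [smul_eq_mul, MulOpposite.op_mul, mul_smul]))
    (mkLeft A B 1)
    (LinearMap.ext fun m => by
      change MulOpposite.op (1 : B) • m = m
      rw [MulOpposite.op_one, one_smul])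
    (linearMap_ext fun m b => by
      change tmul (MulOpposite.op b • m) (1 : B) = tmul m b
      rw [BalancedTensor.smul_tmul, smul_eq_mul, mul_one])

theorem tensorUnit_tmul (M : CentralBimodule R A B) (m : M) (b : B) :
    M.tensorUnit (tmul m b) = MulOpposite.op b • m := rfl

theorem tensorUnit_symm (M : CentralBimodule R A B) (m : M) :
    M.tensorUnit.symm m = tmul m 1 := rfl

variable {M : CentralBimodule R A B} {N : CentralBimodule R B A} {Q : CentralBimodule R B B}
  {X Y : Type u} [AddCommGroup X] [Module B X] [AddCommGroup Y] [Module B Y]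

/-- Each q ⊗ x is the image of q ⊗ 1 under the map induced by b ↦ bx. -/
theorem smul_tensor_eq_zero {c : B} (hc : ∀ v : BalancedTensor B B Q B, c • v = 0)
    (t : BalancedTensor B B Q X) : c • t = 0 := by
  induction t using BalancedTensor.induction with
  | h0 => exact smul_zero c
  | htmul q x =>
    have : (tmul q x : BalancedTensor B B Q X)
        = BalancedTensor.map B B Q (LinearMap.toSpanSingleton B X x) (tmul q 1) := by
      rw [BalancedTensor.map_tmul, LinearMap.toSpanSingleton_apply, one_smul]
    rw [this, ← map_smul, hc, _root_.map_zero]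
  | hadd s t hs ht => rw [smul_add, hs, ht, add_zero]

namespace StableAdjunction

section Finite

variable [IsArtinianRing R]

/-- Hom(M ⊗ X, M ⊗ Y) has the length of Hom(X, Y) plus that of Hom(Q ⊗ X, Y). When the second
vanishes, the faithful functor M ⊗ - is full by counting. -/
theorem map_surjective_of_homLength [Module.Finite R A] (S : StableAdjunction M N Q)
    [Module.Finite B X] [Module.Finite B Y]
    (h : homLength R B (BalancedTensor B B Q X) Y = 0) :
    Function.Surjective (BalancedTensor.map A B M : (X →ₗ[B] Y) → _) := by
  have := S.finite_left
  let e : (X →ₗ[B] Y) →+ (BalancedTensor A B M X →ₗ[A] BalancedTensor A B M Y) :=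
    AddMonoidHom.mk' (BalancedTensor.map A B M) BalancedTensor.map_add
  refine surjective_of_homLength_le (R := R) e S.map_injective (fun r f => ?_) homLength_ne_top ?_
  · rw [← map_centralMul]
    exact linearMap_ext fun m x => rfl
  · rw [← homLength_adj S.adj', homLength_congr_left (S.equivProd X), homLength_prod_left, h,
      add_zero]

variable [Module.Finite R B]

/-- Maps from X to Q ⊗ (Q ⊗ X) vanish, as c is the identity on one side and zero on the other. By
length self-adjointness the identity of Q ⊗ X vanishes too. -/
theorem tensor_eq_zero (S : StableAdjunction M N Q) {c : B}
    (hc : ∀ v : BalancedTensor B B Q B, c • v = 0) [Module.Finite B X]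
    (hX : ∀ x : X, c • x = x) (t : BalancedTensor B B Q X) : t = 0 := by
  have := S.finite
  have h : homLength R B X (BalancedTensor B B Q (BalancedTensor B B Q X)) = 0 :=
    homLength_eq_zero_iff.2 fun f => LinearMap.ext fun x => by
      rw [← hX x, map_smul, smul_tensor_eq_zero hc, LinearMap.zero_apply]
  rw [← S.homLength_tensor_left] at h
  exact LinearMap.congr_fun (homLength_eq_zero_iff.1 h LinearMap.id) t

/-- The endomorphism φ restricted to Mc, or composed with the projection onto Mc, is a map between
modules M ⊗ X on which M ⊗ - is full. Both are thus right multiplications by elements of Bc, which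
turn out to agree. -/
theorem exists_smul_eq [Module.Finite R A] (S : StableAdjunction M N Q) {c : B} (hcc : c * c = c)
    (hcomm : ∀ b, c * b = b * c) (hc : ∀ v : BalancedTensor B B Q B, c • v = 0)
    (φ : M →ₗ[A] M) : ∃ a : B, c * a = a ∧ ∀ m, φ (MulOpposite.op c • m) = MulOpposite.op a • m ∧
      MulOpposite.op c • φ m = MulOpposite.op a • m := by
  have : IsNoetherian R B := inferInstance
  have : IsNoetherianRing B := isNoetherian_of_tower R this
  have := S.finite
  let I : Submodule B B := Submodule.span B {c}
  have hI : ∀ x : I, c • x = x := fun x => by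
    obtain ⟨a, ha⟩ := Submodule.mem_span_singleton.1 x.2
    refine Subtype.ext ?_
    rw [Submodule.coe_smul, ← ha, smul_eq_mul, smul_eq_mul, ← mul_assoc, hcomm a, mul_assoc, hcc]
  let p : B →ₗ[B] I := (LinearMap.toSpanSingleton B B c).codRestrict I fun b =>
    Submodule.mem_span_singleton.2 ⟨b, rfl⟩
  let φ' : BalancedTensor A B M B →ₗ[A] BalancedTensor A B M B :=
    M.tensorUnit.symm.toLinearMap ∘ₗ φ ∘ₗ M.tensorUnit.toLinearMap
  obtain ⟨f, hf⟩ := S.map_surjective_of_homLength (X := I) (Y := B)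
    (homLength_eq_zero_iff.2 fun g => LinearMap.ext fun t => by
      rw [S.tensor_eq_zero hc hI t, _root_.map_zero, _root_.map_zero])
    (φ' ∘ₗ BalancedTensor.map A B M I.subtype)
  obtain ⟨g, hg⟩ := S.map_surjective_of_homLength (X := B) (Y := I)
    (homLength_eq_zero_iff.2 fun g => LinearMap.ext fun t => by
      rw [← hI (g t), ← map_smul, hc, _root_.map_zero, LinearMap.zero_apply])
    (BalancedTensor.map A B M p ∘ₗ φ')
  have h1 : ∀ m, φ (MulOpposite.op c • m) = MulOpposite.op (f (p 1)) • m := fun m => by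
    have := congrArg M.tensorUnit (LinearMap.congr_fun hf (tmul m (p 1)))
    rw [BalancedTensor.map_tmul, tensorUnit_tmul] at this
    rw [this]
    change _ = M.tensorUnit (M.tensorUnit.symm (φ (MulOpposite.op (p 1 : B) • m)))
    rw [LinearEquiv.apply_symm_apply]
    change _ = φ (MulOpposite.op (1 * c) • m)
    rw [one_mul]
  have h2 : ∀ m, MulOpposite.op c • φ m = MulOpposite.op (g 1 : B) • m := fun m => by
    have := congrArg (fun t => M.tensorUnit (BalancedTensor.map A B M I.subtype t))
      (LinearMap.congr_fun hg (tmul m 1))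
    change M.tensorUnit (tmul m (g 1 : B)) = M.tensorUnit (BalancedTensor.map A B M I.subtype
      (BalancedTensor.map A B M p (M.tensorUnit.symm (φ (M.tensorUnit (tmul m 1)))))) at this
    rw [tensorUnit_tmul, tensorUnit_tmul, MulOpposite.op_one, one_smul, tensorUnit_symm,
      BalancedTensor.map_tmul, BalancedTensor.map_tmul, tensorUnit_tmul] at this
    rw [this]
    change _ = MulOpposite.op (1 * c) • φ m
    rw [one_mul]
  have hg1 : c * (g 1 : B) = g 1 := congrArg Subtype.val (hI (g 1))
  refine ⟨g 1, hg1, fun m => ⟨?_, h2 m⟩⟩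
  have h3 : c * f (p 1) = f (p 1) := by
    rw [← smul_eq_mul, ← map_smul, hI]
  -- Evaluating φ(-)c at mc identifies the two multipliers: f(c) and g(1) act alike on M.
  have h4 := h2 (MulOpposite.op c • m)
  rw [h1, smul_smul, smul_smul, ← MulOpposite.op_mul, ← MulOpposite.op_mul, hg1, ← hcomm, h3]
    at h4
  rw [h1, h4]

end Finite

end StableAdjunction

end CentralBimodule

/-! ### Central idempotents of End U come from H -/

/-- A central idempotent endomorphism of a module `U` with `Ext¹(U, U) = 0` for which the regular
module has an `add U`-coresolution is the action of a central idempotent. -/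
theorem exists_central_idempotent_smul_eq {H U : Type u} [Ring H] [AddCommGroup U] [Module H U]
    (hext : Subsingleton (Abelian.Ext.{u} (ModuleCat.of H U) (ModuleCat.of H U) 1))
    (hcores : ∃ (T₀ T₁ : ModuleCat.{u} H) (f : H →ₗ[H] T₀) (g : T₀ →ₗ[H] T₁),
      MemAdd H U T₀ ∧ MemAdd H U T₁ ∧
      Function.Injective f ∧ Function.Exact f g ∧ Function.Surjective g)
    (e : U →ₗ[H] U) (he : ∀ u, e (e u) = e u) (hcomm : ∀ (θ : U →ₗ[H] U) u, e (θ u) = θ (e u)) :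
    ∃ ε : H, ε * ε = ε ∧ (∀ h, ε * h = h * ε) ∧ ∀ u : U, ε • u = e u := by
  obtain ⟨X, Y, f, g, hX, hY, hf, hfg, hg⟩ := hcores
  have hext' := subsingleton_ext_one_of_memAdd hext hY (MemAdd.refl (H := H) (T := U))
  obtain ⟨n, a, b, hab⟩ := hX.exists_sum
  obtain ⟨m, a', b', hab'⟩ := hY.exists_sum
  -- Centrality of e makes its transport to X commute with all maps X → U. Hence g kills eX (f 1),
  -- since every component of g in U does.
  let eX : X →ₗ[H] X := ∑ j, b j ∘ₗ e ∘ₗ a j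
  have heX : ∀ x, eX x = ∑ j, b j (e (a j x)) := fun x => by
    simp only [eX, LinearMap.sum_apply, LinearMap.comp_apply]
  have hnat : ∀ (k : X →ₗ[H] U) x, k (eX x) = e (k x) := fun k x => by
    conv_rhs => rw [← hab x]
    rw [heX, map_sum, map_sum, map_sum]
    exact Finset.sum_congr rfl fun j _ => (hcomm (k ∘ₗ b j) (a j x)).symm
  have hg0 : g (eX (f 1)) = 0 := by
    rw [← hab' (g (eX (f 1)))]
    refine Finset.sum_eq_zero fun j _ => ?_
    have := hnat (a' j ∘ₗ g) (f 1)
    rw [LinearMap.comp_apply, LinearMap.comp_apply, hfg.apply_apply_eq_zero, map_zero,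
      map_zero] at this
    rw [this, map_zero]
  obtain ⟨ε, hε⟩ := (hfg _).1 hg0
  -- Extend 1 ↦ u along f to k : X → U; then εu = k(eX (f 1)) = e(k(f 1)) = eu.
  have hεu : ∀ u : U, ε • u = e u := fun u => by
    obtain ⟨k, hk⟩ := exists_extend_of_ext_one hext' f g hf hfg hg (LinearMap.toSpanSingleton H U u)
    have h1 : ∀ h, k (f h) = h • u := LinearMap.congr_fun hk
    rw [← h1, hε, hnat, h1, one_smul]
  have hfaith : ∀ h h' : H, (∀ u : U, h • u = h' • u) → h = h' := fun h h' hh => by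
    refine hf ?_
    have : ∀ h, f h = ∑ j, b j (h • a j (f 1)) := fun h => by
      conv_lhs => rw [← mul_one h, ← smul_eq_mul, map_smul, ← hab (f 1), Finset.smul_sum]
      exact Finset.sum_congr rfl fun j _ => (map_smul (b j) h _).symm
    rw [this h, this h']
    exact Finset.sum_congr rfl fun j _ => by rw [hh]
  exact ⟨ε, hfaith _ _ fun u => by rw [mul_smul, hεu, hεu, he],
    fun h => hfaith _ _ fun u => by rw [mul_smul, mul_smul, hεu, hεu, map_smul], hεu⟩

/-! ### Restriction of a tilting module to a block of H -/

/-- A central idempotent of a ring. -/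
structure CentralIdempotent (H : Type u) [Ring H] where
  val : H
  mul_self : val * val = val
  comm : ∀ h, val * h = h * val

namespace CentralIdempotent

variable {H : Type u} [Ring H] (ε : CentralIdempotent H)

/-- The complementary ideal `H(1 - ε)` of a central idempotent `ε`. -/
def ideal : Ideal H := LinearMap.ker (LinearMap.toSpanSingleton H H ε.val)

theorem mem_ideal {h : H} : h ∈ ε.ideal ↔ h * ε.val = 0 := Iff.rfl

instance : ε.ideal.IsTwoSided := ⟨fun {a} b ha => by
  rw [mem_ideal] at ha ⊢
  rw [mul_assoc, ← ε.comm, ← mul_assoc, ha, zero_mul]⟩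

/-- The factor `H / H(1 - ε)` of `H`. -/
abbrev Factor : Type u := H ⧸ ε.ideal

instance : IsScalarTower H ε.Factor ε.Factor := ⟨fun h x y => by
  obtain ⟨x, rfl⟩ := Ideal.Quotient.mk_surjective x
  obtain ⟨y, rfl⟩ := Ideal.Quotient.mk_surjective y
  exact congrArg (Ideal.Quotient.mk ε.ideal) (mul_assoc h x y)⟩

theorem mk_smul {X : Type u} [AddCommGroup X] [Module H X] [Module ε.Factor X]
    [IsScalarTower H ε.Factor X] (h : H) (x : X) : Ideal.Quotient.mk ε.ideal h • x = h • x := by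
  have : Ideal.Quotient.mk ε.ideal h = h • (1 : ε.Factor) :=
    congrArg (Ideal.Quotient.mk ε.ideal) (mul_one h).symm
  rw [this, smul_assoc, one_smul]

theorem mk_val : Ideal.Quotient.mk ε.ideal ε.val = 1 := by
  rw [← map_one (Ideal.Quotient.mk ε.ideal), Ideal.Quotient.eq, mem_ideal, sub_mul, one_mul,
    ε.mul_self, sub_self]

theorem val_smul {X : Type u} [AddCommGroup X] [Module H X] [Module ε.Factor X]
    [IsScalarTower H ε.Factor X] (x : X) : ε.val • x = x := by
  rw [← ε.mk_smul, mk_val, one_smul]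

section

variable {X Y : Type u} [AddCommGroup X] [Module H X] [Module ε.Factor X]
    [IsScalarTower H ε.Factor X] [AddCommGroup Y] [Module H Y] [Module ε.Factor Y]
    [IsScalarTower H ε.Factor Y]

/-- An `H`-linear map between modules over the factor is linear over the factor. -/
def extendScalars (f : X →ₗ[H] Y) : X →ₗ[ε.Factor] Y :=
  { f with
    map_smul' := fun h x => by
      obtain ⟨h, rfl⟩ := Ideal.Quotient.mk_surjective h
      change f (Ideal.Quotient.mk ε.ideal h • x) = Ideal.Quotient.mk ε.ideal h • f x
      rw [mk_smul, mk_smul, map_smul] }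

theorem extendScalars_apply (f : X →ₗ[H] Y) (x : X) : ε.extendScalars f x = f x := rfl

end

/-- The preimage of a left ideal is projective over H. An H-map from it to a module over the factor
kills the kernel, because ε is zero on the kernel and the identity on the target. -/
theorem isHereditary_factor (hH : IsHereditary H) : IsHereditary ε.Factor := fun I => by
  refine Module.Projective.of_lifting_property'' fun f hf => ?_
  let J : Submodule H H := (I.restrictScalars H).comap ε.ideal.mkQ
  have := hH J
  let g : J →ₗ[H] I :=
    { toFun := fun x => ⟨Ideal.Quotient.mk ε.ideal x, x.2⟩
      map_add' := fun x y => rfl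
      map_smul' := fun h x => rfl }
  have hg : Function.Surjective g := fun ⟨y, hy⟩ => by
    obtain ⟨x, rfl⟩ := Ideal.Quotient.mk_surjective y
    exact ⟨⟨x, hy⟩, rfl⟩
  obtain ⟨k, hk⟩ := Module.projective_lifting_property (f.restrictScalars H) g hf
  obtain ⟨s, hs⟩ := LinearMap.exists_factor_of_surjective g hg k fun x hx => by
    have h1 : (x : H) * ε.val = 0 := by
      rw [← mem_ideal]
      exact Ideal.Quotient.eq_zero_iff_mem.1 (congrArg Subtype.val hx)
    have h2 : ε.val • x = 0 := Subtype.ext ((ε.comm x).trans h1)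
    rw [← ε.val_smul (k x), ← map_smul, h2, map_zero]
  refine ⟨ε.extendScalars s, LinearMap.ext fun y => ?_⟩
  obtain ⟨x, rfl⟩ := hg y
  rw [LinearMap.comp_apply, extendScalars_apply, hs]
  exact LinearMap.congr_fun hk x

variable (X Y : Type u) [AddCommGroup X] [Module H X] [AddCommGroup Y] [Module H Y]

/-- The part `εX` of a module `X`. -/
def part : Submodule H X where
  carrier := {x | ε.val • x = x}
  add_mem' {x y} hx hy := by
    change ε.val • (x + y) = x + y
    rw [smul_add, hx, hy]
  zero_mem' := smul_zero _
  smul_mem' h x hx := by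
    change ε.val • h • x = h • x
    rw [smul_smul, ε.comm, mul_smul, hx]

theorem part_isTorsionBySet : Module.IsTorsionBySet H (ε.part X) ε.ideal := fun x h => by
  have hx : ε.val • (x : X) = x := x.2
  refine Subtype.ext ?_
  change (h : H) • (x : X) = 0
  rw [← hx, smul_smul, ε.mem_ideal.1 h.2, zero_smul]

instance : Module ε.Factor (ε.part X) := (ε.part_isTorsionBySet X).module

instance : IsScalarTower H ε.Factor (ε.part X) := ⟨fun h k x => by
  obtain ⟨k, rfl⟩ := Ideal.Quotient.mk_surjective k
  exact mul_smul h k x⟩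

/-- The projection `X → εX`. -/
def toPart : X →ₗ[H] ε.part X where
  toFun x := ⟨ε.val • x, by
    change ε.val • ε.val • x = ε.val • x
    rw [smul_smul, ε.mul_self]⟩
  map_add' x y := Subtype.ext (smul_add _ x y)
  map_smul' h x := Subtype.ext (by
    change ε.val • h • x = h • ε.val • x
    rw [smul_smul, ε.comm, mul_smul])

variable {X Y}

theorem coe_toPart (x : X) : (ε.toPart X x : X) = ε.val • x := rfl

theorem toPart_coe (x : ε.part X) : ε.toPart X x = x := Subtype.ext x.2

/-- The restriction `εX → εY` of a map. -/
def partMap (f : X →ₗ[H] Y) : ε.part X →ₗ[H] ε.part Y := ε.toPart Y ∘ₗ f ∘ₗ (ε.part X).subtype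

theorem coe_partMap (f : X →ₗ[H] Y) (x : ε.part X) : (ε.partMap f x : Y) = f x := by
  change ε.val • f x = f x
  rw [← map_smul]
  exact congrArg f x.2

theorem memAdd_part {U : Type u} [AddCommGroup U] [Module H U] (h : MemAdd H U X) :
    MemAdd ε.Factor (ε.part U) (ε.part X) := by
  obtain ⟨n, a, b, hab⟩ := h.exists_sum
  refine MemAdd.of_sum (fun j => ε.extendScalars (ε.partMap (a j)))
    (fun j => ε.extendScalars (ε.partMap (b j))) fun x => Subtype.ext ?_
  rw [AddSubmonoidClass.coe_finsetSum]
  simp only [extendScalars_apply, coe_partMap]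
  exact hab x

theorem part_memAdd {U : Type u} [AddCommGroup U] [Module H U] : MemAdd H U (ε.part U) :=
  MemAdd.of_sum (n := 1) (fun _ => (ε.part U).subtype) (fun _ => ε.toPart U) fun x => by
    rw [Finset.sum_const, Finset.card_univ, Fintype.card_fin, one_smul]
    exact ε.toPart_coe x

/-- The factor is hereditary, so only an extension property and a coresolution are needed. The first
is pulled back along Hⁿ → (H/H(1-ε))ⁿ and solved over H by rigidity of εU; the second is ε times the
given coresolution. -/
theorem isOneTilting_part {U : Type u} [AddCommGroup U] [Module H U] [Module.Finite H U]
    (hH : IsHereditary H)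
    (hext : Subsingleton (Abelian.Ext.{u} (ModuleCat.of H U) (ModuleCat.of H U) 1))
    (hcores : ∃ (T₀ T₁ : ModuleCat.{u} H) (f : H →ₗ[H] T₀) (g : T₀ →ₗ[H] T₁),
      MemAdd H U T₀ ∧ MemAdd H U T₁ ∧
      Function.Injective f ∧ Function.Exact f g ∧ Function.Surjective g) :
    IsOneTilting ε.Factor (ε.part U) := by
  have : Module.Finite H (ε.part U) :=
    Module.Finite.of_surjective (ε.toPart U) fun x => ⟨x, ε.toPart_coe x⟩
  have : Module.Finite ε.Factor (ε.part U) := Module.Finite.of_restrictScalars_finite H _ _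
  refine (ε.isHereditary_factor hH).isOneTilting (fun n p hp g => ?_) ?_
  · let π : (Fin n → H) →ₗ[H] (Fin n → ε.Factor) := ε.ideal.mkQ.compLeft (Fin n)
    have hπ : Function.Surjective π := fun y => by
      choose x hx using fun j => Ideal.Quotient.mk_surjective (y j)
      exact ⟨x, funext hx⟩
    let q : (Fin n → H) →ₗ[H] ε.part U := p.restrictScalars H ∘ₗ π
    let k : LinearMap.ker q →ₗ[H] ε.part U :=
      { toFun := fun x => g ⟨π x, x.2⟩
        map_add' := fun x y => by
          rw [← map_add]
          exact congrArg g (Subtype.ext (map_add π _ _))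
        map_smul' := fun h x => by
          rw [RingHom.id_apply, ← ε.mk_smul h (g _), ← map_smul]
          refine congrArg g (Subtype.ext ?_)
          change π (h • x.1) = Ideal.Quotient.mk ε.ideal h • π x.1
          rw [ε.mk_smul, map_smul] }
    obtain ⟨f, hf⟩ := exists_extend_of_ext_one
      (subsingleton_ext_one_of_memAdd hext ε.part_memAdd ε.part_memAdd)
      (LinearMap.ker q).subtype q Subtype.val_injective (LinearMap.exact_subtype_ker_map q)
      (hp.comp hπ) k
    obtain ⟨s, hs⟩ := LinearMap.exists_factor_of_surjective π hπ f fun x hx => by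
      have h1 : ε.val • x = 0 := funext fun j => by
        have : (x j) * ε.val = 0 :=
          ε.mem_ideal.1 (Ideal.Quotient.eq_zero_iff_mem.1 (congrFun hx j))
        exact (ε.comm _).trans this
      rw [← ε.val_smul (f x), ← map_smul, h1, map_zero]
    refine ⟨ε.extendScalars s, fun ⟨y, hy⟩ => ?_⟩
    obtain ⟨x, rfl⟩ := hπ y
    rw [extendScalars_apply, hs]
    exact LinearMap.congr_fun hf ⟨x, hy⟩
  · obtain ⟨X, Y, f, g, hX, hY, hf, hfg, hg⟩ := hcores
    obtain ⟨s, hs⟩ := LinearMap.exists_factor_of_surjective ε.ideal.mkQ ε.ideal.mkQ_surjective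
      (ε.toPart X ∘ₗ f) fun h hh => by
        have h1 : h * ε.val = 0 := ε.mem_ideal.1 (Ideal.Quotient.eq_zero_iff_mem.1 hh)
        refine Subtype.ext ?_
        change ε.val • f h = 0
        rw [← map_smul, smul_eq_mul, ε.comm, h1, map_zero]
    have hs' : ∀ h, (s (Ideal.Quotient.mk ε.ideal h) : X) = ε.val • f h := fun h =>
      congrArg Subtype.val (hs h)
    refine ⟨ModuleCat.of ε.Factor (ε.part X), ModuleCat.of ε.Factor (ε.part Y),
      ε.extendScalars s, ε.extendScalars (ε.partMap g), ε.memAdd_part hX, ε.memAdd_part hY,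
      (injective_iff_map_eq_zero _).2 fun y hy => ?_, fun x => ⟨fun hx => ?_, ?_⟩, fun y => ?_⟩
    · obtain ⟨h, rfl⟩ := Ideal.Quotient.mk_surjective y
      have h1 : ε.val • f h = 0 := (hs' h).symm.trans (congrArg Subtype.val hy)
      rw [← map_smul, smul_eq_mul, ε.comm] at h1
      rw [Ideal.Quotient.eq_zero_iff_mem, mem_ideal]
      exact hf (h1.trans (map_zero f).symm)
    · have h1 : g (x : ε.part X) = 0 :=
        (ε.coe_partMap g x).symm.trans (congrArg Subtype.val hx)
      obtain ⟨h, hh⟩ := (hfg _).1 h1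
      refine ⟨Ideal.Quotient.mk ε.ideal h, Subtype.ext ?_⟩
      refine (hs' h).trans ?_
      rw [hh]
      exact (x : ε.part X).2
    · rintro ⟨y, rfl⟩
      obtain ⟨h, rfl⟩ := Ideal.Quotient.mk_surjective y
      refine Subtype.ext ((ε.coe_partMap g _).trans ?_)
      change g (s (Ideal.Quotient.mk ε.ideal h) : X) = 0
      rw [hs', map_smul, hfg.apply_apply_eq_zero, smul_zero]
    · obtain ⟨x, hx⟩ := hg (y : ε.part Y)
      refine ⟨ε.toPart X x, Subtype.ext ((ε.coe_partMap g _).trans ?_)⟩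
      rw [coe_toPart, map_smul, hx]
      exact (y : ε.part Y).2

end CentralIdempotent

/-! ### Closure of tilted algebras under isomorphism and products; semisimple algebras -/

theorem IsTiltedAlgebra.of_algEquiv {R : Type v} [CommRing R] {A B : Type u} [Ring A]
    [Algebra R A] [Ring B] [Algebra R B] (h : IsTiltedAlgebra R A) (e : B ≃ₐ[R] A) :
    IsTiltedAlgebra R B := by
  obtain ⟨H, _, _, T, _, _, _, _, h1, h2, h3, ⟨f⟩⟩ := h
  exact ⟨H, _, _, T, _, _, _, _, h1, h2, h3, ⟨e.trans f⟩⟩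

theorem IsHereditary.isOneTilting_self {H : Type u} [Ring H] (hH : IsHereditary H) :
    IsOneTilting H H :=
  isOneTilting_of_presentation (K := PUnit.{u + 1}) (L := H) 0 LinearMap.id
    (Function.injective_of_subsingleton _)
    (fun x => ⟨fun h => ⟨0, h.symm⟩, fun ⟨y, hy⟩ => hy.symm⟩) Function.surjective_id
    (fun g => ⟨0, Subsingleton.elim _ _⟩)
    ⟨ModuleCat.of H H, ModuleCat.of H PUnit, LinearMap.id, 0, MemAdd.refl,
      MemAdd.of_sum (n := 0) Fin.elim0 Fin.elim0 fun x => rfl, Function.injective_id,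
      fun x => ⟨fun _ => ⟨x, rfl⟩, fun _ => rfl⟩, fun y => ⟨0, rfl⟩⟩

theorem isHereditary_of_isSemisimpleRing {H : Type u} [Ring H] [IsSemisimpleRing H] :
    IsHereditary H := fun I => by
  obtain ⟨r, hr⟩ := IsSemisimpleModule.extension_property I.subtype I.injective_subtype
    LinearMap.id
  exact Module.Projective.of_split I.subtype r hr

/-- A semisimple Artin algebra is tilted. -/
theorem isTiltedAlgebra_of_isSemisimpleRing {R : Type v} [CommRing R] {S : Type u} [Ring S]
    [Algebra R S] [Module.Finite R S] [IsSemisimpleRing S] : IsTiltedAlgebra R S :=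
  have h : IsHereditary Sᵐᵒᵖ := isHereditary_of_isSemisimpleRing
  ⟨Sᵐᵒᵖ, inferInstance, inferInstance, Sᵐᵒᵖ, inferInstance, inferInstance, inferInstance,
    inferInstance, inferInstance, h, h.isOneTilting_self,
    ⟨(AlgEquiv.opOp R S).trans (AlgEquiv.moduleEndSelf R)⟩⟩

section Product

/-- By surjectivity an H-submodule of H' is a left ideal of H', hence a summand of a free H'-module,
and that is projective over H. -/
theorem IsHereditary.submodulesProjective_of_surjective {H H' : Type u} [Ring H] [Ring H']
    (hH : IsHereditary H') [Module H H'] [IsScalarTower H H' H'] [Module.Projective H H']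
    (hsurj : ∀ h' : H', ∃ h : H, h • (1 : H') = h') : SubmodulesProjective H H' := fun N => by
  let N' : Submodule H' H' :=
    { N with
      smul_mem' := fun h' x hx => by
        obtain ⟨h, rfl⟩ := hsurj h'
        rw [smul_assoc, one_smul]
        exact N.smul_mem h hx }
  have : Module.Projective H' N' := hH N'
  obtain ⟨s, hs⟩ := Module.projective_def'.1 this
  have : Module.Projective H (N' →₀ H') := by
    classical exact Module.Projective.of_equiv (finsuppLequivDFinsupp H).symm
  have : Module.Projective H N' := Module.Projective.of_split (s.restrictScalars H)
    ((Finsupp.linearCombination H' id).restrictScalars H)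
    (LinearMap.ext fun y => LinearMap.congr_fun hs y)
  exact this

variable {H₁ H₂ : Type u} [Ring H₁] [Ring H₂]

theorem IsHereditary.prod (h₁ : IsHereditary H₁) (h₂ : IsHereditary H₂) :
    IsHereditary (H₁ × H₂) := by
  let m₁ : Module (H₁ × H₂) H₁ := Module.compHom H₁ (RingHom.fst H₁ H₂)
  let m₂ : Module (H₁ × H₂) H₂ := Module.compHom H₂ (RingHom.snd H₁ H₂)
  have : IsScalarTower (H₁ × H₂) H₁ H₁ := ⟨fun h x y => mul_assoc h.1 x y⟩
  have : IsScalarTower (H₁ × H₂) H₂ H₂ := ⟨fun h x y => mul_assoc h.2 x y⟩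
  have : Module.Projective (H₁ × H₂) H₁ := Module.Projective.of_split (M := H₁ × H₂)
    { toFun := fun x => (x, 0)
      map_add' := fun x y => by simp
      map_smul' := fun h x => Prod.ext rfl (mul_zero h.2).symm }
    { toFun := fun x => x.1
      map_add' := fun x y => rfl
      map_smul' := fun h x => rfl } rfl
  have : Module.Projective (H₁ × H₂) H₂ := Module.Projective.of_split (M := H₁ × H₂)
    { toFun := fun x => (0, x)
      map_add' := fun x y => by simp
      map_smul' := fun h x => Prod.ext (mul_zero h.1).symm rfl }
    { toFun := fun x => x.2
      map_add' := fun x y => rfl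
      map_smul' := fun h x => rfl } rfl
  exact ((h₁.submodulesProjective_of_surjective fun h => ⟨(h, 0), mul_one h⟩).prod
    (h₂.submodulesProjective_of_surjective fun h => ⟨(0, h), mul_one h⟩)).of_injective
    ({ toFun := fun x => x
       map_add' := fun x y => rfl
       map_smul' := fun h x => rfl }) fun x y h => h

/-- The module `X × Y` over a product of two rings. -/
abbrev prodModule (X Y : Type u) [AddCommGroup X] [Module H₁ X] [AddCommGroup Y]
    [Module H₂ Y] : Module (H₁ × H₂) (X × Y) where
  smul h x := (h.1 • x.1, h.2 • x.2)
  one_smul x := Prod.ext (one_smul _ _) (one_smul _ _)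
  mul_smul h k x := Prod.ext (mul_smul _ _ _) (mul_smul _ _ _)
  smul_zero h := Prod.ext (smul_zero _) (smul_zero _)
  smul_add h x y := Prod.ext (smul_add _ _ _) (smul_add _ _ _)
  add_smul h k x := Prod.ext (add_smul _ _ _) (add_smul _ _ _)
  zero_smul x := Prod.ext (zero_smul _ _) (zero_smul _ _)

attribute [local instance] prodModule

variable {T₁ X₁ Y₁ T₂ X₂ Y₂ : Type u} [AddCommGroup T₁] [Module H₁ T₁] [AddCommGroup X₁]
  [Module H₁ X₁] [AddCommGroup Y₁] [Module H₁ Y₁] [AddCommGroup T₂] [Module H₂ T₂]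
  [AddCommGroup X₂] [Module H₂ X₂] [AddCommGroup Y₂] [Module H₂ Y₂]

/-- The product of an `H₁`-linear and an `H₂`-linear map. -/
def prodMapOver (f : X₁ →ₗ[H₁] Y₁) (g : X₂ →ₗ[H₂] Y₂) : X₁ × X₂ →ₗ[H₁ × H₂] Y₁ × Y₂ where
  toFun x := (f x.1, g x.2)
  map_add' x y := Prod.ext (map_add f _ _) (map_add g _ _)
  map_smul' h x := Prod.ext (map_smul f _ _) (map_smul g _ _)

theorem prodMapOver_apply (f : X₁ →ₗ[H₁] Y₁) (g : X₂ →ₗ[H₂] Y₂) (x : X₁ × X₂) :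
    prodMapOver f g x = (f x.1, g x.2) := rfl

theorem MemAdd.prodOver (h₁ : MemAdd H₁ T₁ X₁) (h₂ : MemAdd H₂ T₂ X₂) :
    MemAdd (H₁ × H₂) (T₁ × T₂) (X₁ × X₂) := by
  obtain ⟨n, a, b, hab⟩ := h₁.exists_sum
  obtain ⟨m, a', b', hab'⟩ := h₂.exists_sum
  refine MemAdd.of_sum (n := n + m)
    (Fin.append (fun j => prodMapOver (a j) 0) (fun j => prodMapOver 0 (a' j)))
    (Fin.append (fun j => prodMapOver (b j) 0) (fun j => prodMapOver 0 (b' j))) fun x => ?_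
  rw [Fin.sum_univ_add]
  simp only [Fin.append_left, Fin.append_right, prodMapOver_apply, LinearMap.zero_apply]
  refine Prod.ext ?_ ?_
  · rw [Prod.fst_add, Prod.fst_sum, Prod.fst_sum, Finset.sum_const_zero, add_zero]
    exact hab x.1
  · rw [Prod.snd_add, Prod.snd_sum, Prod.snd_sum, Finset.sum_const_zero, zero_add]
    exact hab' x.2

theorem finite_prodOver [Module.Finite H₁ T₁] [Module.Finite H₂ T₂] :
    Module.Finite (H₁ × H₂) (T₁ × T₂) := by
  obtain ⟨n, v, hv⟩ := Module.Finite.exists_fin (R := H₁) (M := T₁)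
  obtain ⟨m, w, hw⟩ := Module.Finite.exists_fin (R := H₂) (M := T₂)
  let N : Submodule (H₁ × H₂) (T₁ × T₂) := Submodule.span _
    (Set.range (fun j => (v j, (0 : T₂))) ∪ Set.range (fun j => ((0 : T₁), w j)))
  have h1 : ∀ x : T₁, (x, (0 : T₂)) ∈ N := fun x => by
    have hx : x ∈ Submodule.span H₁ (Set.range v) := hv ▸ trivial
    induction hx using Submodule.span_induction with
    | mem x hx =>
      obtain ⟨j, rfl⟩ := hx
      exact Submodule.subset_span (Or.inl ⟨j, rfl⟩)
    | zero => exact N.zero_mem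
    | add x y _ _ hx hy =>
      have := N.add_mem hx hy
      rwa [Prod.mk_add_mk, add_zero] at this
    | smul h x _ hx =>
      have := N.smul_mem ((h, 0) : H₁ × H₂) hx
      rwa [show ((h, 0) : H₁ × H₂) • (x, (0 : T₂)) = (h • x, 0) from
        Prod.ext rfl (smul_zero _)] at this
  have h2 : ∀ y : T₂, ((0 : T₁), y) ∈ N := fun x => by
    have hx : x ∈ Submodule.span H₂ (Set.range w) := hw ▸ trivial
    induction hx using Submodule.span_induction with
    | mem x hx =>
      obtain ⟨j, rfl⟩ := hx
      exact Submodule.subset_span (Or.inr ⟨j, rfl⟩)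
    | zero => exact N.zero_mem
    | add x y _ _ hx hy =>
      have := N.add_mem hx hy
      rwa [Prod.mk_add_mk, add_zero] at this
    | smul h x _ hx =>
      have := N.smul_mem ((0, h) : H₁ × H₂) hx
      rwa [show ((0, h) : H₁ × H₂) • ((0 : T₁), x) = (0, h • x) from
        Prod.ext (smul_zero _) rfl] at this
  refine Module.Finite.of_fg_top ?_
  rw [show (⊤ : Submodule (H₁ × H₂) (T₁ × T₂)) = N from (eq_top_iff.2 fun x _ => by
    have := N.add_mem (h1 x.1) (h2 x.2)
    rwa [Prod.mk_add_mk, add_zero, zero_add] at this).symm]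
  exact Submodule.fg_span ((Set.finite_range _).union (Set.finite_range _))

/-- The idempotents (1,0) and (0,1) cut any extension problem over H₁ × H₂ into one over each
factor, where rigidity applies. The coresolutions are multiplied componentwise. -/
theorem IsOneTilting.prodOver (h₁ : IsHereditary H₁) (h₂ : IsHereditary H₂)
    (ht₁ : IsOneTilting H₁ T₁) (ht₂ : IsOneTilting H₂ T₂) :
    IsOneTilting (H₁ × H₂) (T₁ × T₂) := by
  have := ht₁.finite
  have := ht₂.finite
  have := finite_prodOver (H₁ := H₁) (H₂ := H₂) (T₁ := T₁) (T₂ := T₂)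
  refine (h₁.prod h₂).isOneTilting (fun n p hp g => ?_) ?_
  · have hfst : ∀ {K : Type u} [AddCommGroup K] [Module (H₁ × H₂) K]
        (q : K →ₗ[H₁ × H₂] T₁ × T₂) (x : K), (q x).1 = (q (((1, 0) : H₁ × H₂) • x)).1 := by
      intro K _ _ q x
      rw [map_smul]
      exact (one_smul H₁ _).symm
    have hsnd : ∀ {K : Type u} [AddCommGroup K] [Module (H₁ × H₂) K]
        (q : K →ₗ[H₁ × H₂] T₁ × T₂) (x : K), (q x).2 = (q (((0, 1) : H₁ × H₂) • x)).2 := by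
      intro K _ _ q x
      rw [map_smul]
      exact (one_smul H₂ _).symm
    let ι₁ : (Fin n → H₁) → (Fin n → H₁ × H₂) := fun x j => (x j, 0)
    let ι₂ : (Fin n → H₂) → (Fin n → H₁ × H₂) := fun x j => (0, x j)
    have add₁ : ∀ x y, ι₁ (x + y) = ι₁ x + ι₁ y := fun x y =>
      funext fun j => Prod.ext rfl (add_zero 0).symm
    have add₂ : ∀ x y, ι₂ (x + y) = ι₂ x + ι₂ y := fun x y =>
      funext fun j => Prod.ext (add_zero 0).symm rfl
    have smul₁ : ∀ (h : H₁) x, ι₁ (h • x) = ((h, 0) : H₁ × H₂) • ι₁ x := fun h x =>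
      funext fun j => Prod.ext rfl (mul_zero 0).symm
    have smul₂ : ∀ (h : H₂) x, ι₂ (h • x) = ((0, h) : H₁ × H₂) • ι₂ x := fun h x =>
      funext fun j => Prod.ext (mul_zero 0).symm rfl
    have e₁ : ∀ x : Fin n → H₁ × H₂, ι₁ (fun j => (x j).1) = ((1, 0) : H₁ × H₂) • x := fun x =>
      funext fun j => Prod.ext (one_mul _).symm (zero_mul _).symm
    have e₂ : ∀ x : Fin n → H₁ × H₂, ι₂ (fun j => (x j).2) = ((0, 1) : H₁ × H₂) • x := fun x =>
      funext fun j => Prod.ext (zero_mul _).symm (one_mul _).symm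
    let p₁ : (Fin n → H₁) →ₗ[H₁] T₁ :=
      { toFun := fun x => (p (ι₁ x)).1
        map_add' := fun x y => by rw [add₁, map_add, Prod.fst_add]
        map_smul' := fun h x => by
          rw [smul₁, map_smul]
          rfl }
    let p₂ : (Fin n → H₂) →ₗ[H₂] T₂ :=
      { toFun := fun x => (p (ι₂ x)).2
        map_add' := fun x y => by rw [add₂, map_add, Prod.snd_add]
        map_smul' := fun h x => by
          rw [smul₂, map_smul]
          rfl }
    have hp₁ : Function.Surjective p₁ := fun t => by
      obtain ⟨x, hx⟩ := hp (t, 0)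
      refine ⟨fun j => (x j).1, ?_⟩
      change (p (ι₁ _)).1 = t
      rw [e₁, ← hfst, hx]
    have hp₂ : Function.Surjective p₂ := fun t => by
      obtain ⟨x, hx⟩ := hp (0, t)
      refine ⟨fun j => (x j).2, ?_⟩
      change (p (ι₂ _)).2 = t
      rw [e₂, ← hsnd, hx]
    have k₁ : ∀ x : LinearMap.ker p₁, ι₁ x ∈ LinearMap.ker p := fun x => by
      refine Prod.ext x.2 ?_
      rw [hsnd, show ((0, 1) : H₁ × H₂) • ι₁ x = 0 from
        funext fun j => Prod.ext (zero_mul _) (mul_zero _), map_zero]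
    have k₂ : ∀ x : LinearMap.ker p₂, ι₂ x ∈ LinearMap.ker p := fun x => by
      refine Prod.ext ?_ x.2
      rw [hfst, show ((1, 0) : H₁ × H₂) • ι₂ x = 0 from
        funext fun j => Prod.ext (mul_zero _) (zero_mul _), map_zero]
    let g₁ : LinearMap.ker p₁ →ₗ[H₁] T₁ :=
      { toFun := fun x => (g ⟨ι₁ x, k₁ x⟩).1
        map_add' := fun x y => by
          rw [← Prod.fst_add, ← map_add]
          exact congrArg (fun z => (g z).1) (Subtype.ext (add₁ _ _))
        map_smul' := fun h x => by
          have : (⟨ι₁ (h • x : LinearMap.ker p₁), k₁ _⟩ : LinearMap.ker p)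
            = ((h, 0) : H₁ × H₂) • ⟨ι₁ x, k₁ x⟩ := Subtype.ext (smul₁ _ _)
          rw [this, map_smul]
          rfl }
    let g₂ : LinearMap.ker p₂ →ₗ[H₂] T₂ :=
      { toFun := fun x => (g ⟨ι₂ x, k₂ x⟩).2
        map_add' := fun x y => by
          rw [← Prod.snd_add, ← map_add]
          exact congrArg (fun z => (g z).2) (Subtype.ext (add₂ _ _))
        map_smul' := fun h x => by
          have : (⟨ι₂ (h • x : LinearMap.ker p₂), k₂ _⟩ : LinearMap.ker p)
            = ((0, h) : H₁ × H₂) • ⟨ι₂ x, k₂ x⟩ := Subtype.ext (smul₂ _ _)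
          rw [this, map_smul]
          rfl }
    obtain ⟨f₁, hf₁⟩ := exists_extend_of_ext_one (ht₁.ext_eq_zero 1 le_rfl)
      (LinearMap.ker p₁).subtype p₁ Subtype.val_injective (LinearMap.exact_subtype_ker_map p₁)
      hp₁ g₁
    obtain ⟨f₂, hf₂⟩ := exists_extend_of_ext_one (ht₂.ext_eq_zero 1 le_rfl)
      (LinearMap.ker p₂).subtype p₂ Subtype.val_injective (LinearMap.exact_subtype_ker_map p₂)
      hp₂ g₂
    let f : (Fin n → H₁ × H₂) →ₗ[H₁ × H₂] T₁ × T₂ :=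
      { toFun := fun x => (f₁ fun j => (x j).1, f₂ fun j => (x j).2)
        map_add' := fun x y => Prod.ext (map_add f₁ (fun j => (x j).1) fun j => (y j).1)
          (map_add f₂ (fun j => (x j).2) fun j => (y j).2)
        map_smul' := fun h x => Prod.ext (map_smul f₁ h.1 fun j => (x j).1)
          (map_smul f₂ h.2 fun j => (x j).2) }
    refine ⟨f, fun x => Prod.ext ?_ ?_⟩
    · have hx : (fun j => ((x : Fin n → H₁ × H₂) j).1) ∈ LinearMap.ker p₁ := by
        change (p (ι₁ _)).1 = 0
        rw [e₁, ← hfst, LinearMap.mem_ker.1 x.2]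
        rfl
      refine (LinearMap.congr_fun hf₁ ⟨_, hx⟩).trans ?_
      rw [hfst g]
      exact congrArg (fun z => (g z).1) (Subtype.ext (e₁ x))
    · have hx : (fun j => ((x : Fin n → H₁ × H₂) j).2) ∈ LinearMap.ker p₂ := by
        change (p (ι₂ _)).2 = 0
        rw [e₂, ← hsnd, LinearMap.mem_ker.1 x.2]
        rfl
      refine (LinearMap.congr_fun hf₂ ⟨_, hx⟩).trans ?_
      rw [hsnd g]
      exact congrArg (fun z => (g z).2) (Subtype.ext (e₂ x))
  · obtain ⟨X₁, Y₁, f₁, g₁, hX₁, hY₁, hf₁, hfg₁, hg₁⟩ := ht₁.exists_coresolution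
    obtain ⟨X₂, Y₂, f₂, g₂, hX₂, hY₂, hf₂, hfg₂, hg₂⟩ := ht₂.exists_coresolution
    refine ⟨ModuleCat.of (H₁ × H₂) (X₁ × X₂), ModuleCat.of (H₁ × H₂) (Y₁ × Y₂),
      { toFun := fun x => (f₁ x.1, f₂ x.2)
        map_add' := fun x y => Prod.ext (map_add f₁ _ _) (map_add f₂ _ _)
        map_smul' := fun h x => Prod.ext (map_smul f₁ _ _) (map_smul f₂ _ _) },
      prodMapOver g₁ g₂, hX₁.prodOver hX₂, hY₁.prodOver hY₂, ?_, fun x => ?_, ?_⟩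
    · exact fun x y h => Prod.ext (hf₁ (congrArg Prod.fst h)) (hf₂ (congrArg Prod.snd h))
    · constructor
      · intro h
        obtain ⟨y₁, hy₁⟩ := (hfg₁ _).1 (congrArg Prod.fst h)
        obtain ⟨y₂, hy₂⟩ := (hfg₂ _).1 (congrArg Prod.snd h)
        exact ⟨(y₁, y₂), Prod.ext hy₁ hy₂⟩
      · rintro ⟨y, rfl⟩
        exact Prod.ext (hfg₁.apply_apply_eq_zero _) (hfg₂.apply_apply_eq_zero _)
    · rintro ⟨y₁, y₂⟩
      obtain ⟨x₁, rfl⟩ := hg₁ y₁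
      obtain ⟨x₂, rfl⟩ := hg₂ y₂
      exact ⟨(x₁, x₂), rfl⟩

/-- A product of two tilted algebras is tilted. -/
theorem IsTiltedAlgebra.prod {R : Type v} [CommRing R] {A B : Type u} [Ring A] [Algebra R A]
    [Ring B] [Algebra R B] (hA : IsTiltedAlgebra R A) (hB : IsTiltedAlgebra R B) :
    IsTiltedAlgebra R (A × B) := by
  obtain ⟨H₁, _, _, T₁, _, _, _, _, fin₁, h₁, ht₁, ⟨e₁⟩⟩ := hA
  obtain ⟨H₂, _, _, T₂, _, _, _, _, fin₂, h₂, ht₂, ⟨e₂⟩⟩ := hB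
  have : IsScalarTower R (H₁ × H₂) (T₁ × T₂) :=
    ⟨fun r h x => Prod.ext (smul_assoc r h.1 x.1) (smul_assoc r h.2 x.2)⟩
  let φ : A × B →ₐ[R] Module.End (H₁ × H₂) (T₁ × T₂) :=
    { toFun := fun x => prodMapOver (e₁ x.1) (e₂ x.2)
      map_one' := LinearMap.ext fun t => by
        rw [prodMapOver_apply, Prod.fst_one, Prod.snd_one, map_one, map_one]
        rfl
      map_mul' := fun x y => LinearMap.ext fun t => by
        rw [prodMapOver_apply, Prod.fst_mul, Prod.snd_mul, map_mul, map_mul]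
        rfl
      map_zero' := LinearMap.ext fun t => by
        rw [prodMapOver_apply, Prod.fst_zero, Prod.snd_zero, map_zero, map_zero]
        rfl
      map_add' := fun x y => LinearMap.ext fun t => by
        rw [prodMapOver_apply, Prod.fst_add, Prod.snd_add, map_add, map_add]
        rfl
      commutes' := fun r => LinearMap.ext fun t => by
        rw [prodMapOver_apply, Prod.algebraMap_apply, AlgEquiv.commutes, AlgEquiv.commutes]
        rfl }
  refine ⟨H₁ × H₂, inferInstance, inferInstance, T₁ × T₂, inferInstance, inferInstance,
    inferInstance, inferInstance, inferInstance, h₁.prod h₂, ht₁.prodOver h₁ h₂ ht₂,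
    ⟨AlgEquiv.ofBijective φ ⟨fun x y hxy => ?_, fun θ => ?_⟩⟩⟩
  · refine Prod.ext (e₁.injective (LinearMap.ext fun t => ?_))
      (e₂.injective (LinearMap.ext fun t => ?_))
    · exact congrArg Prod.fst (LinearMap.congr_fun hxy (t, 0))
    · exact congrArg Prod.snd (LinearMap.congr_fun hxy (0, t))
  -- An endomorphism commutes with (1,0) and (0,1), so it is diagonal.
  · have hθ₁ : ∀ t, (θ t).1 = (θ (t.1, 0)).1 := fun t => by
      rw [show ((t.1, 0) : T₁ × T₂) = ((1, 0) : H₁ × H₂) • t from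
        Prod.ext (one_smul _ _).symm (zero_smul _ _).symm, map_smul]
      exact (one_smul H₁ _).symm
    have hθ₂ : ∀ t, (θ t).2 = (θ (0, t.2)).2 := fun t => by
      rw [show ((0, t.2) : T₁ × T₂) = ((0, 1) : H₁ × H₂) • t from
        Prod.ext (zero_smul _ _).symm (one_smul _ _).symm, map_smul]
      exact (one_smul H₂ _).symm
    let θ₁ : T₁ →ₗ[H₁] T₁ :=
      { toFun := fun t => (θ (t, 0)).1
        map_add' := fun s t => by
          rw [← Prod.fst_add, ← map_add, Prod.mk_add_mk, add_zero]
        map_smul' := fun h t => by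
          rw [show ((h • t, 0) : T₁ × T₂) = ((h, 0) : H₁ × H₂) • (t, 0) from
            Prod.ext rfl (smul_zero _).symm, map_smul]
          rfl }
    let θ₂ : T₂ →ₗ[H₂] T₂ :=
      { toFun := fun t => (θ (0, t)).2
        map_add' := fun s t => by
          rw [← Prod.snd_add, ← map_add, Prod.mk_add_mk, add_zero]
        map_smul' := fun h t => by
          rw [show ((0, h • t) : T₁ × T₂) = ((0, h) : H₁ × H₂) • (0, t) from
            Prod.ext (smul_zero _).symm rfl, map_smul]
          rfl }
    refine ⟨(e₁.symm θ₁, e₂.symm θ₂), LinearMap.ext fun t => ?_⟩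
    change (e₁ (e₁.symm θ₁) t.1, e₂ (e₂.symm θ₂) t.2) = θ t
    rw [AlgEquiv.apply_symm_apply, AlgEquiv.apply_symm_apply]
    exact Prod.ext (hθ₁ t).symm (hθ₂ t).symm

end Product

/-! ### M is faithful over B and generates A -/

namespace CentralBimodule

open BalancedTensor

variable {R : Type v} [CommRing R] {A B : Type u} [Ring A] [Algebra R A] [Ring B] [Algebra R B]

/-- If b kills M on the right it kills N ⊗ M on the right, and so its summand B. -/
theorem eq_zero_of_op_smul_eq_zero {M : CentralBimodule R A B} {N : CentralBimodule R B A}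
    {Q : CentralBimodule R B B} (e : BalancedTensor B A N M ≃ₗ[B] B × Q)
    (he : ∀ (b : Bᵐᵒᵖ) (t : BalancedTensor B A N M), e (N.tensorRight M b t) = b • e t) {b : B}
    (hb : ∀ m : M, MulOpposite.op b • m = 0) : b = 0 := by
  have h : N.tensorRight M (MulOpposite.op b) (e.symm (1, 0)) = 0 := by
    have : N.tensorRight M (MulOpposite.op b) = 0 := linearMap_ext fun n m => by
      change tmul n (MulOpposite.op b • m) = 0
      rw [hb, BalancedTensor.tmul_zero]
    rw [this, LinearMap.zero_apply]
  have h2 := he (MulOpposite.op b) (e.symm (1, 0))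
  rw [h, LinearEquiv.apply_symm_apply, _root_.map_zero] at h2
  have h3 : (0 : B) = 1 * b := congrArg Prod.fst h2
  rw [h3, one_mul]

/-- Each n ∈ N gives a functional m ↦ π(m ⊗ n), so π takes values in the trace of M. With π the
projection of M ⊗ N onto A this puts 1 in the trace. -/
theorem exists_sum_eq (M : CentralBimodule R A B) (N : CentralBimodule R B A)
    (π : BalancedTensor A B M N →ₗ[A] A) (t : BalancedTensor A B M N) :
    ∃ (n : ℕ) (α : Fin n → M →ₗ[A] A) (m : Fin n → M), ∑ j, α j (m j) = π t := by
  induction t using BalancedTensor.induction with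
  | h0 => exact ⟨0, Fin.elim0, Fin.elim0, (_root_.map_zero π).symm⟩
  | htmul m n =>
    refine ⟨1, fun _ => π ∘ₗ mkLeft A B n, fun _ => m, ?_⟩
    rw [Finset.sum_const, Finset.card_univ, Fintype.card_fin, one_smul]
    rfl
  | hadd s t hs ht =>
    obtain ⟨n, α, m, h⟩ := hs
    obtain ⟨n', α', m', h'⟩ := ht
    refine ⟨n + n', Fin.append α α', Fin.append m m', ?_⟩
    rw [Fin.sum_univ_add, _root_.map_add, ← h, ← h']
    simp only [Fin.append_left, Fin.append_right]

end CentralBimodule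

theorem memAdd_hom_of_sum_eq_one {A H T M : Type u} [Ring A] [Ring H] [AddCommGroup T] [Module A T]
    [Module H T] [SMulCommClass A H T] [AddCommGroup M] [Module A M] {n : ℕ}
    (α : Fin n → M →ₗ[A] A) (m : Fin n → M) (h : ∑ j, α j (m j) = 1) :
    MemAdd H (M →ₗ[A] T) T :=
  MemAdd.of_sum
    (fun j => ⟨⟨fun t => LinearMap.toSpanSingleton A T t ∘ₗ α j,
      fun s t => LinearMap.ext fun y => smul_add _ _ _⟩,
      fun a t => LinearMap.ext fun y => smul_comm _ _ _⟩)
    (fun j => ⟨⟨fun φ => φ (m j), fun φ ψ => rfl⟩, fun a φ => rfl⟩) fun t => by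
      change ∑ j, α j (m j) • t = t
      rw [← Finset.sum_smul, h, one_smul]

theorem CentralIdempotent.isSemisimpleRing_factor {B : Type u} [Ring B] (ε : CentralIdempotent B)
    (h : IsSemisimpleModule B ε.Factor) : IsSemisimpleRing ε.Factor := by
  let l : ε.Factor →ₛₗ[Ideal.Quotient.mk ε.ideal] ε.Factor :=
    { toFun := fun x => x
      map_add' := fun _ _ => rfl
      map_smul' := fun b x => (ε.mk_smul b x).symm }
  exact (LinearMap.isSemisimpleModule_iff_of_bijective l Function.bijective_id).1 h

/-! ### Transfer of tiltedness -/

section TiltedTransfer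

theorem StablyEquivalentOfAdjointType.symm {R : Type v} [CommRing R] {Λ Γ : Type u} [Ring Λ] [Algebra R Λ] [Ring Γ]
    [Algebra R Γ] (h : StablyEquivalentOfAdjointType R Λ Γ) :
    StablyEquivalentOfAdjointType R Γ Λ := by
  obtain ⟨M, N, P, Q, hM, hN, hP, hQ, eP, eQ, a, a'⟩ := h
  exact ⟨N, M, Q, P, hN, hM, hQ, hP, eQ, eP, a', a⟩

open CentralBimodule

variable {R : Type v} [CommRing R] [IsArtinianRing R] {A B : Type u} [Ring A] [Algebra R A]
  [Module.Finite R A] [Ring B] [Algebra R B] [Module.Finite R B]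
  {M : CentralBimodule R A B} {N : CentralBimodule R B A} {Q : CentralBimodule R B B}

theorem CentralBimodule.StableAdjunction.isSemisimpleModule_of_actsAsEnd
    (S : StableAdjunction M N Q) {H T : Type u} [Ring H] [AddCommGroup T] [Module A T] [Module H T]
    [SMulCommClass A H T] (h : ActsAsEnd A H T) [IsArtinianRing H] (hH : IsHereditary H)
    [Module.Finite H T]
    (hext : Subsingleton (Abelian.Ext.{u} (ModuleCat.of H T) (ModuleCat.of H T) 1)) :
    IsSemisimpleModule B (BalancedTensor B B Q B) := by
  have : IsArtinianRing A := IsArtinianRing.of_finite R A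
  have := S.finite
  have := S.finite_left
  have := S.projective_tensor (X := B)
  have := S.injective_tensor (Y := B)
  have := projective_of_adj S.adj (BalancedTensor B B Q B)
  have := injective_of_adj S.adj' (fun f hf => map_injective_of_adj S.adj f hf)
    (BalancedTensor B B Q B)
  refine S.isSemisimpleModule_tensor (h.isSemisimpleModule hH hext fun W hW => ?_)
  refine S.exists_ne_zero W fun hbot => ?_
  have := IsSimpleModule.nontrivial A W
  rw [hbot] at this
  exact not_subsingleton (⊥ : Submodule A (BalancedTensor A B M (BalancedTensor B B Q B)))
    inferInstance

/-- With U = Hom_A(M, T) and c acting on U as ε in H, b ↦ (its action on εU, its class modulo Bc) is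
an isomorphism of B with End(εU) × B/Bc. -/
theorem CentralBimodule.StableAdjunction.isTiltedAlgebra (S : StableAdjunction M N Q)
    [Module.Projective A M] {n : ℕ} (α : Fin n → M →ₗ[A] A) (m : Fin n → M)
    (hαm : ∑ j, α j (m j) = 1) {H T : Type u} [Ring H] [Algebra R H] [Module.Finite R H]
    [AddCommGroup T] [Module A T] [Module H T] [SMulCommClass A H T] (h : ActsAsEnd A H T)
    (hR : ∀ (r : R) (t : T), algebraMap R A r • t = algebraMap R H r • t) (hH : IsHereditary H)
    (hT : IsOneTilting H T) : IsTiltedAlgebra R B := by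
  have : IsArtinianRing H := IsArtinianRing.of_finite R H
  have := hT.finite
  have := S.finite
  have := S.finite_left
  have hextT := hT.ext_eq_zero 1 le_rfl
  have := S.projective_tensor (X := B)
  have := S.injective_tensor (Y := B)
  have := S.isSemisimpleModule_of_actsAsEnd h hH hextT
  obtain ⟨c, hcc, hcomm, hcV, hss⟩ :=
    exists_central_idempotent R (B := B) (V := BalancedTensor B B Q B)
  have hend := fun φ => S.exists_smul_eq hcc hcomm hcV φ
  have hTU : MemAdd H T (M →ₗ[A] T) := memAdd_hom
  have hUT : MemAdd H (M →ₗ[A] T) T := memAdd_hom_of_sum_eq_one α m hαm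
  have hfinU : Module.Finite H (M →ₗ[A] T) := hTU.finite hT.finite
  have hextU := subsingleton_ext_one_of_memAdd hextT hTU hTU
  have hcores : ∃ (T₀ T₁ : ModuleCat.{u} H) (f : H →ₗ[H] T₀) (g : T₀ →ₗ[H] T₁),
      MemAdd H (M →ₗ[A] T) T₀ ∧ MemAdd H (M →ₗ[A] T) T₁ ∧
      Function.Injective f ∧ Function.Exact f g ∧ Function.Surjective g := by
    obtain ⟨T₀, T₁, f, g, h₀, h₁, hfg⟩ := hT.exists_coresolution
    exact ⟨T₀, T₁, f, g, hUT.trans h₀, hUT.trans h₁, hfg⟩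
  obtain ⟨ε₀, hε₁, hε₂, hε₃⟩ := exists_central_idempotent_smul_eq hextU hcores
    (precompHom H T (M.rightMul (MulOpposite.op c)))
    (fun u => LinearMap.ext fun m => by
      change u (MulOpposite.op c • MulOpposite.op c • m) = u (MulOpposite.op c • m)
      rw [smul_smul, ← MulOpposite.op_mul, hcc])
    (fun θ u => by
      obtain ⟨φ, rfl⟩ := h.exists_precompHom θ
      obtain ⟨a, -, ha⟩ := hend φ
      refine LinearMap.ext fun m => ?_
      change u (φ (MulOpposite.op c • m)) = u (MulOpposite.op c • φ m)
      rw [(ha m).1, (ha m).2])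
  let ε : CentralIdempotent H := ⟨ε₀, hε₁, hε₂⟩
  -- The complementary idempotent is used so that the ideal of δ is Bc and its factor is the
  -- semisimple B/Bc.
  let δ : CentralIdempotent B := ⟨1 - c, by rw [mul_sub, mul_one, sub_mul, one_mul, hcc, sub_self,
    sub_zero], fun b => by rw [sub_mul, mul_sub, one_mul, mul_one, hcomm]⟩
  have hδ : δ.ideal = Submodule.span B {c} := by
    ext b
    rw [δ.mem_ideal, Submodule.mem_span_singleton]
    change b * (1 - c) = 0 ↔ _
    rw [mul_sub, mul_one, sub_eq_zero]
    refine ⟨fun hb => ⟨b, hb.symm⟩, ?_⟩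
    rintro ⟨a, rfl⟩
    rw [smul_eq_mul, mul_assoc, hcc]
  have hssδ : IsSemisimpleRing δ.Factor := δ.isSemisimpleRing_factor (by
    change IsSemisimpleModule B (B ⧸ δ.ideal)
    rw [hδ]
    exact hss)
  have hfinδ : Module.Finite R δ.Factor := inferInstance
  have hfinε : Module.Finite R ε.Factor := inferInstance
  let U := ε.part (M →ₗ[A] T)
  have hU : ∀ (u : U) m, (u : M →ₗ[A] T) (MulOpposite.op c • m) = (u : M →ₗ[A] T) m := fun u m =>
    LinearMap.congr_fun ((hε₃ u).symm.trans u.2) m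
  let _ : Module R U := restrictModule R ε.Factor U
  have _ : IsScalarTower R ε.Factor U := restrictModule_isScalarTower R ε.Factor U
  let ρ : B → Module.End ε.Factor U := fun b =>
    ε.extendScalars (ε.partMap (precompHom H T (M.rightMul (MulOpposite.op b))))
  have hρ : ∀ b (u : U) m, (ρ b u : M →ₗ[A] T) m = (u : M →ₗ[A] T) (MulOpposite.op b • m) :=
    fun b u m => LinearMap.congr_fun
      (ε.coe_partMap (precompHom H T (M.rightMul (MulOpposite.op b))) u) m
  let ρ' : B →ₐ[R] Module.End ε.Factor U :=
    { toFun := ρ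
      map_one' := LinearMap.ext fun u => Subtype.ext (LinearMap.ext fun m => by
        rw [hρ, MulOpposite.op_one, one_smul]
        rfl)
      map_mul' := fun b b' => LinearMap.ext fun u => Subtype.ext (LinearMap.ext fun m => by
        change _ = (ρ b (ρ b' u) : M →ₗ[A] T) m
        rw [hρ, hρ, hρ, MulOpposite.op_mul, mul_smul])
      map_zero' := LinearMap.ext fun u => Subtype.ext (LinearMap.ext fun m => by
        rw [hρ, MulOpposite.op_zero, zero_smul, map_zero]
        rfl)
      map_add' := fun b b' => LinearMap.ext fun u => Subtype.ext (LinearMap.ext fun m => by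
        change _ = (ρ b u : M →ₗ[A] T) m + (ρ b' u : M →ₗ[A] T) m
        rw [hρ, hρ, hρ, MulOpposite.op_add, add_smul, map_add])
      commutes' := fun r => LinearMap.ext fun u => Subtype.ext (LinearMap.ext fun m => by
        rw [hρ, ← M.central, map_smul, hR]
        rfl) }
  have htilt : IsTiltedAlgebra R (Module.End ε.Factor U) :=
    ⟨ε.Factor, inferInstance, inferInstance, U, inferInstance, inferInstance, inferInstance,
      inferInstance, hfinε, ε.isHereditary_factor hH, ε.isOneTilting_part hH hextU hcores,
      ⟨AlgEquiv.refl⟩⟩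
  have hss' : IsTiltedAlgebra R δ.Factor := isTiltedAlgebra_of_isSemisimpleRing
  refine (htilt.prod hss').of_algEquiv
    (AlgEquiv.ofBijective (ρ'.prod (Ideal.Quotient.mkₐ R δ.ideal)) ⟨?_, ?_⟩)
  · refine (injective_iff_map_eq_zero _).2 fun b hb => ?_
    have hb₁ : ρ b = 0 := congrArg Prod.fst hb
    have hb₂ : b * (1 - c) = 0 :=
      δ.mem_ideal.1 (Ideal.Quotient.eq_zero_iff_mem.1 (congrArg Prod.snd hb))
    rw [mul_sub, mul_one, sub_eq_zero] at hb₂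
    -- Here b = bc. Acting as zero on εU, it satisfies f(mb) = 0 for all f : M → T, so mb = 0 since
    -- maps to T separate points of M.
    refine eq_zero_of_op_smul_eq_zero S.decomp S.decomp_op_smul fun m =>
      h.eq_zero_of_forall fun f => ?_
    have h1 := hρ b (ε.toPart _ f) m
    rw [hb₁] at h1
    have h2 : (ε.toPart _ f : M →ₗ[A] T) = precompHom H T (M.rightMul (MulOpposite.op c)) f := hε₃ f
    rw [h2] at h1
    have h3 : (0 : T) = f (MulOpposite.op c • MulOpposite.op b • m) := h1
    rw [smul_smul, ← MulOpposite.op_mul, ← hb₂] at h3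
    exact h3.symm
  · rintro ⟨θ, y⟩
    obtain ⟨b₀, rfl⟩ := Ideal.Quotient.mk_surjective y
    obtain ⟨φ, hφ⟩ := h.exists_precompHom
      (U.subtype ∘ₗ (θ.restrictScalars H) ∘ₗ ε.toPart (M →ₗ[A] T))
    obtain ⟨a, hca, ha⟩ := hend φ
    -- The element a of Bc realises θ on εU and vanishes modulo Bc; b₀(1-c) is zero on εU and
    -- congruent to b₀ modulo Bc.
    refine ⟨a + b₀ * (1 - c), Prod.ext (LinearMap.ext fun u => Subtype.ext
      (LinearMap.ext fun m => ?_)) ?_⟩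
    · have h1 : (θ u : M →ₗ[A] T) = precompHom H T φ u := by
        rw [← hφ]
        change _ = (θ (ε.toPart (M →ₗ[A] T) u) : M →ₗ[A] T)
        rw [ε.toPart_coe]
      have h2 : (θ u : M →ₗ[A] T) m = (u : M →ₗ[A] T) (MulOpposite.op a • m) := by
        rw [← hU (θ u), h1, ← (ha m).1]
        rfl
      refine (hρ _ u m).trans ?_
      refine Eq.trans ?_ h2.symm
      have h3 : (u : M →ₗ[A] T) (MulOpposite.op (b₀ * (1 - c)) • m) = 0 := by
        rw [← hU, smul_smul, ← MulOpposite.op_mul, mul_assoc, sub_mul, one_mul, hcc, sub_self,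
          mul_zero, MulOpposite.op_zero, zero_smul, map_zero]
      rw [MulOpposite.op_add, add_smul, map_add, h3, add_zero]
    · change Ideal.Quotient.mk δ.ideal _ = _
      rw [Ideal.Quotient.eq, δ.mem_ideal]
      change (a + b₀ * (1 - c) - b₀) * (1 - c) = 0
      have hac : a * (1 - c) = 0 := by
        rw [mul_sub, mul_one, ← hcomm, hca, sub_self]
      rw [sub_mul, add_mul, hac, zero_add, mul_assoc, δ.mul_self, sub_self]

theorem StablyEquivalentOfAdjointType.isTiltedAlgebra
    (h : StablyEquivalentOfAdjointType R A B) (hA : IsTiltedAlgebra R A) :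
    IsTiltedAlgebra R B := by
  have hnil : ∀ r : R, IsNilpotent r → algebraMap R A r = 0 := fun r hr =>
    hA.algebraMap_eq_zero hr
  obtain ⟨H, _, _, T, _, _, _, _, hfin, hH, hT, ⟨e⟩⟩ := hA
  obtain ⟨M, N, P, Q, hM, hN, -, hQ, ⟨eP, -⟩, ⟨eQ, heQ⟩, ⟨adj⟩, ⟨adj'⟩⟩ := h
  have := hM.projective_left
  let S : StableAdjunction M N Q :=
    { finite_left := hM.finite_left
      finite_right := hN.finite_left
      isProjective := hQ
      decomp := eQ
      decomp_op_smul := heQ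
      adj := adj
      adj' := adj'
      algebraMap_eq_zero := fun r hr =>
        eq_zero_of_op_smul_eq_zero (N := N) eQ heQ fun m : M => by
          rw [← M.central, hnil r hr, zero_smul] }
  -- Only the summand A of M ⊗ N matters here: the tensor corresponding to (1, 0) puts 1 in the
  -- trace of M.
  obtain ⟨n, α, m, hαm⟩ := exists_sum_eq M N (LinearMap.fst A A P ∘ₗ eP.toLinearMap)
    (eP.symm (1, 0))
  have h1 : ∑ j, α j (m j) = 1 := by
    rw [hαm]
    exact congrArg Prod.fst (eP.apply_symm_apply (1, 0))
  let _ : Module A T := Module.compHom T (e : A →+* Module.End H T)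
  have hsmul : ∀ (a : A) (t : T), a • t = e a t := fun a t => rfl
  have : SMulCommClass A H T := ⟨fun a x t => map_smul (e a) x t⟩
  refine S.isTiltedAlgebra α m h1 (T := T) ⟨fun a ha => ?_, fun θ => ⟨e.symm θ, fun t => ?_⟩⟩
    (fun r t => ?_) hH hT
  · refine e.injective ((LinearMap.ext ha).trans (map_zero e).symm)
  · rw [hsmul, AlgEquiv.apply_symm_apply]
  · rw [hsmul, AlgEquiv.commutes, algebraMap_smul]
    rfl

end TiltedTransfer

theorem corollary3p8 (R : Type v) [CommRing R] [IsArtinianRing R]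
    (Λ Γ : Type u) [Ring Λ] [Algebra R Λ] [Module.Finite R Λ]
    [Ring Γ] [Algebra R Γ] [Module.Finite R Γ]
    (h : StablyEquivalentOfAdjointType R Λ Γ) :
    IsTiltedAlgebra R Λ ↔ IsTiltedAlgebra R Γ :=
  ⟨h.isTiltedAlgebra, h.symm.isTiltedAlgebra⟩
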